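/- Throughout, $\inf$ and $\sup$ of a measurable function denote its essential infimum and essential supremum. Let $\mathcal B$ be the set of $2\pi$-periodic $a\in L^\infty(\mathbb R)$ with $\inf a>0$; for $L>1$ let $\mathcal B(L)$ be the set of $2\pi$-periodic $L^\infty$ functions $a$ with $\inf a=1$ and $\sup a=L$. For $a,b\in\mathcal B$ let $C(a,b)>0$ be the best (smallest) constant in the inequality $$\int_0^{2\pi}a\,w^2\le C(a,b)\int_0^{2\pi}b\,w'^2\qquad(1)$$ for all $2\pi$-periodic $w\in H^1_{\mathrm{loc}}(\mathbb R)$ satisfying $$\int_0^{2\pi}a\,w=0.\qquad(2)$$ For $L>1$ let $\bar a=\bar a_L$ be the $2\pi$-periodic function equal to $1$ on $[0,\frac{\pi}{2})\cup[\pi,\frac{3\pi}{2})$ and to $L$ on $[\frac{\pi}{2},\pi)\cup[\frac{3\pi}{2},2\pi)$. Let $a,b\in\mathcal B$. Then: (i) The best constant $C(a,b)$ exists and $$C(a,b)\le\left(\frac{\frac1{2\pi}\int_0^{2\pi}\sqrt{a/b}}{\frac4\pi\arctan\left(\left(\frac{\inf ab}{\sup ab}\right)^{1/4}\right)}\right)^2.$$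 (ii) Let $c=\frac1{2\pi}\int_0^{2\pi}\sqrt{a/b}$ and $\tau(\theta)=\frac1c\int_0^\theta\sqrt{a/b}$. Then $\tau$ is a homeomorphism of $\mathbb R$; let $\theta(\tau)$ denote its inverse. If $L>1$ and $\sqrt{ab}\in\mathcal B(L)$, then $$\sup_{a',b'\in\mathcal B,\ \sqrt{a'b'}\in\mathcal B(L)}\frac{C(a',b')}{\left(\frac1{2\pi}\int_0^{2\pi}\sqrt{a'/b'}\right)^2}=\left(\frac4\pi\arctan L^{-1/2}\right)^{-2},$$ and $$\frac{C(a,b)}{\left(\frac1{2\pi}\int_0^{2\pi}\sqrt{a/b}\right)^2}=\sup_{a',b'\in\mathcal B,\ \sqrt{a'b'}\in\mathcal B(L)}\frac{C(a',b')}{\left(\frac1{2\pi}\int_0^{2\pi}\sqrt{a'/b'}\right)^2}=\left(\frac4\pi\arctan L^{-1/2}\right)^{-2}$$ holds if and only if there is $\varphi\in\mathbb R$ such that $a(\theta(\tau))\,b(\theta(\tau))=\bar a^2(\tau+\varphi)$ for a.e. $\tau\in(0,2\pi)$. (iii) If $b=a^{-1}$, then $C(a,a^{-1})=\left(\frac1{2\pi}\int_0^{2\pi}a\right)^2$.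 Moreover, a function $w$ that does not vanish almost everywhere is a $2\pi$-periodic $H^1_{\mathrm{loc}}(\mathbb R)$ function satisfying (2) for which equality holds in (1) with $b=a^{-1}$ if and only if, almost everywhere, $$w(\theta)=C\cos\left(\frac{2\pi}{\int_0^{2\pi}a}\int_0^\theta a+\varphi\right)$$ for some $C\neq0$ and $\varphi\in\mathbb R$. -/

import Mathlib

open MeasureTheory Set

noncomputable section

namespace Wirtinger

/-- `f` is `2π`-periodic, as an almost-everywhere class of functions on `ℝ`. -/
def AEPeriodic (f : ℝ → ℝ) : Prop :=
  ∀ᵐ x ∂(volume : Measure ℝ), f (x + 2 * Real.pi) = f x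

/-- The class `𝓑` of weights: `L^∞(ℝ)` functions that are `2π`-periodic and have
positive essential infimum. -/
structure MemB (a : ℝ → ℝ) : Prop where
  memLp : MemLp a ⊤ volume
  periodic : AEPeriodic a
  essInf_pos : 0 < essInf a volume

/-- The class `𝓑(L)`: `2π`-periodic `L^∞` functions whose essential infimum is `1` and whose
essential supremum is `L`. -/
structure MemBL (L : ℝ) (a : ℝ → ℝ) : Prop where
  memLp : MemLp a ⊤ volume
  periodic : AEPeriodic a
  essInf_eq : essInf a volume = 1
  essSup_eq : essSup a volume = L

/-- `f ∈ L²_loc(ℝ)`. -/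
def MemL2Loc (f : ℝ → ℝ) : Prop :=
  ∀ K : Set ℝ, IsCompact K → MemLp f 2 (volume.restrict K)

/-- `g` is the weak (distributional) derivative of `w` on `ℝ`. -/
def IsWeakDeriv (w g : ℝ → ℝ) : Prop :=
  ∀ η : ℝ → ℝ, ContDiff ℝ (⊤ : ℕ∞) η → HasCompactSupport η →
    ∫ x, w x * deriv η x = -∫ x, g x * η x

/-- `w` belongs to `H¹_loc(ℝ)`, is `2π`-periodic, and has weak derivative `g`. -/
structure IsPeriodicH1 (w g : ℝ → ℝ) : Prop where
  memL2Loc : MemL2Loc w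
  deriv_memL2Loc : MemL2Loc g
  weakDeriv : IsWeakDeriv w g
  periodic : AEPeriodic w

/-- `w` (with weak derivative `g`) is a competitor in the Wirtinger inequality with weight `a`:
a `2π`-periodic `H¹_loc` function with `∫₀^{2π} a w = 0`. -/
structure IsAdmissible (a w g : ℝ → ℝ) : Prop where
  isPeriodicH1 : IsPeriodicH1 w g
  constraint : ∫ x in (0 : ℝ)..(2 * Real.pi), a x * w x = 0

/-- The constants `C > 0` for which `∫₀^{2π} a w² ≤ C ∫₀^{2π} b w'²` for all competitors `w`. -/
def wirtingerConstants (a b : ℝ → ℝ) : Set ℝ :=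
  {C : ℝ | 0 < C ∧ ∀ w g : ℝ → ℝ, IsAdmissible a w g →
    ∫ x in (0 : ℝ)..(2 * Real.pi), a x * w x ^ 2 ≤
      C * ∫ x in (0 : ℝ)..(2 * Real.pi), b x * g x ^ 2}

/-- The best constant `C(a, b)`. -/
def bestConst (a b : ℝ → ℝ) : ℝ := sInf (wirtingerConstants a b)

/-- `(1 / 2π) ∫₀^{2π} √(a / b)`. -/
def meanSqrt (a b : ℝ → ℝ) : ℝ :=
  1 / (2 * Real.pi) * ∫ x in (0 : ℝ)..(2 * Real.pi), Real.sqrt (a x / b x)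

/-- `τ(θ) = (1 / c) ∫₀^θ √(a / b)`, with `c = (1 / 2π) ∫₀^{2π} √(a / b)`. -/
def tau (a b : ℝ → ℝ) (x : ℝ) : ℝ :=
  1 / meanSqrt a b * ∫ y in (0 : ℝ)..x, Real.sqrt (a y / b y)

/-- The normalized best constant `C(a, b) / ((1 / 2π) ∫₀^{2π} √(a / b))²`. -/
def normalizedConst (a b : ℝ → ℝ) : ℝ := bestConst a b / meanSqrt a b ^ 2

/-- The normalized best constants of all pairs `a', b' ∈ 𝓑` with `√(a' b') ∈ 𝓑(L)`. -/
def normalizedConsts (L : ℝ) : Set ℝ :=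
  {r : ℝ | ∃ a' b' : ℝ → ℝ, MemB a' ∧ MemB b' ∧
    MemBL L (fun x => Real.sqrt (a' x * b' x)) ∧ r = normalizedConst a' b'}

/-- The `2π`-periodic step function equal to `1` on `[0, π/2) ∪ [π, 3π/2)` and to `L` on
`[π/2, π) ∪ [3π/2, 2π)`. -/
def stepFun (L x : ℝ) : ℝ :=
  let t := toIcoMod Real.two_pi_pos 0 x
  if t < Real.pi / 2 ∨ (Real.pi ≤ t ∧ t < 3 * Real.pi / 2) then 1 else L

end Wirtinger

end

open Filter Topology
open scoped BoundedContinuousFunction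

/-! The best constant is 1/λ, with λ the smallest positive eigenvalue of the periodic problem (b
w')' + λ a w = 0. Indeed the Rayleigh quotient ∫ a w² / ∫ b w'² attains its maximum, because it is
the squared norm quotient of a compact operator (`exists_maximizer`). Its maximizers satisfy the
Euler-Lagrange equation (`IsCompetitor.exists_isPeriodicSol`), and every periodic eigenfunction with
positive eigenvalue is a competitor whose quotient is the reciprocal of that eigenvalue
(`bestConstSpec`).

The eigenvalue is bounded from below by counting turns in the phase plane. Put s = √(a/b), β =
√(ab)/κ and ω = √λ. Then W = ω κ w and v = b w' satisfy W' = ω (s/β) v, v' = -ω s β W, and the polar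
angle ψ of (v, W) has ψ' = ω s (cos²ψ/β + β sin²ψ). If ρ ≤ β ≤ 1/ρ, the bracket is at most `maxSpeed
ρ ψ`, its value at the better of the two endpoints. The angle increases strictly and a periodic
solution returns to its starting point, so it makes at least one full turn, and at maximal speed a
full turn takes the time 8 arctan ρ. Hence 8 arctan ρ ≤ √λ ∫ √(a/b) (`eight_mul_arctan_le`). With κρ
= √(inf ab) and κ/ρ = √(sup ab) this is (i).

In the case of equality the speed is maximal almost everywhere. So β equals ρ where cos 2ψ > 0 and
1/ρ where cos 2ψ < 0, and the elapsed turning time is proportional to τ. Since all quarter turns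
take the same time, ab is a shifted step function of τ (`exists_shift_of_bestConst_eq`). Conversely,
for a step weight an explicit eigenfunction is glued from sines and cosines (`wave`), and it shows
that the bound is attained (`le_bestConst_of_step`). This gives (ii), the pair a = b = ā being one
extremal.

For b = 1/a the product ab is 1, so ρ = 1 and the upper bound is the squared mean of a. In the
variable ∫ a the equation has constant coefficients, so the extremals are cosines
(`IsPeriodicSol.exists_eq_cos_primitive`). -/

namespace Wirtinger


/-! ### Calculus of absolutely continuous functions. -/

/-- `f` is absolutely continuous on `[a, b]` with almost everywhere derivative `f'`. -/
structure HasACDeriv (f f' : ℝ → ℝ) (a b : ℝ) : Prop where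
  ac : AbsolutelyContinuousOnInterval f a b
  deriv : ∀ᵐ x, x ∈ uIcc a b → HasDerivAt f (f' x) x

theorem _root_.LipschitzOnWith.comp_absolutelyContinuousOnInterval {F f : ℝ → ℝ} {K : NNReal}
    {s : Set ℝ} {a b : ℝ} (hF : LipschitzOnWith K F s) (hf : AbsolutelyContinuousOnInterval f a b)
    (hs : MapsTo f (uIcc a b) s) : AbsolutelyContinuousOnInterval (fun x => F (f x)) a b := by
  unfold AbsolutelyContinuousOnInterval at hf ⊢
  apply squeeze_zero' ?_ ?_ (by simpa using hf.const_mul (K : ℝ))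
  · exact Eventually.of_forall fun _ => Finset.sum_nonneg fun i _ => dist_nonneg
  rw [eventually_inf_principal]
  filter_upwards with E hE
  rw [Finset.mul_sum]
  refine Finset.sum_le_sum fun i hi => ?_
  exact hF.dist_le_mul _ (hs (hE.1 i hi).1) _ (hs (hE.1 i hi).2)

namespace HasACDeriv

variable {f f' g g' : ℝ → ℝ} {a b : ℝ}

theorem continuousOn (h : HasACDeriv f f' a b) : ContinuousOn f (uIcc a b) := h.ac.continuousOn

theorem intervalIntegrable (h : HasACDeriv f f' a b) : IntervalIntegrable f' volume a b := by
  refine h.ac.intervalIntegrable_deriv.congr_ae ?_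
  rw [EventuallyEq, ae_restrict_iff' measurableSet_uIoc]
  filter_upwards [h.deriv] with x hx hx' using (hx (uIoc_subset_uIcc hx')).deriv

theorem mono (h : HasACDeriv f f' a b) {c d : ℝ} (hcd : uIcc c d ⊆ uIcc a b) :
    HasACDeriv f f' c d :=
  ⟨h.ac.mono hcd, by filter_upwards [h.deriv] with x hx hx' using hx (hcd hx')⟩

theorem integral_eq (h : HasACDeriv f f' a b) : ∫ x in a..b, f' x = f b - f a := by
  rw [← h.ac.integral_deriv_eq_sub]
  refine intervalIntegral.integral_congr_ae ?_
  filter_upwards [h.deriv] with x hx hx' using ((hx (uIoc_subset_uIcc hx')).deriv).symm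

theorem integral_eq_left (h : HasACDeriv f f' a b) {x : ℝ} (hx : x ∈ uIcc a b) :
    ∫ y in a..x, f' y = f x - f a :=
  (h.mono (uIcc_subset_uIcc left_mem_uIcc hx)).integral_eq

theorem congr_deriv (h : HasACDeriv f f' a b) {f'' : ℝ → ℝ}
    (h' : ∀ᵐ x, x ∈ uIcc a b → f' x = f'' x) : HasACDeriv f f'' a b :=
  ⟨h.ac, by filter_upwards [h.deriv, h'] with x hx hx' hm using hx' hm ▸ hx hm⟩

theorem congr (h : HasACDeriv f f' a b) (hfg : EqOn g f (uIcc a b)) : HasACDeriv g f' a b := by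
  refine ⟨?_, ?_⟩
  · have := h.ac
    rw [absolutelyContinuousOnInterval_iff] at this ⊢
    intro ε hε
    obtain ⟨δ, hδ, H⟩ := this ε hε
    refine ⟨δ, hδ, fun E hE hE' => ?_⟩
    refine lt_of_le_of_lt (le_of_eq ?_) (H E hE hE')
    refine Finset.sum_congr rfl fun i hi => ?_
    rw [hfg (hE.1 i hi).1, hfg (hE.1 i hi).2]
  · have h₁ : ∀ᵐ x : ℝ, x ≠ a := by simp [ae_iff, measure_singleton]
    have h₂ : ∀ᵐ x : ℝ, x ≠ b := by simp [ae_iff, measure_singleton]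
    filter_upwards [h.deriv, h₁, h₂] with x hx hxa hxb hm
    refine (hx hm).congr_of_eventuallyEq ?_
    have : Ioo (min a b) (max a b) ∈ 𝓝 x := by
      refine Ioo_mem_nhds ?_ ?_
      · rcases min_choice a b with h | h <;> rw [h] <;>
          exact lt_of_le_of_ne (h ▸ hm.1) (Ne.symm (by assumption))
      · rcases max_choice a b with h | h <;> rw [h] <;>
          exact lt_of_le_of_ne (h ▸ hm.2) (by assumption)
    filter_upwards [this] with y hy using hfg (Ioo_subset_Icc_self hy)

theorem of_integral {g : ℝ → ℝ} (hg : IntervalIntegrable g volume a b) (c : ℝ) :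
    HasACDeriv (fun x => c + ∫ y in a..x, g y) g a b := by
  refine ⟨?_, ?_⟩
  · have h := hg.absolutelyContinuousOnInterval_intervalIntegral left_mem_uIcc
    have hc : AbsolutelyContinuousOnInterval (fun _ : ℝ => c) a b :=
      (LipschitzWith.const c).lipschitzOnWith.absolutelyContinuousOnInterval (K := 0)
    exact hc.fun_add h
  · filter_upwards [hg.ae_hasDerivAt_integral] with x hx hm
    exact (hx hm a left_mem_uIcc).const_add c

theorem of_eqOn_integral {g : ℝ → ℝ} (hg : IntervalIntegrable g volume a b)
    (hf : ∀ x ∈ uIcc a b, f x = f a + ∫ y in a..x, g y) : HasACDeriv f g a b :=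
  (of_integral hg (f a)).congr hf

theorem of_contDiff (h : ∀ x, HasDerivAt f (f' x) x) (h' : Continuous f') :
    HasACDeriv f f' a b := by
  refine ⟨ContDiffOn.absolutelyContinuousOnInterval ?_, Eventually.of_forall fun x _ => h x⟩
  refine ContDiff.contDiffOn ?_
  rw [contDiff_one_iff_deriv]
  have : _root_.deriv f = f' := funext fun x => (h x).deriv
  exact ⟨fun x => (h x).differentiableAt, this ▸ h'⟩

theorem const (c : ℝ) : HasACDeriv (fun _ => c) (fun _ => 0) a b :=
  of_contDiff (fun x => hasDerivAt_const x c) continuous_const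

theorem add (hf : HasACDeriv f f' a b) (hg : HasACDeriv g g' a b) :
    HasACDeriv (fun x => f x + g x) (fun x => f' x + g' x) a b :=
  ⟨hf.ac.fun_add hg.ac, by
    filter_upwards [hf.deriv, hg.deriv] with x h₁ h₂ hm using (h₁ hm).fun_add (h₂ hm)⟩

theorem sub (hf : HasACDeriv f f' a b) (hg : HasACDeriv g g' a b) :
    HasACDeriv (fun x => f x - g x) (fun x => f' x - g' x) a b :=
  ⟨hf.ac.fun_sub hg.ac, by
    filter_upwards [hf.deriv, hg.deriv] with x h₁ h₂ hm using (h₁ hm).fun_sub (h₂ hm)⟩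

theorem mul (hf : HasACDeriv f f' a b) (hg : HasACDeriv g g' a b) :
    HasACDeriv (fun x => f x * g x) (fun x => f' x * g x + f x * g' x) a b :=
  ⟨hf.ac.fun_mul hg.ac, by
    filter_upwards [hf.deriv, hg.deriv] with x h₁ h₂ hm using (h₁ hm).fun_mul (h₂ hm)⟩

theorem const_mul (c : ℝ) (hf : HasACDeriv f f' a b) :
    HasACDeriv (fun x => c * f x) (fun x => c * f' x) a b :=
  ⟨hf.ac.const_mul c, by filter_upwards [hf.deriv] with x h₁ hm using (h₁ hm).const_mul c⟩

/-- An absolutely continuous `f` has bounded range on the interval, and the C¹ function `F` is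
Lipschitz there, so absolute continuity survives the composition. -/
theorem comp {F F' : ℝ → ℝ} (hF : ∀ y, HasDerivAt F (F' y) y) (hF' : Continuous F')
    (hf : HasACDeriv f f' a b) :
    HasACDeriv (fun x => F (f x)) (fun x => F' (f x) * f' x) a b := by
  obtain ⟨C, hC⟩ := hf.ac.exists_bound
  have hs : MapsTo f (uIcc a b) (Icc (-C) C) := fun x hx => abs_le.1 (hC x hx)
  have hcd : ContDiff ℝ 1 F := by
    rw [contDiff_one_iff_deriv]
    have : _root_.deriv F = F' := funext fun x => (hF x).deriv
    exact ⟨fun x => (hF x).differentiableAt, this ▸ hF'⟩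
  obtain ⟨K, hK⟩ := hcd.contDiffOn.exists_lipschitzOnWith (by decide) (convex_Icc (-C) C)
    isCompact_Icc
  refine ⟨hK.comp_absolutelyContinuousOnInterval hf.ac hs, ?_⟩
  filter_upwards [hf.deriv] with x hx hm
  exact (hF (f x)).comp x (hx hm)

theorem le_of_nonneg (hab : a ≤ b) (h : HasACDeriv f f' a b)
    (h' : ∀ᵐ x, x ∈ Icc a b → 0 ≤ f' x) : f a ≤ f b := by
  have : 0 ≤ ∫ x in a..b, f' x := by
    refine intervalIntegral.integral_nonneg_of_ae_restrict hab ?_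
    rw [EventuallyLE, ae_restrict_iff' measurableSet_Icc]
    exact h'
  rw [h.integral_eq] at this
  linarith

theorem monotoneOn (hab : a ≤ b) (h : HasACDeriv f f' a b)
    (h' : ∀ᵐ x, x ∈ Icc a b → 0 ≤ f' x) : MonotoneOn f (Icc a b) := by
  intro x hx y hy hxy
  have hsub : uIcc x y ⊆ uIcc a b := by
    rw [uIcc_of_le hxy, uIcc_of_le hab]; exact Icc_subset_Icc hx.1 hy.2
  refine (h.mono hsub).le_of_nonneg hxy ?_
  filter_upwards [h'] with z hz hm using hz (Icc_subset_Icc hx.1 hy.2 hm)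

theorem eq_left_of_deriv_zero (h : HasACDeriv f f' a b)
    (h' : ∀ᵐ x, x ∈ uIcc a b → f' x = 0) {x : ℝ} (hx : x ∈ uIcc a b) : f x = f a := by
  obtain ⟨C, hC⟩ := h.ac.const_of_ae_hasDerivAt_zero (by
    filter_upwards [h.deriv, h'] with x h₁ h₂ hm using h₂ hm ▸ h₁ hm)
  rw [hC x hx, hC a left_mem_uIcc]

end HasACDeriv

/-- Variation of constants for a homogeneous linear scalar equation. -/
theorem eq_exp_of_deriv_eq_mul {d ρ : ℝ → ℝ} {a b : ℝ} (hρ : IntervalIntegrable ρ volume a b)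
    (hd : HasACDeriv d (fun x => ρ x * d x) a b) {x : ℝ} (hx : x ∈ uIcc a b) :
    d x = d a * Real.exp (∫ y in a..x, ρ y) := by
  -- The integrating factor exp(-∫ρ): its product with `d` has zero derivative.
  have hE := ((HasACDeriv.of_integral hρ 0).const_mul (-1)).comp
    (F := Real.exp) (F' := Real.exp) Real.hasDerivAt_exp Real.continuous_exp
  have := (hd.mul hE).eq_left_of_deriv_zero (Eventually.of_forall fun x _ => by ring) hx
  simp only [zero_add, intervalIntegral.integral_same, mul_zero, Real.exp_zero, mul_one] at this
  rw [← this, mul_assoc, ← Real.exp_add]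
  simp


/-! ### The Prüfer angle of a planar first order system. -/

section Pruefer

variable {p r W v : ℝ → ℝ} {a b : ℝ}

/-- With N = v² + W² and E = exp ∫(p + r), the derivative of N E is E (p (v + W)² + r (v - W)²) ≥ 0,
so N cannot reach zero. This is a Gronwall bound with the multiplier chosen to complete the squares.
-/
theorem sq_add_sq_pos_of_left (hab : a ≤ b) (hp : IntervalIntegrable p volume a b)
    (hr : IntervalIntegrable r volume a b) (hp0 : ∀ᵐ x, x ∈ Icc a b → 0 ≤ p x)
    (hr0 : ∀ᵐ x, x ∈ Icc a b → 0 ≤ r x) (hW : HasACDeriv W (fun x => p x * v x) a b)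
    (hv : HasACDeriv v (fun x => -(r x * W x)) a b) (h0 : 0 < v a ^ 2 + W a ^ 2) {x : ℝ}
    (hx : x ∈ Icc a b) : 0 < v x ^ 2 + W x ^ 2 := by
  have hE := (HasACDeriv.of_integral (hp.add hr) 0).comp
    (F := Real.exp) (F' := Real.exp) Real.hasDerivAt_exp Real.continuous_exp
  have hN := ((hv.mul hv).add (hW.mul hW)).mul hE
  have hmono := hN.monotoneOn hab (by
    filter_upwards [hp0, hr0] with x h₁ h₂ hm
    have h1 := h₁ hm
    have h2 := h₂ hm
    have : 0 ≤ p x * (v x + W x) ^ 2 + r x * (v x - W x) ^ 2 := by positivity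
    have hexp := Real.exp_pos (0 + ∫ y in a..x, (p y + r y))
    have h3 := mul_nonneg this hexp.le
    nlinarith [h3]) (left_mem_Icc.2 hab) hx hx.1
  simp only [zero_add, intervalIntegral.integral_same, Real.exp_zero, mul_one] at hmono
  have h1 : 0 < (v x * v x + W x * W x) * Real.exp (∫ y in a..x, (p y + r y)) := by
    nlinarith
  have := (pos_iff_pos_of_mul_pos h1).2 (Real.exp_pos _)
  nlinarith

/-- The companion Gronwall bound: with the multiplier exp(-∫(p + r)) the squared norm is
nonincreasing, hence stays zero if it starts at zero. -/
theorem eq_zero_of_left (hab : a ≤ b) (hp : IntervalIntegrable p volume a b)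
    (hr : IntervalIntegrable r volume a b) (hp0 : ∀ᵐ x, x ∈ Icc a b → 0 ≤ p x)
    (hr0 : ∀ᵐ x, x ∈ Icc a b → 0 ≤ r x) (hW : HasACDeriv W (fun x => p x * v x) a b)
    (hv : HasACDeriv v (fun x => -(r x * W x)) a b) (hv0 : v a = 0) (hW0 : W a = 0) {x : ℝ}
    (hx : x ∈ Icc a b) : W x = 0 := by
  have hE := ((HasACDeriv.of_integral (hp.add hr) 0).const_mul (-1)).comp
    (F := Real.exp) (F' := Real.exp) Real.hasDerivAt_exp Real.continuous_exp
  have hN := (((hv.mul hv).add (hW.mul hW)).mul hE).const_mul (-1)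
  have hmono := hN.monotoneOn hab (by
    filter_upwards [hp0, hr0] with x h₁ h₂ hm
    have h1 := h₁ hm
    have h2 := h₂ hm
    have : 0 ≤ p x * (v x - W x) ^ 2 + r x * (v x + W x) ^ 2 := by positivity
    have hexp := Real.exp_pos (-1 * (0 + ∫ y in a..x, (p y + r y)))
    have h3 := mul_nonneg this hexp.le
    nlinarith [h3]) (left_mem_Icc.2 hab) hx hx.1
  simp only [zero_add, intervalIntegral.integral_same, hv0, hW0] at hmono
  have h1 : (v x * v x + W x * W x) * Real.exp (-1 * ∫ y in a..x, (p y + r y)) ≤ 0 := by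
    linarith
  have h2 := nonpos_of_mul_nonpos_left h1 (Real.exp_pos _)
  nlinarith [sq_nonneg (v x), sq_nonneg (W x)]

theorem exists_polar (x y : ℝ) : ∃ R ψ : ℝ, 0 ≤ R ∧ x = R * Real.cos ψ ∧ y = R * Real.sin ψ := by
  refine ⟨‖(⟨x, y⟩ : ℂ)‖, Complex.arg ⟨x, y⟩, norm_nonneg _, ?_, ?_⟩
  · exact (Complex.norm_mul_cos_arg ⟨x, y⟩).symm
  · exact (Complex.norm_mul_sin_arg ⟨x, y⟩).symm

/-- Polar coordinates for a planar first order system with a nontrivial solution. -/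
theorem exists_pruefer_angle (hab : a ≤ b) (hp : IntervalIntegrable p volume a b)
    (hr : IntervalIntegrable r volume a b) (hp0 : ∀ᵐ x, x ∈ Icc a b → 0 ≤ p x)
    (hr0 : ∀ᵐ x, x ∈ Icc a b → 0 ≤ r x) (hW : HasACDeriv W (fun x => p x * v x) a b)
    (hv : HasACDeriv v (fun x => -(r x * W x)) a b) (h0 : 0 < v a ^ 2 + W a ^ 2) :
    ∃ ψ R : ℝ → ℝ,
      HasACDeriv ψ (fun x => p x * Real.cos (ψ x) ^ 2 + r x * Real.sin (ψ x) ^ 2) a b ∧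
      ∀ x ∈ Icc a b, 0 < R x ∧ v x = R x * Real.cos (ψ x) ∧ W x = R x * Real.sin (ψ x) := by
  have hN : ∀ x ∈ Icc a b, 0 < v x ^ 2 + W x ^ 2 := fun x hx =>
    sq_add_sq_pos_of_left hab hp hr hp0 hr0 hW hv h0 hx
  have hvc := hv.continuousOn
  have hWc := hW.continuousOn
  have huI : uIcc a b = Icc a b := uIcc_of_le hab
  have hNc : ContinuousOn (fun x => (v x ^ 2 + W x ^ 2)⁻¹) (uIcc a b) :=
    ((hvc.pow 2).add (hWc.pow 2)).inv₀ fun x hx => (hN x (huI ▸ hx)).ne'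
  -- The prospective angular speed, written through the known `v` and `W` instead of the angle, so
  -- that the angle is obtained by mere integration.
  obtain ⟨q, hq⟩ : ∃ q : ℝ → ℝ, q = fun x => p x * (v x ^ 2 * (v x ^ 2 + W x ^ 2)⁻¹) +
    r x * (W x ^ 2 * (v x ^ 2 + W x ^ 2)⁻¹) := ⟨_, rfl⟩
  -- The logarithmic derivative of the radius √(v² + W²).
  obtain ⟨ρ, hρ⟩ : ∃ ρ : ℝ → ℝ, ρ = fun x => (p x - r x) *
    (v x * W x * (v x ^ 2 + W x ^ 2)⁻¹) := ⟨_, rfl⟩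
  have hqi : IntervalIntegrable q volume a b := by
    rw [hq]
    exact (hp.mul_continuousOn ((hvc.pow 2).mul hNc)).add
      (hr.mul_continuousOn ((hWc.pow 2).mul hNc))
  have hρi : IntervalIntegrable ρ volume a b := by
    rw [hρ]; exact (hp.sub hr).mul_continuousOn ((hvc.mul hWc).mul hNc)
  obtain ⟨R₀, ψ₀, hR₀, hv₀, hW₀⟩ := exists_polar (v a) (W a)
  have hR₀' : 0 < R₀ := by
    refine lt_of_le_of_ne hR₀ fun h => ?_
    rw [hv₀, hW₀, ← h] at h0
    simp at h0
  have hψ := HasACDeriv.of_integral hqi ψ₀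
  have hψa : (fun x => ψ₀ + ∫ y in a..x, q y) a = ψ₀ := by simp
  generalize (fun x => ψ₀ + ∫ y in a..x, q y) = ψ at hψ hψa
  have hcos := hψ.comp Real.hasDerivAt_cos Real.continuous_sin.neg
  have hsin := hψ.comp Real.hasDerivAt_sin Real.continuous_cos
  -- The components of (v, W) orthogonal to and along the direction (cos ψ, sin ψ) both solve y' = ρ
  -- y. The first starts at zero and the second at R₀ > 0, so the first vanishes and the second
  -- stays positive.
  have hd := ((hW.mul hcos).sub (hv.mul hsin)).congr_deriv
    (f'' := fun x => ρ x * (W x * Real.cos (ψ x) - v x * Real.sin (ψ x)))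
    (Eventually.of_forall fun x hx => by
      have := (hN x (huI ▸ hx)).ne'
      simp only [hq, hρ]
      field_simp
      ring)
  have hc := ((hv.mul hcos).add (hW.mul hsin)).congr_deriv
    (f'' := fun x => ρ x * (v x * Real.cos (ψ x) + W x * Real.sin (ψ x)))
    (Eventually.of_forall fun x hx => by
      have := (hN x (huI ▸ hx)).ne'
      simp only [hq, hρ]
      field_simp
      ring)
  have hd0 : ∀ x ∈ Icc a b, W x * Real.cos (ψ x) - v x * Real.sin (ψ x) = 0 := fun x hx => by
    have := eq_exp_of_deriv_eq_mul hρi hd (huI ▸ hx)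
    rw [this, hψa, hv₀, hW₀]
    ring
  have hc0 : ∀ x ∈ Icc a b, 0 < v x * Real.cos (ψ x) + W x * Real.sin (ψ x) := fun x hx => by
    have := eq_exp_of_deriv_eq_mul hρi hc (huI ▸ hx)
    rw [this, hψa, hv₀, hW₀]
    have h1 : R₀ * Real.cos ψ₀ * Real.cos ψ₀ + R₀ * Real.sin ψ₀ * Real.sin ψ₀ = R₀ := by
      linear_combination R₀ * Real.sin_sq_add_cos_sq ψ₀
    rw [h1]
    positivity
  have hv' : ∀ x ∈ Icc a b, v x =
      (v x * Real.cos (ψ x) + W x * Real.sin (ψ x)) * Real.cos (ψ x) := fun x hx => by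
    linear_combination (-v x) * Real.sin_sq_add_cos_sq (ψ x) - Real.sin (ψ x) * hd0 x hx
  have hW' : ∀ x ∈ Icc a b, W x =
      (v x * Real.cos (ψ x) + W x * Real.sin (ψ x)) * Real.sin (ψ x) := fun x hx => by
    linear_combination (-W x) * Real.sin_sq_add_cos_sq (ψ x) + Real.cos (ψ x) * hd0 x hx
  refine ⟨ψ, fun x => v x * Real.cos (ψ x) + W x * Real.sin (ψ x), ?_,
    fun x hx => ⟨hc0 x hx, hv' x hx, hW' x hx⟩⟩
  refine hψ.congr_deriv (Eventually.of_forall fun x hx => ?_)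
  rw [huI] at hx
  have h1 := hv' x hx
  have h2 := hW' x hx
  have h3 := hc0 x hx
  have h4 := hN x hx
  generalize v x * Real.cos (ψ x) + W x * Real.sin (ψ x) = R at h1 h2 h3
  have h5 : v x ^ 2 + W x ^ 2 = R ^ 2 := by
    rw [h1, h2]; linear_combination R ^ 2 * Real.sin_sq_add_cos_sq (ψ x)
  rw [hq]
  simp only
  rw [h5, h1, h2]
  field_simp

end Pruefer

/-! ### The maximal angular speed and the time of a turn. -/

section Speed

/-- The largest possible angular speed for coefficient ratios in `[ρ, ρ⁻¹]`. -/
noncomputable def maxSpeed (ρ s : ℝ) : ℝ :=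
  max (Real.cos s ^ 2 / ρ + ρ * Real.sin s ^ 2) (ρ * Real.cos s ^ 2 + Real.sin s ^ 2 / ρ)

variable {ρ : ℝ}

theorem maxSpeed_pos (hρ : 0 < ρ) (s : ℝ) : 0 < maxSpeed ρ s := by
  refine lt_max_of_lt_left ?_
  have h := Real.sin_sq_add_cos_sq s
  have h1 : 0 ≤ Real.cos s ^ 2 / ρ := by positivity
  have h2 : 0 ≤ ρ * Real.sin s ^ 2 := by positivity
  refine lt_of_le_of_ne (by positivity) fun h0 => ?_
  have h3 : Real.cos s ^ 2 / ρ = 0 := by linarith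
  have h4 : ρ * Real.sin s ^ 2 = 0 := by linarith
  rw [div_eq_zero_iff] at h3
  rw [mul_eq_zero] at h4
  have h5 := h3.resolve_right hρ.ne'
  have h6 := h4.resolve_left hρ.ne'
  linarith

theorem continuous_maxSpeed : Continuous (maxSpeed ρ) := by
  unfold maxSpeed; fun_prop

theorem continuous_inv_maxSpeed (hρ : 0 < ρ) : Continuous fun s => (maxSpeed ρ s)⁻¹ :=
  continuous_maxSpeed.inv₀ fun s => (maxSpeed_pos hρ s).ne'

theorem maxSpeed_add_pi_div_two (s : ℝ) : maxSpeed ρ (s + Real.pi / 2) = maxSpeed ρ s := by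
  unfold maxSpeed
  rw [Real.cos_add_pi_div_two, Real.sin_add_pi_div_two, max_comm, neg_sq]
  congr 1 <;> ring

theorem maxSpeed_of_cos_two_mul_nonneg (hρ : 0 < ρ) (hρ1 : ρ ≤ 1) {s : ℝ}
    (h : 0 ≤ Real.cos (2 * s)) :
    maxSpeed ρ s = Real.cos s ^ 2 / ρ + ρ * Real.sin s ^ 2 := by
  refine max_eq_left ?_
  rw [Real.cos_two_mul'] at h
  have h1 : 1 ≤ ρ⁻¹ := one_le_inv_iff₀.2 ⟨hρ, hρ1⟩
  rw [div_eq_mul_inv, div_eq_mul_inv]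
  nlinarith [mul_nonneg h (show 0 ≤ ρ⁻¹ - ρ by linarith)]

theorem maxSpeed_of_cos_two_mul_nonpos (hρ : 0 < ρ) (hρ1 : ρ ≤ 1) {s : ℝ}
    (h : Real.cos (2 * s) ≤ 0) :
    maxSpeed ρ s = ρ * Real.cos s ^ 2 + Real.sin s ^ 2 / ρ := by
  refine max_eq_right ?_
  rw [Real.cos_two_mul'] at h
  have h1 : 1 ≤ ρ⁻¹ := one_le_inv_iff₀.2 ⟨hρ, hρ1⟩
  rw [div_eq_mul_inv, div_eq_mul_inv]
  nlinarith [mul_nonneg (neg_nonneg.2 h) (show 0 ≤ ρ⁻¹ - ρ by linarith)]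

/-- The gap to the maximal speed factors through the distance of β from the optimal endpoint. When
also β ≤ 1/ρ, the other factor is at least cos 2s; this yields the bound on the speed and, for cos
2s > 0, the equality case. The next lemma plays the same role for cos 2s ≤ 0. -/
theorem maxSpeed_sub_of_cos_two_mul_nonneg (hρ : 0 < ρ) (hρ1 : ρ ≤ 1) {s β : ℝ} (hβ : ρ ≤ β)
    (h : 0 ≤ Real.cos (2 * s)) :
    maxSpeed ρ s - (Real.cos s ^ 2 / β + β * Real.sin s ^ 2) =
      (β - ρ) * (Real.cos s ^ 2 / (ρ * β) - Real.sin s ^ 2) := by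
  have : 0 < β := hρ.trans_le hβ
  rw [maxSpeed_of_cos_two_mul_nonneg hρ hρ1 h]
  field_simp
  ring

theorem maxSpeed_sub_of_cos_two_mul_nonpos (hρ : 0 < ρ) (hρ1 : ρ ≤ 1) {s β : ℝ} (hβ : ρ ≤ β)
    (h : Real.cos (2 * s) ≤ 0) :
    maxSpeed ρ s - (Real.cos s ^ 2 / β + β * Real.sin s ^ 2) =
      (ρ⁻¹ - β) * (Real.sin s ^ 2 - ρ / β * Real.cos s ^ 2) := by
  have : 0 < β := hρ.trans_le hβ
  rw [maxSpeed_of_cos_two_mul_nonpos hρ hρ1 h]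
  field_simp
  ring

theorem speed_le_maxSpeed (hρ : 0 < ρ) (hρ1 : ρ ≤ 1) {s β : ℝ} (hβ : β ∈ Icc ρ ρ⁻¹) :
    Real.cos s ^ 2 / β + β * Real.sin s ^ 2 ≤ maxSpeed ρ s := by
  have hβ0 : 0 < β := hρ.trans_le hβ.1
  have h1 : ρ * β ≤ 1 := by
    have := mul_le_mul_of_nonneg_left hβ.2 hρ.le
    rwa [mul_inv_cancel₀ hρ.ne'] at this
  rw [← sub_nonneg]
  rcases le_total 0 (Real.cos (2 * s)) with h | h
  · rw [maxSpeed_sub_of_cos_two_mul_nonneg hρ hρ1 hβ.1 h]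
    refine mul_nonneg (by linarith [hβ.1]) ?_
    rw [Real.cos_two_mul'] at h
    have : Real.cos s ^ 2 ≤ Real.cos s ^ 2 / (ρ * β) :=
      le_div_self (sq_nonneg _) (by positivity) h1
    linarith
  · rw [maxSpeed_sub_of_cos_two_mul_nonpos hρ hρ1 hβ.1 h]
    refine mul_nonneg (by linarith [hβ.2]) ?_
    rw [Real.cos_two_mul'] at h
    have h2 : ρ / β ≤ 1 := (div_le_one hβ0).2 hβ.1
    have : ρ / β * Real.cos s ^ 2 ≤ 1 * Real.cos s ^ 2 := by gcongr
    linarith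

theorem eq_of_speed_eq_maxSpeed_of_cos_pos (hρ : 0 < ρ) (hρ1 : ρ ≤ 1) {s β : ℝ}
    (hβ : β ∈ Icc ρ ρ⁻¹) (h : 0 < Real.cos (2 * s))
    (heq : Real.cos s ^ 2 / β + β * Real.sin s ^ 2 = maxSpeed ρ s) : β = ρ := by
  have hβ0 : 0 < β := hρ.trans_le hβ.1
  have h1 : ρ * β ≤ 1 := by
    have := mul_le_mul_of_nonneg_left hβ.2 hρ.le
    rwa [mul_inv_cancel₀ hρ.ne'] at this
  have h2 := maxSpeed_sub_of_cos_two_mul_nonneg hρ hρ1 hβ.1 h.le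
  rw [heq, sub_self, eq_comm, mul_eq_zero] at h2
  rw [Real.cos_two_mul'] at h
  have : Real.cos s ^ 2 ≤ Real.cos s ^ 2 / (ρ * β) :=
    le_div_self (sq_nonneg _) (by positivity) h1
  rcases h2 with h2 | h2 <;> linarith

theorem eq_of_speed_eq_maxSpeed_of_cos_neg (hρ : 0 < ρ) (hρ1 : ρ ≤ 1) {s β : ℝ}
    (hβ : β ∈ Icc ρ ρ⁻¹) (h : Real.cos (2 * s) < 0)
    (heq : Real.cos s ^ 2 / β + β * Real.sin s ^ 2 = maxSpeed ρ s) : β = ρ⁻¹ := by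
  have hβ0 : 0 < β := hρ.trans_le hβ.1
  have h2 := maxSpeed_sub_of_cos_two_mul_nonpos hρ hρ1 hβ.1 h.le
  rw [heq, sub_self, eq_comm, mul_eq_zero] at h2
  rw [Real.cos_two_mul'] at h
  have h3 : ρ / β ≤ 1 := (div_le_one hβ0).2 hβ.1
  have : ρ / β * Real.cos s ^ 2 ≤ 1 * Real.cos s ^ 2 := by gcongr
  rcases h2 with h2 | h2 <;> linarith

/-- The time needed to turn from the angle `0` to the angle `s` at maximal speed. -/
noncomputable def turnTime (ρ s : ℝ) : ℝ := ∫ y in (0 : ℝ)..s, (maxSpeed ρ y)⁻¹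

theorem hasDerivAt_turnTime (hρ : 0 < ρ) (s : ℝ) :
    HasDerivAt (turnTime ρ) (maxSpeed ρ s)⁻¹ s :=
  intervalIntegral.integral_hasDerivAt_right
    ((continuous_inv_maxSpeed hρ).intervalIntegrable _ _)
    ((continuous_inv_maxSpeed hρ).stronglyMeasurableAtFilter _ _)
    (continuous_inv_maxSpeed hρ).continuousAt

theorem strictMono_turnTime (hρ : 0 < ρ) : StrictMono (turnTime ρ) := by
  refine strictMono_of_deriv_pos fun s => ?_
  rw [(hasDerivAt_turnTime hρ s).deriv]
  exact inv_pos.2 (maxSpeed_pos hρ s)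

theorem hasDerivAt_arctan_mul_tan (hρ : 0 < ρ) {s : ℝ} (h : Real.cos s ≠ 0) :
    HasDerivAt (fun s => Real.arctan (ρ * Real.tan s))
      (Real.cos s ^ 2 / ρ + ρ * Real.sin s ^ 2)⁻¹ s := by
  have h1 := ((Real.hasDerivAt_tan h).const_mul ρ).arctan
  convert h1 using 1
  rw [Real.tan_eq_sin_div_cos]
  have : 0 < Real.cos s ^ 2 := by positivity
  have h2 : 0 < Real.cos s ^ 2 + ρ ^ 2 * Real.sin s ^ 2 := by positivity
  have h3 : 0 < Real.cos s ^ 2 / ρ + ρ * Real.sin s ^ 2 := by positivity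
  field_simp

/-- For |s| ≤ π/4 the optimal endpoint is always β = ρ, and the reciprocal speed has an elementary
primitive. -/
theorem turnTime_of_mem_Icc (hρ : 0 < ρ) (hρ1 : ρ ≤ 1) {s : ℝ}
    (hs : s ∈ Icc (-(Real.pi / 4)) (Real.pi / 4)) :
    turnTime ρ s = Real.arctan (ρ * Real.tan s) := by
  have hpi := Real.pi_pos
  have hsub : ∀ y ∈ uIcc 0 s, y ∈ Icc (-(Real.pi / 4)) (Real.pi / 4) := fun y hy =>
    uIcc_subset_Icc ⟨by linarith, by linarith⟩ hs hy
  have hder : ∀ y ∈ uIcc 0 s, HasDerivAt (fun s => Real.arctan (ρ * Real.tan s))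
      (maxSpeed ρ y)⁻¹ y := by
    intro y hy
    have hy' := hsub y hy
    have hcos : 0 < Real.cos y :=
      Real.cos_pos_of_mem_Ioo ⟨by linarith [hy'.1], by linarith [hy'.2]⟩
    rw [maxSpeed_of_cos_two_mul_nonneg hρ hρ1
      (Real.cos_nonneg_of_mem_Icc ⟨by linarith [hy'.1], by linarith [hy'.2]⟩)]
    exact hasDerivAt_arctan_mul_tan hρ hcos.ne'
  unfold turnTime
  rw [intervalIntegral.integral_eq_sub_of_hasDerivAt hder
    ((continuous_inv_maxSpeed hρ).intervalIntegrable _ _)]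
  simp

theorem turnTime_pi_div_four (hρ : 0 < ρ) (hρ1 : ρ ≤ 1) :
    turnTime ρ (Real.pi / 4) = Real.arctan ρ := by
  have hpi := Real.pi_pos
  rw [turnTime_of_mem_Icc hρ hρ1 ⟨by linarith, le_rfl⟩, Real.tan_pi_div_four, mul_one]

theorem turnTime_neg_pi_div_four (hρ : 0 < ρ) (hρ1 : ρ ≤ 1) :
    turnTime ρ (-(Real.pi / 4)) = -Real.arctan ρ := by
  have hpi := Real.pi_pos
  rw [turnTime_of_mem_Icc hρ hρ1 ⟨le_rfl, by linarith⟩, Real.tan_neg, Real.tan_pi_div_four,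
    mul_neg, mul_one, Real.arctan_neg]

/-- The maximal speed has period π/2, so every quarter turn takes as long as the one from -π/4 to
π/4, which lasts 2 arctan ρ. -/
theorem turnTime_add_pi_div_two (hρ : 0 < ρ) (hρ1 : ρ ≤ 1) (s : ℝ) :
    turnTime ρ (s + Real.pi / 2) = turnTime ρ s + 2 * Real.arctan ρ := by
  have hper : Function.Periodic (fun s => (maxSpeed ρ s)⁻¹) (Real.pi / 2) := fun s => by
    simp only [maxSpeed_add_pi_div_two]
  have hi : ∀ x y : ℝ, IntervalIntegrable (fun s => (maxSpeed ρ s)⁻¹) volume x y := fun x y =>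
    (continuous_inv_maxSpeed hρ).intervalIntegrable _ _
  have h1 := hper.intervalIntegral_add_eq s (-(Real.pi / 4))
  have h2 : ∀ x y : ℝ, ∫ y in x..y, (maxSpeed ρ y)⁻¹ = turnTime ρ y - turnTime ρ x := fun x y =>
    (intervalIntegral.integral_interval_sub_left (hi _ _) (hi _ _)).symm
  rw [h2, h2, show -(Real.pi / 4) + Real.pi / 2 = Real.pi / 4 by ring,
    turnTime_pi_div_four hρ hρ1, turnTime_neg_pi_div_four hρ hρ1] at h1
  linarith

theorem turnTime_add_two_pi (hρ : 0 < ρ) (hρ1 : ρ ≤ 1) (s : ℝ) :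
    turnTime ρ (s + 2 * Real.pi) = turnTime ρ s + 8 * Real.arctan ρ := by
  rw [show s + 2 * Real.pi = s + Real.pi / 2 + Real.pi / 2 + Real.pi / 2 + Real.pi / 2 by ring]
  simp only [turnTime_add_pi_div_two hρ hρ1]
  ring

end Speed


/-! ### A lower bound for the time in which a periodic solution turns around. -/

theorem HasACDeriv.ae_deriv_eq_zero {f f' : ℝ → ℝ} {a b : ℝ} (hab : a ≤ b)
    (h : HasACDeriv f f' a b) (h' : ∀ᵐ x, x ∈ Icc a b → 0 ≤ f' x) (hfab : f b ≤ f a) :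
    ∀ᵐ x, x ∈ Icc a b → f' x = 0 := by
  have h1 : 0 ≤ᵐ[volume.restrict (Ioc a b)] f' := by
    rw [EventuallyLE, ae_restrict_iff' measurableSet_Ioc]
    filter_upwards [h'] with x hx hm using hx (Ioc_subset_Icc_self hm)
  have h2 : ∫ x in a..b, f' x = 0 := by
    have h3 := h.le_of_nonneg hab h'
    rw [h.integral_eq]
    linarith
  rw [intervalIntegral.integral_eq_zero_iff_of_le_of_nonneg_ae hab h1 h.intervalIntegrable,
    EventuallyEq, ae_restrict_iff' measurableSet_Ioc] at h2
  have h₁ : ∀ᵐ x : ℝ, x ≠ a := by simp [ae_iff, measure_singleton]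
  filter_upwards [h2, h₁] with x hx hxa hm
  exact hx ⟨lt_of_le_of_ne hm.1 (Ne.symm hxa), hm.2⟩

theorem countable_cos_two_mul_eq_zero : {x : ℝ | Real.cos (2 * x) = 0}.Countable := by
  refine (countable_range fun k : ℤ => (2 * (k : ℝ) + 1) * Real.pi / 2 / 2).mono ?_
  intro x hx
  obtain ⟨k, hk⟩ := Real.cos_eq_zero_iff.1 hx
  exact ⟨k, by simp only; rw [← hk]; ring⟩

theorem two_pi_le_of_cos_sin_eq {x y : ℝ} (hxy : x < y) (hc : Real.cos x = Real.cos y)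
    (hs : Real.sin x = Real.sin y) : x + 2 * Real.pi ≤ y := by
  have h1 : Real.cos (y - x) = 1 := by
    rw [Real.cos_sub, hc, hs]
    linear_combination Real.sin_sq_add_cos_sq y
  obtain ⟨n, hn⟩ := (Real.cos_eq_one_iff _).1 h1
  have h2 : 0 < n := by
    by_contra h
    have : (n : ℝ) ≤ 0 := by exact_mod_cast not_lt.1 h
    nlinarith [Real.pi_pos]
  have h3 : (1 : ℝ) ≤ n := by exact_mod_cast h2
  nlinarith [Real.pi_pos]

/-- A nontrivial `T`-periodic solution of `W' = ω (s / β) v`, `v' = -ω s β W` with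
`ρ ≤ β ≤ ρ⁻¹` makes at least one full turn, which takes the time `8 arctan ρ` at least; if it
takes exactly this time, then `β` switches between `ρ` and `ρ⁻¹`. -/
theorem eight_mul_arctan_le {s β W v : ℝ → ℝ} {ρ ω T δ : ℝ} (hT : 0 < T) (hρ : 0 < ρ)
    (hρ1 : ρ ≤ 1) (hω : 0 < ω) (hδ : 0 < δ) (hs : IntervalIntegrable s volume 0 T)
    (hp : IntervalIntegrable (fun x => ω * (s x / β x)) volume 0 T)
    (hr : IntervalIntegrable (fun x => ω * (s x * β x)) volume 0 T)
    (hsδ : ∀ᵐ x, x ∈ Icc 0 T → δ ≤ s x) (hβ : ∀ᵐ x, x ∈ Icc 0 T → β x ∈ Icc ρ ρ⁻¹)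
    (hW : HasACDeriv W (fun x => ω * (s x / β x) * v x) 0 T)
    (hv : HasACDeriv v (fun x => -(ω * (s x * β x) * W x)) 0 T)
    (hWT : W T = W 0) (hvT : v T = v 0) (hne : ∃ x ∈ Icc 0 T, W x ≠ 0) :
    8 * Real.arctan ρ ≤ ω * ∫ x in (0 : ℝ)..T, s x ∧
    (ω * ∫ x in (0 : ℝ)..T, s x = 8 * Real.arctan ρ → ∃ ψ : ℝ → ℝ,
      (∀ x ∈ Icc 0 T, turnTime ρ (ψ x) = turnTime ρ (ψ 0) + ω * ∫ y in (0 : ℝ)..x, s y) ∧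
      ∀ᵐ x, x ∈ Icc 0 T → (0 < Real.cos (2 * ψ x) ∧ β x = ρ) ∨
        (Real.cos (2 * ψ x) < 0 ∧ β x = ρ⁻¹)) := by
  have huI : uIcc 0 T = Icc 0 T := uIcc_of_le hT.le
  have hp0 : ∀ᵐ x, x ∈ Icc 0 T → 0 ≤ ω * (s x / β x) := by
    filter_upwards [hsδ, hβ] with x h1 h2 hm
    have h3 := h1 hm
    have h4 := (h2 hm).1
    have : 0 < s x := by linarith
    have : 0 < β x := by linarith
    positivity
  have hr0 : ∀ᵐ x, x ∈ Icc 0 T → 0 ≤ ω * (s x * β x) := by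
    filter_upwards [hsδ, hβ] with x h1 h2 hm
    have h3 := h1 hm
    have h4 := (h2 hm).1
    have : 0 < s x := by linarith
    have : 0 < β x := by linarith
    positivity
  -- Zero initial data would make `W` vanish on the whole interval.
  have h0 : 0 < v 0 ^ 2 + W 0 ^ 2 := by
    obtain ⟨x, hx, hWx⟩ := hne
    by_contra h
    have hv0 : v 0 = 0 := by nlinarith [sq_nonneg (v 0), sq_nonneg (W 0)]
    have hW0 : W 0 = 0 := by nlinarith [sq_nonneg (v 0), sq_nonneg (W 0)]
    exact hWx (eq_zero_of_left hT.le hp hr hp0 hr0 hW hv hv0 hW0 hx)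
  obtain ⟨ψ, R, hψ, hR⟩ := exists_pruefer_angle hT.le hp hr hp0 hr0 hW hv h0
  have hspeed : ∀ᵐ x, x ∈ Icc 0 T →
      ω * (s x / β x) * Real.cos (ψ x) ^ 2 + ω * (s x * β x) * Real.sin (ψ x) ^ 2 ≤
        ω * s x * maxSpeed ρ (ψ x) := by
    filter_upwards [hsδ, hβ] with x h1 h2 hm
    have h3 : 0 ≤ s x := hδ.le.trans (h1 hm)
    have h4 := mul_le_mul_of_nonneg_left (speed_le_maxSpeed hρ hρ1 (s := ψ x) (h2 hm))
      (mul_nonneg hω.le h3)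
    refine le_trans (le_of_eq ?_) h4
    ring
  -- Both β and 1/β are at least ρ, so the angular speed is at least ω δ ρ; hence the angle is
  -- strictly increasing.
  have hlow : ∀ᵐ x, x ∈ Icc 0 T → 0 ≤
      ω * (s x / β x) * Real.cos (ψ x) ^ 2 + ω * (s x * β x) * Real.sin (ψ x) ^ 2 -
        ω * δ * ρ * 1 := by
    filter_upwards [hsδ, hβ] with x h1 h2 hm
    have h3 := h1 hm
    have h4 := h2 hm
    have hβ0 : 0 < β x := hρ.trans_le h4.1
    have h5 : δ * ρ ≤ s x * β x := mul_le_mul h3 h4.1 hρ.le (hδ.le.trans h3)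
    have h6 : δ * ρ ≤ s x / β x := by
      rw [div_eq_mul_inv]
      exact mul_le_mul h3 ((le_inv_comm₀ hρ hβ0).2 h4.2) hρ.le (hδ.le.trans h3)
    have h7 := mul_nonneg (mul_nonneg hω.le (sub_nonneg.2 h5)) (sq_nonneg (Real.sin (ψ x)))
    have h8 := mul_nonneg (mul_nonneg hω.le (sub_nonneg.2 h6)) (sq_nonneg (Real.cos (ψ x)))
    have h9 := Real.sin_sq_add_cos_sq (ψ x)
    have h10 : ω * δ * ρ * 1 = ω * δ * ρ * (Real.sin (ψ x) ^ 2 + Real.cos (ψ x) ^ 2) := by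
      rw [h9]
    rw [h10]
    nlinarith [h7, h8]
  have hmonoψ := (hψ.sub (HasACDeriv.of_contDiff (f := fun x => ω * δ * ρ * x)
    (f' := fun _ => ω * δ * ρ * 1) (fun x => (hasDerivAt_id x).const_mul _)
    continuous_const)).monotoneOn hT.le hlow
  have hψstrict : StrictMonoOn ψ (Icc 0 T) := by
    intro x hx y hy hxy
    have h1 := hmonoψ hx hy hxy.le
    simp only at h1
    have h2 : 0 < ω * δ * ρ := by positivity
    nlinarith [mul_pos h2 (sub_pos.2 hxy)]
  have h0T : (0 : ℝ) ∈ Icc 0 T := left_mem_Icc.2 hT.le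
  have hTT : T ∈ Icc 0 T := right_mem_Icc.2 hT.le
  -- Periodicity gives equal radii at the ends, hence equal cosines and sines; two different angles
  -- with this property are at least 2π apart.
  have hturn : ψ 0 + 2 * Real.pi ≤ ψ T := by
    obtain ⟨h1, h2, h3⟩ := hR 0 h0T
    obtain ⟨h4, h5, h6⟩ := hR T hTT
    rw [hvT, h2] at h5
    rw [hWT, h3] at h6
    have h7 : R 0 ^ 2 = R T ^ 2 := by
      have e1 := Real.sin_sq_add_cos_sq (ψ 0)
      have e2 := Real.sin_sq_add_cos_sq (ψ T)
      calc R 0 ^ 2 = (R 0 * Real.cos (ψ 0)) ^ 2 + (R 0 * Real.sin (ψ 0)) ^ 2 := by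
            linear_combination -(R 0 ^ 2) * e1
        _ = R T ^ 2 := by rw [h5, h6]; linear_combination (R T ^ 2) * e2
    have h8 : R 0 = R T := (pow_left_inj₀ h1.le h4.le two_ne_zero).1 h7
    rw [h8] at h5 h6
    exact two_pi_le_of_cos_sin_eq (hψstrict h0T hTT hT) (mul_left_cancel₀ h4.ne' h5)
      (mul_left_cancel₀ h4.ne' h6)
  -- The time used minus the time needed at maximal speed is nondecreasing.
  have hG := ((HasACDeriv.of_integral hs 0).const_mul ω).sub
    (hψ.comp (hasDerivAt_turnTime hρ) (continuous_inv_maxSpeed hρ))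
  have hG0 : ∀ᵐ x, x ∈ Icc 0 T → 0 ≤ ω * s x - (maxSpeed ρ (ψ x))⁻¹ *
      (ω * (s x / β x) * Real.cos (ψ x) ^ 2 + ω * (s x * β x) * Real.sin (ψ x) ^ 2) := by
    filter_upwards [hspeed] with x h1 hm
    have h2 := maxSpeed_pos hρ (ψ x)
    rw [sub_nonneg, inv_mul_le_iff₀ h2]
    linarith [h1 hm]
  have hGT := hG.le_of_nonneg hT.le hG0
  simp only [zero_add, intervalIntegral.integral_same, mul_zero] at hGT
  have hfull : turnTime ρ (ψ 0) + 8 * Real.arctan ρ ≤ turnTime ρ (ψ T) := by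
    rw [← turnTime_add_two_pi hρ hρ1]
    exact (strictMono_turnTime hρ).monotone hturn
  refine ⟨by linarith, fun heq => ⟨ψ, ?_, ?_⟩⟩
  -- Equality leaves no room for this difference to grow: it is constant, which gives the formula
  -- for the turning time, and its derivative vanishes almost everywhere.
  · intro x hx
    have h1 := hG.monotoneOn hT.le hG0 h0T hx hx.1
    have h2 := hG.monotoneOn hT.le hG0 hx hTT hx.2
    simp only [zero_add, intervalIntegral.integral_same, mul_zero] at h1 h2
    linarith
  · have h1 := hG.ae_deriv_eq_zero hT.le hG0 (by
      simp only [zero_add, intervalIntegral.integral_same, mul_zero]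
      linarith)
    -- Where cos 2ψ = 0 both endpoints give the same speed, and β is not determined. As ψ is
    -- injective, this happens at countably many points only.
    have hcount : {x | x ∈ Icc 0 T ∧ Real.cos (2 * ψ x) = 0}.Countable := by
      have h3 : {x | x ∈ Icc 0 T ∧ Real.cos (2 * ψ x) = 0} =
          Icc 0 T ∩ ψ ⁻¹' {y | Real.cos (2 * y) = 0} := rfl
      rw [h3]
      refine Set.MapsTo.countable_of_injOn (f := ψ) (t := {y | Real.cos (2 * y) = 0})
        (fun x hx => hx.2) (hψstrict.injOn.mono inter_subset_left) countable_cos_two_mul_eq_zero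
    have h4 : ∀ᵐ x, x ∉ {x | x ∈ Icc 0 T ∧ Real.cos (2 * ψ x) = 0} :=
      measure_eq_zero_iff_ae_notMem.1 (hcount.measure_zero _)
    filter_upwards [h1, h4, hβ, hsδ] with x hx1 hx4 hxβ hxs hm
    have hs0 : 0 < s x := hδ.trans_le (hxs hm)
    have h5 := maxSpeed_pos hρ (ψ x)
    have h6 : Real.cos (ψ x) ^ 2 / β x + β x * Real.sin (ψ x) ^ 2 = maxSpeed ρ (ψ x) := by
      have h7 := hx1 hm
      have h8 : ω * s x * (1 - (maxSpeed ρ (ψ x))⁻¹ *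
          (Real.cos (ψ x) ^ 2 / β x + β x * Real.sin (ψ x) ^ 2)) = 0 := by
        rw [← h7]; ring
      have h9 := (mul_eq_zero.1 h8).resolve_left (by positivity)
      have h10 := mul_inv_cancel₀ h5.ne'
      linear_combination (-maxSpeed ρ (ψ x)) * h9 -
        (Real.cos (ψ x) ^ 2 / β x + β x * Real.sin (ψ x) ^ 2) * h10
    have h7 : Real.cos (2 * ψ x) ≠ 0 := fun h => hx4 ⟨hm, h⟩
    rcases lt_or_gt_of_ne h7 with h | h
    · exact Or.inr ⟨h, eq_of_speed_eq_maxSpeed_of_cos_neg hρ hρ1 (hxβ hm) h h6⟩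
    · exact Or.inl ⟨h, eq_of_speed_eq_maxSpeed_of_cos_pos hρ hρ1 (hxβ hm) h h6⟩


/-! ### Weak derivatives and periodic functions in H¹_loc. -/

theorem _root_.MeasureTheory.LocallyIntegrable.intervalIntegrable {f : ℝ → ℝ}
    (hf : LocallyIntegrable f volume) (x y : ℝ) : IntervalIntegrable f volume x y :=
  intervalIntegrable_iff.2 <|
    (hf.integrableOn_isCompact isCompact_uIcc).mono_set uIoc_subset_uIcc

theorem exists_support_subset_Ioo {f : ℝ → ℝ} (hf : HasCompactSupport f) :
    ∃ R : ℝ, 0 < R ∧ ∀ x, f x ≠ 0 → x ∈ Ioo (-R) R := by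
  obtain ⟨R, hR, h⟩ := hf.isCompact.isBounded.subset_ball_lt 0 0
  refine ⟨R, hR, fun x hx => ?_⟩
  have := h (subset_tsupport f hx)
  rw [Metric.mem_ball, dist_zero_right, Real.norm_eq_abs, abs_lt] at this
  exact this

theorem integral_eq_of_support_subset_Ioo {f : ℝ → ℝ} {R : ℝ}
    (h : ∀ x, f x ≠ 0 → x ∈ Ioo (-R) R) : ∫ x, f x = ∫ x in (-R)..R, f x :=
  (intervalIntegral.integral_eq_integral_of_support_subset fun x hx =>
    Ioo_subset_Ioc_self (h x hx)).symm

/-- A test function with vanishing integral is the derivative of a test function. -/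
theorem exists_primitive_of_integral_eq_zero {η : ℝ → ℝ} (hη : ContDiff ℝ (⊤ : ℕ∞) η)
    (hc : HasCompactSupport η) (h0 : ∫ x, η x = 0) :
    ∃ χ : ℝ → ℝ, ContDiff ℝ (⊤ : ℕ∞) χ ∧ HasCompactSupport χ ∧ deriv χ = η := by
  obtain ⟨R, hR, hsupp⟩ := exists_support_subset_Ioo hc
  have hi : ∀ x y : ℝ, IntervalIntegrable η volume x y := fun x y =>
    hη.continuous.intervalIntegrable x y
  have hder : ∀ x, HasDerivAt (fun x => ∫ y in (-R)..x, η y) (η x) x := fun x =>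
    intervalIntegral.integral_hasDerivAt_right (hi _ _)
      (hη.continuous.stronglyMeasurableAtFilter _ _) hη.continuous.continuousAt
  have hderiv : deriv (fun x => ∫ y in (-R)..x, η y) = η := funext fun x => (hder x).deriv
  have hR0 : ∫ y in (-R)..R, η y = 0 := by
    rw [← integral_eq_of_support_subset_Ioo hsupp, h0]
  refine ⟨fun x => ∫ y in (-R)..x, η y, ?_, ?_, hderiv⟩
  · have := (contDiff_infty_iff_deriv (𝕜 := ℝ) (f := fun x => ∫ y in (-R)..x, η y)).2
      ⟨fun x => (hder x).differentiableAt, by rw [hderiv]; exact hη⟩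
    exact this
  · refine HasCompactSupport.intro (isCompact_Icc (a := -R) (b := R)) fun x hx => ?_
    have hz : ∀ y, y ∉ Ioo (-R) R → η y = 0 := fun y hy => by
      by_contra h; exact hy (hsupp y h)
    rw [mem_Icc, not_and_or, not_le, not_le] at hx
    rcases hx with hx | hx
    · change (∫ y in (-R)..x, η y) = 0
      rw [intervalIntegral.integral_symm, neg_eq_zero]
      refine (intervalIntegral.integral_congr (g := fun _ => 0) fun y hy => hz y fun hy' => ?_).trans
        (by simp)
      rw [uIcc_of_le hx.le] at hy
      linarith [hy.2, hy'.1]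
    · change (∫ y in (-R)..x, η y) = 0
      rw [← intervalIntegral.integral_add_adjacent_intervals (hi (-R) R) (hi R x), hR0, zero_add]
      refine (intervalIntegral.integral_congr (g := fun _ => 0) fun y hy => hz y fun hy' => ?_).trans
        (by simp)
      rw [uIcc_of_le hx.le] at hy
      linarith [hy.1, hy'.2]

/-- The lemma of du Bois-Reymond. -/
theorem ae_eq_const_of_integral_mul_deriv_eq_zero {f : ℝ → ℝ} (hf : LocallyIntegrable f volume)
    (h : ∀ η : ℝ → ℝ, ContDiff ℝ (⊤ : ℕ∞) η → HasCompactSupport η → ∫ x, f x * deriv η x = 0) :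
    ∃ c : ℝ, ∀ᵐ x, f x = c := by
  obtain ⟨η₀, hη₀, hc₀, hint₀⟩ : ∃ η₀ : ℝ → ℝ, ContDiff ℝ (⊤ : ℕ∞) η₀ ∧ HasCompactSupport η₀ ∧
      ∫ x, η₀ x = 1 :=
    ⟨(default : ContDiffBump (0 : ℝ)).normed volume, ContDiffBump.contDiff_normed _,
      ContDiffBump.hasCompactSupport_normed _, ContDiffBump.integral_normed _⟩
  have hfi : ∀ η : ℝ → ℝ, ContDiff ℝ (⊤ : ℕ∞) η → HasCompactSupport η →
      Integrable (fun x => η x * f x) volume := fun η hη hc =>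
    hf.integrable_smul_left_of_hasCompactSupport hη.continuous hc
  have hηi : ∀ η : ℝ → ℝ, ContDiff ℝ (⊤ : ℕ∞) η → HasCompactSupport η →
      Integrable η volume := fun η hη hc => hη.continuous.integrable_of_hasCompactSupport hc
  refine ⟨∫ x, η₀ x * f x, ?_⟩
  have hg : LocallyIntegrable (fun x => f x - ∫ x, η₀ x * f x) volume :=
    hf.sub (locallyIntegrable_const _)
  have := ae_eq_zero_of_integral_contDiff_smul_eq_zero hg fun η hη hc => by
    -- Removing the multiple of `η₀` with the same integral leaves a test function of zero integral,
    -- which is a derivative and is therefore annihilated by `f`.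
    have hχ : ContDiff ℝ (⊤ : ℕ∞) (fun x => η x - (∫ y, η y) * η₀ x) :=
      hη.sub (contDiff_const.mul hη₀)
    have hχc : HasCompactSupport (fun x => η x - (∫ y, η y) * η₀ x) :=
      hc.sub (hc₀.mul_left (f := fun _ => ∫ y, η y))
    obtain ⟨χ, hχ1, hχ2, hχ3⟩ := exists_primitive_of_integral_eq_zero hχ hχc (by
      rw [integral_sub (hηi η hη hc) ((hηi η₀ hη₀ hc₀).const_mul _), integral_const_mul, hint₀]
      ring)
    have h1 := h χ hχ1 hχ2
    rw [hχ3] at h1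
    have h2 : ∫ x, f x * (η x - (∫ y, η y) * η₀ x) =
        (∫ x, η x * f x) - (∫ y, η y) * ∫ x, η₀ x * f x := by
      rw [← integral_const_mul, ← integral_sub (hfi η hη hc) ((hfi η₀ hη₀ hc₀).const_mul _)]
      congr 1
      ext x
      ring
    have h3 : ∫ x, η x • (f x - ∫ x, η₀ x * f x) =
        (∫ x, η x * f x) - (∫ y, η y) * ∫ x, η₀ x * f x := by
      rw [← integral_mul_const, ← integral_sub (hfi η hη hc) ((hηi η hη hc).mul_const _)]
      congr 1
      ext x
      simp only [smul_eq_mul]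
      ring
    rw [h3, ← h2, h1]
  filter_upwards [this] with x hx
  linarith

theorem MemL2Loc.locallyIntegrable {f : ℝ → ℝ} (hf : MemL2Loc f) :
    LocallyIntegrable f volume := by
  rw [locallyIntegrable_iff]
  intro K hK
  have : IsFiniteMeasure (volume.restrict K) := ⟨by
    rw [Measure.restrict_apply_univ]; exact hK.measure_lt_top⟩
  exact (hf K hK).integrable (by norm_num)

theorem memL2Loc_of_ae_bound {f : ℝ → ℝ} (hf : AEStronglyMeasurable f volume) {C : ℝ}
    (h : ∀ᵐ x, |f x| ≤ C) : MemL2Loc f := fun K hK => by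
  have : IsFiniteMeasure (volume.restrict K) := ⟨by
    rw [Measure.restrict_apply_univ]; exact hK.measure_lt_top⟩
  exact MemLp.of_bound hf.restrict C (ae_restrict_of_ae h)

theorem _root_.Continuous.memL2Loc {f : ℝ → ℝ} (hf : Continuous f) : MemL2Loc f := fun K hK => by
  have : IsFiniteMeasure (volume.restrict K) := ⟨by
    rw [Measure.restrict_apply_univ]; exact hK.measure_lt_top⟩
  obtain ⟨C, hC⟩ := hK.exists_bound_of_continuousOn hf.continuousOn
  refine MemLp.of_bound hf.aestronglyMeasurable C ?_
  rw [ae_restrict_iff' hK.measurableSet]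
  exact Eventually.of_forall hC

theorem AEPeriodic.congr {f g : ℝ → ℝ} (hf : AEPeriodic f) (h : g =ᵐ[volume] f) :
    AEPeriodic g := by
  have h1 := (measurePreserving_add_right volume (2 * Real.pi)).quasiMeasurePreserving.ae h
  filter_upwards [hf, h, h1] with x h1 h2 h3
  rw [h2, h3, h1]

theorem _root_.Function.Periodic.aePeriodic {f : ℝ → ℝ} (hf : Function.Periodic f (2 * Real.pi)) :
    AEPeriodic f := Eventually.of_forall hf

theorem AEPeriodic.periodic {f : ℝ → ℝ} (hf : AEPeriodic f) (hc : Continuous f) :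
    Function.Periodic f (2 * Real.pi) := by
  have h : Continuous fun x => f (x + 2 * Real.pi) := by fun_prop
  exact fun x => congrFun ((Continuous.ae_eq_iff_eq volume h hc).1 hf) x

theorem AEPeriodic.integral_add_two_pi {f : ℝ → ℝ} (hf : AEPeriodic f)
    (hi : LocallyIntegrable f volume) (x : ℝ) :
    ∫ y in (0 : ℝ)..(x + 2 * Real.pi), f y =
      (∫ y in (0 : ℝ)..x, f y) + ∫ y in (0 : ℝ)..(2 * Real.pi), f y := by
  have hii : ∀ x y : ℝ, IntervalIntegrable f volume x y := fun x y =>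
    hi.intervalIntegrable x y
  rw [← intervalIntegral.integral_add_adjacent_intervals (hii 0 (2 * Real.pi)) (hii _ _), add_comm]
  congr 1
  have h1 := intervalIntegral.integral_comp_add_right (a := 0) (b := x) f (2 * Real.pi)
  rw [zero_add] at h1
  rw [← h1]
  refine intervalIntegral.integral_congr_ae ?_
  filter_upwards [hf] with y hy _ using hy

theorem _root_.MeasureTheory.LocallyIntegrable.continuous_primitive' {f : ℝ → ℝ}
    (hi : LocallyIntegrable f volume) (c : ℝ) : Continuous fun x => ∫ y in c..x, f y :=
  intervalIntegral.continuous_primitive hi.intervalIntegrable c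

/-- Integration by parts on an interval containing the supports, where the boundary terms vanish. -/
theorem integral_primitive_mul_deriv {u g η : ℝ → ℝ} (hg : LocallyIntegrable g volume)
    (hu : ∀ x, u x = u 0 + ∫ y in (0 : ℝ)..x, g y)
    (hη : ContDiff ℝ (⊤ : ℕ∞) η) (hc : HasCompactSupport η) :
    ∫ x, u x * deriv η x = -∫ x, g x * η x := by
  obtain ⟨R, hR, hsupp⟩ := exists_support_subset_Ioo hc
  obtain ⟨R', hR', hsupp'⟩ := exists_support_subset_Ioo hc.deriv
  have hηd : ∀ x, HasDerivAt η (deriv η x) x := fun x =>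
    (hη.differentiable (by simp)).differentiableAt.hasDerivAt
  have hηc : Continuous (deriv η) := hη.continuous_deriv (by simp)
  obtain ⟨M, hM⟩ : ∃ M, M = max R R' := ⟨_, rfl⟩
  have hs1 : ∀ x, η x ≠ 0 → x ∈ Ioo (-M) M := fun x hx =>
    ⟨by linarith [(hsupp x hx).1, le_max_left R R'], by linarith [(hsupp x hx).2, le_max_left R R']⟩
  have hs2 : ∀ x, deriv η x ≠ 0 → x ∈ Ioo (-M) M := fun x hx =>
    ⟨by linarith [(hsupp' x hx).1, le_max_right R R'],
      by linarith [(hsupp' x hx).2, le_max_right R R']⟩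
  rw [integral_eq_of_support_subset_Ioo (R := M) fun x hx => hs2 x (right_ne_zero_of_mul hx),
    integral_eq_of_support_subset_Ioo (R := M) fun x hx => hs1 x (right_ne_zero_of_mul hx)]
  have hu' : HasACDeriv u g (-M) M := by
    refine HasACDeriv.of_eqOn_integral (hg.intervalIntegrable _ _) fun x _ => ?_
    rw [hu x, hu (-M), add_assoc, intervalIntegral.integral_add_adjacent_intervals
      (hg.intervalIntegrable _ _) (hg.intervalIntegrable _ _)]
  have hη' : HasACDeriv η (deriv η) (-M) M := HasACDeriv.of_contDiff hηd hηc
  have h1 := (hu'.mul hη').integral_eq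
  have hηM : η M = 0 := by
    by_contra h; exact lt_irrefl _ (hs1 _ h).2
  have hηM' : η (-M) = 0 := by
    by_contra h; exact lt_irrefl _ (hs1 _ h).1
  rw [hηM, hηM', intervalIntegral.integral_add] at h1
  · linarith
  · exact (hg.intervalIntegrable _ _).mul_continuousOn hη.continuous.continuousOn
  · exact (hηc.intervalIntegrable _ _).continuousOn_mul hu'.continuousOn

/-- Primitives of locally square integrable functions belong to `H¹_loc`. -/
theorem isPeriodicH1_of_primitive {u w g : ℝ → ℝ} (hg : MemL2Loc g)
    (hu : ∀ x, u x = u 0 + ∫ y in (0 : ℝ)..x, g y) (hper : Function.Periodic u (2 * Real.pi))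
    (hw : w =ᵐ[volume] u) : IsPeriodicH1 w g := by
  have hgl := hg.locallyIntegrable
  have huc : Continuous u := by
    have : u = fun x => u 0 + ∫ y in (0 : ℝ)..x, g y := funext hu
    rw [this]
    exact continuous_const.add (hgl.continuous_primitive' 0)
  refine ⟨fun K hK => (huc.memL2Loc K hK).ae_eq (ae_restrict_of_ae hw.symm), hg, ?_,
    hper.aePeriodic.congr hw⟩
  intro η hη hc
  rw [← integral_primitive_mul_deriv hgl hu hη hc]
  refine integral_congr_ae ?_
  filter_upwards [hw] with x hx
  rw [hx]

/-- Functions in `H¹_loc` are primitives of their weak derivative. -/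
theorem IsPeriodicH1.exists_primitive {w g : ℝ → ℝ} (h : IsPeriodicH1 w g) :
    ∃ u : ℝ → ℝ, w =ᵐ[volume] u ∧ Continuous u ∧ Function.Periodic u (2 * Real.pi) ∧
      ∀ x, u x = u 0 + ∫ y in (0 : ℝ)..x, g y := by
  have hgl := h.deriv_memL2Loc.locallyIntegrable
  have hwl := h.memL2Loc.locallyIntegrable
  have hG : Continuous fun x => ∫ y in (0 : ℝ)..x, g y := hgl.continuous_primitive' 0
  -- The difference of `w` and the primitive of `g` has zero weak derivative, so it is almost
  -- everywhere constant.
  have hf : LocallyIntegrable (fun x => w x - ∫ y in (0 : ℝ)..x, g y) volume :=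
    hwl.sub hG.locallyIntegrable
  obtain ⟨c, hc⟩ := ae_eq_const_of_integral_mul_deriv_eq_zero hf fun η hη hc => by
    have h1 := integral_primitive_mul_deriv (u := fun x => ∫ y in (0 : ℝ)..x, g y) hgl
      (by simp) hη hc
    have h2 := h.weakDeriv η hη hc
    have hηc : Continuous (deriv η) := hη.continuous_deriv (by simp)
    have i1 : Integrable (fun x => w x * deriv η x) volume :=
      (hwl.integrable_smul_left_of_hasCompactSupport hηc hc.deriv).congr
        (Eventually.of_forall fun x => by simp [mul_comm])
    have i2 : Integrable (fun x => (∫ y in (0 : ℝ)..x, g y) * deriv η x) volume :=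
      (hG.mul hηc).integrable_of_hasCompactSupport hc.deriv.mul_left
    simp_rw [sub_mul]
    rw [integral_sub i1 i2, h1, h2, sub_self]
  have hwu : w =ᵐ[volume] fun x => c + ∫ y in (0 : ℝ)..x, g y := by
    filter_upwards [hc] with x hx
    linarith
  have huc : Continuous fun x => c + ∫ y in (0 : ℝ)..x, g y := continuous_const.add hG
  exact ⟨_, hwu, huc, (h.periodic.congr hwu.symm).periodic huc, fun x => by simp⟩


/-! ### Existence of a maximizer of the Rayleigh quotient. -/

/-- A compact operator on a Hilbert space attains its norm. -/
theorem exists_norm_apply_eq_of_isCompactOperator {H K : Type*} [NormedAddCommGroup H]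
    [InnerProductSpace ℝ H] [CompleteSpace H] [NormedAddCommGroup K] [InnerProductSpace ℝ K]
    (S : H →L[ℝ] K) (hS : IsCompactOperator S) (h0 : S ≠ 0) :
    ∃ h : H, ‖h‖ = 1 ∧ ‖S h‖ = ‖S‖ := by
  have hpos : 0 < ‖S‖ := norm_pos_iff.2 h0
  have hex : ∀ n : ℕ, ∃ x : H, ‖x‖ < 1 ∧ ‖S‖ - 1 / ((n : ℝ) + 1) < ‖S x‖ := fun n =>
    S.exists_lt_apply_of_lt_opNorm (by
      have : (0 : ℝ) < 1 / ((n : ℝ) + 1) := by positivity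
      linarith)
  choose x hx1 hx2 using hex
  have hcomp : IsCompact (closure (S '' Metric.closedBall 0 1)) :=
    hS.isCompact_closure_image_closedBall 1
  obtain ⟨y, -, φ, hφ, hy⟩ := hcomp.tendsto_subseq (x := fun n => S (x n)) fun n =>
    subset_closure ⟨x n, by simpa using (hx1 n).le, rfl⟩
  have hyn : ‖y‖ = ‖S‖ := by
    refine le_antisymm ?_ ?_
    · refine le_of_tendsto hy.norm (Eventually.of_forall fun n => ?_)
      refine (S.le_opNorm _).trans ?_
      have := (hx1 (φ n)).le
      simpa using mul_le_mul_of_nonneg_left this hpos.le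
    · have h1 : Tendsto (fun n : ℕ => ‖S‖ - 1 / ((φ n : ℝ) + 1)) atTop (𝓝 (‖S‖ - 0)) :=
        tendsto_const_nhds.sub (tendsto_one_div_add_atTop_nhds_zero_nat.comp hφ.tendsto_atTop)
      rw [sub_zero] at h1
      exact le_of_tendsto_of_tendsto' h1 hy.norm fun n => (hx2 (φ n)).le
  -- Images of late terms are close to `y`, so ‖x_m + x_n‖ is close to 2 while both norms are below
  -- 1. The parallelogram law then makes the maximizing sequence itself Cauchy.
  have hcauchy : CauchySeq fun n => x (φ n) := by
    rw [Metric.cauchySeq_iff]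
    intro ε hε
    -- The first bound makes 2‖S‖ - 2δ nonnegative, so that it can be squared; the second turns the
    -- resulting error 8‖S‖δ into at most ‖S‖² ε²/2.
    obtain ⟨δ, hδ⟩ : ∃ δ, δ = min ‖S‖ (ε ^ 2 * ‖S‖ / 16) := ⟨_, rfl⟩
    have hδ0 : 0 < δ := by rw [hδ]; exact lt_min hpos (by positivity)
    obtain ⟨N, hN⟩ := Metric.tendsto_atTop.1 hy δ hδ0
    refine ⟨N, fun m hm n hn => ?_⟩
    have h1 := hN m hm
    have h2 := hN n hn
    simp only [Function.comp_apply, dist_eq_norm] at h1 h2 ⊢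
    have h3 : 2 * ‖S‖ - 2 * δ ≤ ‖S‖ * ‖x (φ m) + x (φ n)‖ := by
      have h4 : ‖(2 : ℝ) • y‖ ≤ ‖S (x (φ m) + x (φ n))‖ + ‖S (x (φ m)) - y‖ +
          ‖S (x (φ n)) - y‖ := by
        have : (2 : ℝ) • y = S (x (φ m) + x (φ n)) - (S (x (φ m)) - y) - (S (x (φ n)) - y) := by
          rw [map_add, two_smul]; abel
        rw [this]
        exact (norm_sub_le _ _).trans (by gcongr; exact norm_sub_le _ _)
      rw [norm_smul, Real.norm_two, hyn] at h4
      have h5 := S.le_opNorm (x (φ m) + x (φ n))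
      linarith
    have h6 := parallelogram_law_with_norm ℝ (x (φ m)) (x (φ n))
    have h7 : ‖x (φ m)‖ * ‖x (φ m)‖ ≤ 1 := by nlinarith [hx1 (φ m), norm_nonneg (x (φ m))]
    have h8 : ‖x (φ n)‖ * ‖x (φ n)‖ ≤ 1 := by nlinarith [hx1 (φ n), norm_nonneg (x (φ n))]
    have hδ1 : δ ≤ ‖S‖ := hδ ▸ min_le_left _ _
    have hδ2 : δ ≤ ε ^ 2 * ‖S‖ / 16 := hδ ▸ min_le_right _ _
    have h9 : (2 * ‖S‖ - 2 * δ) ^ 2 ≤ (‖S‖ * ‖x (φ m) + x (φ n)‖) ^ 2 :=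
      pow_le_pow_left₀ (by linarith) h3 2
    have h10 : ‖S‖ ^ 2 * ‖x (φ m) - x (φ n)‖ ^ 2 ≤ ‖S‖ ^ 2 * (ε ^ 2 / 2) := by
      have h11 : ‖x (φ m) - x (φ n)‖ ^ 2 ≤ 4 - ‖x (φ m) + x (φ n)‖ ^ 2 := by nlinarith
      have h12 := mul_le_mul_of_nonneg_left h11 (sq_nonneg ‖S‖)
      have h13 := mul_le_mul_of_nonneg_left hδ2 hpos.le
      nlinarith [sq_nonneg δ]
    have h14 := le_of_mul_le_mul_left h10 (by positivity)
    have h15 : ‖x (φ m) - x (φ n)‖ ^ 2 < ε ^ 2 := by nlinarith [sq_pos_of_pos hε]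
    exact lt_of_pow_lt_pow_left₀ 2 hε.le h15
  obtain ⟨h, hh⟩ := cauchySeq_tendsto_of_complete hcauchy
  have hSh : S h = y := tendsto_nhds_unique ((S.continuous.tendsto h).comp hh) hy
  have hle : ‖h‖ ≤ 1 := le_of_tendsto hh.norm (Eventually.of_forall fun n => (hx1 (φ n)).le)
  have hSn : ‖S h‖ = ‖S‖ := by rw [hSh, hyn]
  refine ⟨h, le_antisymm hle ?_, hSn⟩
  have := S.le_opNorm h
  rw [hSn] at this
  by_contra hlt
  nlinarith [not_le.1 hlt]

/-- Lebesgue measure on one period. -/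
noncomputable abbrev circleVol : Measure ℝ := volume.restrict (Ioc 0 (2 * Real.pi))

theorem integral_circleVol (f : ℝ → ℝ) :
    ∫ x, f x ∂circleVol = ∫ x in (0 : ℝ)..(2 * Real.pi), f x :=
  (intervalIntegral.integral_of_le Real.two_pi_pos.le).symm

theorem ae_Icc_of_ae_circleVol {P : ℝ → Prop} (h : ∀ᵐ x ∂circleVol, P x) :
    ∀ᵐ x, x ∈ Icc 0 (2 * Real.pi) → P x := by
  rw [ae_restrict_iff' measurableSet_Ioc] at h
  have h₁ : ∀ᵐ x : ℝ, x ≠ 0 := by simp [ae_iff, measure_singleton]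
  filter_upwards [h, h₁] with x hx hx0 hm
  exact hx ⟨lt_of_le_of_ne hm.1 (Ne.symm hx0), hm.2⟩

theorem _root_.MeasureTheory.MemLp.intervalIntegrable_circleVol {f : ℝ → ℝ}
    (hf : MemLp f 2 circleVol) : IntervalIntegrable f volume 0 (2 * Real.pi) :=
  (intervalIntegrable_iff_integrableOn_Ioc_of_le Real.two_pi_pos.le).2
    (hf.integrable (by norm_num))

theorem inner_toLp {f g : ℝ → ℝ} (hf : MemLp f 2 circleVol) (hg : MemLp g 2 circleVol) :
    inner ℝ (hf.toLp f) (hg.toLp g) = ∫ x in (0 : ℝ)..(2 * Real.pi), f x * g x := by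
  rw [L2.inner_def, ← integral_circleVol]
  refine integral_congr_ae ?_
  filter_upwards [hf.coeFn_toLp, hg.coeFn_toLp] with x h1 h2
  rw [h1, h2]
  simp [mul_comm]

theorem norm_sq_toLp {f : ℝ → ℝ} (hf : MemLp f 2 circleVol) :
    ‖hf.toLp f‖ ^ 2 = ∫ x in (0 : ℝ)..(2 * Real.pi), f x ^ 2 := by
  rw [← real_inner_self_eq_norm_sq, inner_toLp]
  simp only [sq]

/-- Measurable weights with positive bounds. -/
structure BddWeight (a : ℝ → ℝ) : Prop where
  aesm : AEStronglyMeasurable a volume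
  bounds : ∃ m M : ℝ, 0 < m ∧ ∀ᵐ x, m ≤ a x ∧ a x ≤ M

theorem BddWeight.exists_le {a : ℝ → ℝ} (ha : BddWeight a) :
    ∃ M : ℝ, 0 < M ∧ ∀ᵐ x, 0 < a x ∧ a x ≤ M := by
  obtain ⟨m, M, hm, h⟩ := ha.bounds
  refine ⟨max m M, lt_max_of_lt_left hm, ?_⟩
  filter_upwards [h] with x hx
  exact ⟨hm.trans_le hx.1, hx.2.trans (le_max_right _ _)⟩

theorem BddWeight.inv_sqrt {a : ℝ → ℝ} (ha : BddWeight a) :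
    AEStronglyMeasurable (fun x => (Real.sqrt (a x))⁻¹) volume ∧
      ∃ K : ℝ, 0 ≤ K ∧ ∀ᵐ x, |(Real.sqrt (a x))⁻¹| ≤ K := by
  refine ⟨ha.aesm.aemeasurable.sqrt.inv.aestronglyMeasurable, ?_⟩
  obtain ⟨m, M, hm, h⟩ := ha.bounds
  refine ⟨(Real.sqrt m)⁻¹, by positivity, ?_⟩
  filter_upwards [h] with x hx
  rw [abs_of_nonneg (by positivity)]
  gcongr
  exact hx.1

theorem BddWeight.sqrt {a : ℝ → ℝ} (ha : BddWeight a) :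
    AEStronglyMeasurable (fun x => Real.sqrt (a x)) volume ∧
      ∃ K : ℝ, 0 ≤ K ∧ ∀ᵐ x, |Real.sqrt (a x)| ≤ K := by
  refine ⟨ha.aesm.aemeasurable.sqrt.aestronglyMeasurable, ?_⟩
  obtain ⟨m, M, hm, h⟩ := ha.bounds
  refine ⟨Real.sqrt M, by positivity, ?_⟩
  filter_upwards [h] with x hx
  rw [abs_of_nonneg (by positivity)]
  gcongr
  exact hx.2

theorem _root_.MeasureTheory.MemLp.mul_of_ae_bound {σ f : ℝ → ℝ} (hf : MemLp f 2 circleVol)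
    (hσ : AEStronglyMeasurable σ volume) {K : ℝ} (hK : ∀ᵐ x, |σ x| ≤ K) :
    MemLp (fun x => σ x * f x) 2 circleVol := by
  refine hf.of_le_mul (c := K) (hσ.restrict.mul hf.aestronglyMeasurable) ?_
  filter_upwards [ae_restrict_of_ae hK] with x hx
  rw [norm_mul]
  gcongr
  exact hx

/-- Cauchy-Schwarz against σ restricted to (x, y]. The bound is Hölder continuity of exponent 1/2,
uniform over balls of L². -/
theorem abs_integral_mul_le {σ : ℝ → ℝ} (hσ : AEStronglyMeasurable σ volume) {K : ℝ}
    (hK0 : 0 ≤ K) (hK : ∀ᵐ x, |σ x| ≤ K) (h : Lp ℝ 2 circleVol) {x y : ℝ} (hx : 0 ≤ x)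
    (hxy : x ≤ y) (hy : y ≤ 2 * Real.pi) :
    |∫ t in x..y, σ t * h t| ≤ K * Real.sqrt (y - x) * ‖h‖ := by
  have hsub : Ioc x y ⊆ Ioc 0 (2 * Real.pi) := Ioc_subset_Ioc hx hy
  have hmem : MemLp ((Ioc x y).indicator σ) 2 circleVol := by
    refine MemLp.of_bound (hσ.restrict.indicator measurableSet_Ioc) K ?_
    filter_upwards [ae_restrict_of_ae hK] with t ht
    exact (norm_indicator_le_norm_self _ _).trans ht
  have h1 : inner ℝ (hmem.toLp _) h = ∫ t in x..y, σ t * h t := by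
    rw [L2.inner_def, intervalIntegral.integral_of_le hxy]
    have : ∫ t in Ioc x y, σ t * h t =
        ∫ t, (Ioc x y).indicator (fun t => σ t * h t) t ∂circleVol := by
      rw [integral_indicator measurableSet_Ioc, Measure.restrict_restrict measurableSet_Ioc,
        inter_eq_left.2 hsub]
    rw [this]
    refine integral_congr_ae ?_
    filter_upwards [hmem.coeFn_toLp] with t ht
    rw [ht]
    by_cases htm : t ∈ Ioc x y <;> simp [htm, mul_comm]
  have h2 : ‖hmem.toLp _‖ ^ 2 ≤ (K * Real.sqrt (y - x)) ^ 2 := by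
    rw [norm_sq_toLp, ← integral_circleVol, mul_pow, Real.sq_sqrt (sub_nonneg.2 hxy)]
    have h3 : ∫ t, ((Ioc x y).indicator σ t) ^ 2 ∂circleVol = ∫ t in Ioc x y, σ t ^ 2 := by
      have : (fun t => ((Ioc x y).indicator σ t) ^ 2) =
          (Ioc x y).indicator fun t => σ t ^ 2 := by
        ext t; by_cases htm : t ∈ Ioc x y <;> simp [htm]
      rw [this, integral_indicator measurableSet_Ioc, Measure.restrict_restrict measurableSet_Ioc,
        inter_eq_left.2 hsub]
    rw [h3]
    have h4 := norm_setIntegral_le_of_norm_le_const_ae (μ := volume) (s := Ioc x y)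
      (f := fun t => σ t ^ 2) (C := K ^ 2) (by simp) (by
        filter_upwards [ae_restrict_of_ae hK] with t ht
        rw [norm_pow]
        exact pow_le_pow_left₀ (norm_nonneg _) ht 2)
    refine (le_abs_self _).trans (h4.trans ?_)
    rw [Real.volume_real_Ioc_of_le hxy]
  rw [← h1]
  refine (abs_real_inner_le_norm _ _).trans ?_
  gcongr
  exact le_of_sq_le_sq h2 (by positivity)


theorem BddWeight.locallyIntegrable {a : ℝ → ℝ} (ha : BddWeight a) :
    LocallyIntegrable a volume := by
  obtain ⟨M, -, hM⟩ := ha.exists_le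
  refine (memL2Loc_of_ae_bound (C := M) ha.aesm ?_).locallyIntegrable
  filter_upwards [hM] with x hx
  rw [abs_of_pos hx.1]
  exact hx.2

theorem BddWeight.intervalIntegrable {a : ℝ → ℝ} (ha : BddWeight a) (x y : ℝ) :
    IntervalIntegrable a volume x y := ha.locallyIntegrable.intervalIntegrable x y

theorem BddWeight.integral_pos {a : ℝ → ℝ} (ha : BddWeight a) {x y : ℝ} (hxy : x < y) :
    0 < ∫ t in x..y, a t := by
  obtain ⟨m, M, hm, h⟩ := ha.bounds
  have h1 : ∫ _ in x..y, m ≤ ∫ t in x..y, a t := by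
    refine intervalIntegral.integral_mono_ae hxy.le (by simp) (ha.intervalIntegrable x y) ?_
    filter_upwards [h] with t ht using ht.1
  rw [intervalIntegral.integral_const, smul_eq_mul] at h1
  have : 0 < (y - x) * m := mul_pos (sub_pos.2 hxy) hm
  linarith

/-- The uniform Hölder estimate makes the primitives of the unit ball bounded and equicontinuous, so
compactness follows from Arzelà-Ascoli. With σ = 1/√b and h = √b w' the operator recovers w - w(0).
-/
theorem exists_primitive_operator {σ : ℝ → ℝ} (hσ : AEStronglyMeasurable σ volume) {K : ℝ}
    (hK0 : 0 ≤ K) (hK : ∀ᵐ x, |σ x| ≤ K) :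
    ∃ V : Lp ℝ 2 circleVol →L[ℝ] (Icc (0 : ℝ) (2 * Real.pi) →ᵇ ℝ), IsCompactOperator V ∧
      ∀ h x, V h x = ∫ t in (0 : ℝ)..x, σ t * h t := by
  have hint : ∀ h : Lp ℝ 2 circleVol,
      IntervalIntegrable (fun t => σ t * h t) volume 0 (2 * Real.pi) := fun h =>
    ((Lp.memLp h).mul_of_ae_bound hσ hK).intervalIntegrable_circleVol
  have hint' : ∀ h : Lp ℝ 2 circleVol, ∀ x ∈ Icc (0 : ℝ) (2 * Real.pi),
      ∀ y ∈ Icc (0 : ℝ) (2 * Real.pi),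
      IntervalIntegrable (fun t => σ t * h t) volume x y := fun h x hx y hy =>
    (hint h).mono_set (by
      rw [uIcc_of_le Real.two_pi_pos.le]
      exact uIcc_subset_Icc hx hy)
  have hz : (0 : ℝ) ∈ Icc (0 : ℝ) (2 * Real.pi) := left_mem_Icc.2 Real.two_pi_pos.le
  have hdist : ∀ (h : Lp ℝ 2 circleVol) (x y : Icc (0 : ℝ) (2 * Real.pi)),
      |(∫ t in (0 : ℝ)..x, σ t * h t) - ∫ t in (0 : ℝ)..y, σ t * h t| ≤
        K * Real.sqrt |(x : ℝ) - y| * ‖h‖ := by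
    intro h x y
    wlog hxy : (x : ℝ) ≤ y generalizing x y
    · rw [abs_sub_comm, abs_sub_comm (x : ℝ)]
      exact this y x (not_le.1 hxy).le
    · rw [abs_sub_comm, abs_sub_comm (x : ℝ), intervalIntegral.integral_interval_sub_left
        (hint' h _ hz _ y.2) (hint' h _ hz _ x.2), abs_of_nonneg (sub_nonneg.2 hxy)]
      exact abs_integral_mul_le hσ hK0 hK h x.2.1 hxy y.2.2
  have hcont : ∀ h : Lp ℝ 2 circleVol,
      Continuous fun x : Icc (0 : ℝ) (2 * Real.pi) => ∫ t in (0 : ℝ)..x, σ t * h t := by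
    intro h
    have h1 := (HasACDeriv.of_integral (hint h) 0).continuousOn
    rw [uIcc_of_le Real.two_pi_pos.le] at h1
    simpa [zero_add] using! h1.domRestrict
  obtain ⟨V₀, hV₀⟩ : ∃ V₀ : Lp ℝ 2 circleVol →ₗ[ℝ] (Icc (0 : ℝ) (2 * Real.pi) →ᵇ ℝ),
      ∀ h x, V₀ h x = ∫ t in (0 : ℝ)..x, σ t * h t := by
    refine ⟨{ toFun := fun h => BoundedContinuousFunction.mkOfCompact ⟨_, hcont h⟩
              map_add' := fun h k => ?_
              map_smul' := fun c h => ?_ }, fun h x => rfl⟩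
    · ext x
      simp only [BoundedContinuousFunction.mkOfCompact_apply, ContinuousMap.coe_mk,
        BoundedContinuousFunction.coe_add, Pi.add_apply]
      rw [← intervalIntegral.integral_add (hint' h _ hz _ x.2) (hint' k _ hz _ x.2)]
      refine intervalIntegral.integral_congr_ae ?_
      filter_upwards [ae_Icc_of_ae_circleVol (Lp.coeFn_add h k)] with t ht hm
      rw [ht ?_, Pi.add_apply, mul_add]
      rw [uIoc_of_le x.2.1] at hm
      exact ⟨hm.1.le, hm.2.trans x.2.2⟩
    · ext x
      simp only [BoundedContinuousFunction.mkOfCompact_apply, ContinuousMap.coe_mk,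
        BoundedContinuousFunction.coe_smul, RingHom.id_apply, smul_eq_mul]
      rw [← intervalIntegral.integral_const_mul]
      refine intervalIntegral.integral_congr_ae ?_
      filter_upwards [ae_Icc_of_ae_circleVol (Lp.coeFn_smul c h)] with t ht hm
      rw [ht ?_, Pi.smul_apply, smul_eq_mul]
      · ring
      rw [uIoc_of_le x.2.1] at hm
      exact ⟨hm.1.le, hm.2.trans x.2.2⟩
  have hbound : ∀ h, ‖V₀ h‖ ≤ K * Real.sqrt (2 * Real.pi) * ‖h‖ := by
    intro h
    refine (BoundedContinuousFunction.norm_le (by positivity)).2 fun x => ?_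
    have h1 := hdist h x ⟨0, hz⟩
    simp only [intervalIntegral.integral_same, sub_zero] at h1
    rw [hV₀, Real.norm_eq_abs]
    refine h1.trans ?_
    gcongr
    rw [abs_of_nonneg x.2.1]
    exact x.2.2
  refine ⟨V₀.mkContinuous _ hbound, ?_, hV₀⟩
  refine (isCompactOperator_iff_isCompact_closure_image_closedBall V₀ one_pos).2 ?_
  refine BoundedContinuousFunction.arzela_ascoli
    (Metric.closedBall (0 : ℝ) (K * Real.sqrt (2 * Real.pi))) (isCompact_closedBall _ _) _ ?_ ?_
  · rintro f x ⟨h, hh, rfl⟩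
    rw [mem_closedBall_zero_iff] at hh ⊢
    refine (BoundedContinuousFunction.norm_coe_le_norm _ x).trans ((hbound h).trans ?_)
    exact mul_le_of_le_one_right (by positivity) hh
  · refine Metric.equicontinuous_of_continuity_modulus (fun d => K * Real.sqrt d) ?_ _ ?_
    · have : Continuous fun d : ℝ => K * Real.sqrt d := by fun_prop
      simpa using this.tendsto 0
    · rintro x y ⟨f, h, hh, rfl⟩
      rw [mem_closedBall_zero_iff] at hh
      change dist (V₀ h x) (V₀ h y) ≤ _
      rw [hV₀, hV₀, Real.dist_eq, Subtype.dist_eq, Real.dist_eq]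
      refine (hdist h x y).trans ?_
      exact mul_le_of_le_one_right (by positivity) hh

/-- Subtracting the mean with weight `a` enforces the constraint, and the factor √a makes the
squared L² norm equal to ∫ a w². The projection `projIcc` only lets functions on the closed interval
be evaluated on the line. -/
theorem exists_centering_operator {a : ℝ → ℝ} (ha : BddWeight a) :
    ∃ J : (Icc (0 : ℝ) (2 * Real.pi) →ᵇ ℝ) →L[ℝ] Lp ℝ 2 circleVol, ∀ f,
      J f =ᵐ[circleVol] fun x => Real.sqrt (a x) *
        (f (projIcc 0 (2 * Real.pi) Real.two_pi_pos.le x) -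
          (∫ y in (0 : ℝ)..(2 * Real.pi), a y)⁻¹ * ∫ y in (0 : ℝ)..(2 * Real.pi),
            a y * f (projIcc 0 (2 * Real.pi) Real.two_pi_pos.le y)) := by
  obtain ⟨hsm, K, hK0, hK⟩ := ha.sqrt
  have hA : 0 < ∫ y in (0 : ℝ)..(2 * Real.pi), a y := ha.integral_pos Real.two_pi_pos
  have hfc : ∀ f : Icc (0 : ℝ) (2 * Real.pi) →ᵇ ℝ,
      Continuous fun x => f (projIcc 0 (2 * Real.pi) Real.two_pi_pos.le x) := fun f =>
    f.continuous.comp continuous_projIcc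
  have hi : ∀ f : Icc (0 : ℝ) (2 * Real.pi) →ᵇ ℝ, IntervalIntegrable
      (fun y => a y * f (projIcc 0 (2 * Real.pi) Real.two_pi_pos.le y)) volume 0 (2 * Real.pi) :=
    fun f => (ha.intervalIntegrable _ _).mul_continuousOn (hfc f).continuousOn
  have hmem : ∀ f : Icc (0 : ℝ) (2 * Real.pi) →ᵇ ℝ, MemLp (fun x => Real.sqrt (a x) *
        (f (projIcc 0 (2 * Real.pi) Real.two_pi_pos.le x) -
          (∫ y in (0 : ℝ)..(2 * Real.pi), a y)⁻¹ * ∫ y in (0 : ℝ)..(2 * Real.pi),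
            a y * f (projIcc 0 (2 * Real.pi) Real.two_pi_pos.le y))) 2 circleVol := by
    intro f
    refine MemLp.mul_of_ae_bound ?_ hsm hK
    refine MemLp.of_bound ((hfc f).sub continuous_const).aestronglyMeasurable
      (‖f‖ + ‖(∫ y in (0 : ℝ)..(2 * Real.pi), a y)⁻¹ * ∫ y in (0 : ℝ)..(2 * Real.pi),
            a y * f (projIcc 0 (2 * Real.pi) Real.two_pi_pos.le y)‖) ?_
    refine Eventually.of_forall fun x => (norm_sub_le _ _).trans ?_
    gcongr
    exact f.norm_coe_le_norm _
  obtain ⟨J₀, hJ₀⟩ : ∃ J₀ : (Icc (0 : ℝ) (2 * Real.pi) →ᵇ ℝ) →ₗ[ℝ] Lp ℝ 2 circleVol,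
      ∀ f, J₀ f = (hmem f).toLp _ := by
    refine ⟨{ toFun := fun f => (hmem f).toLp _
              map_add' := fun f g => ?_
              map_smul' := fun c f => ?_ }, fun f => rfl⟩
    · rw [← MemLp.toLp_add]
      congr 1
      ext x
      simp only [BoundedContinuousFunction.coe_add, Pi.add_apply, mul_add]
      rw [intervalIntegral.integral_add (hi f) (hi g)]
      ring
    · rw [RingHom.id_apply, ← MemLp.toLp_const_smul]
      congr 1
      ext x
      simp only [BoundedContinuousFunction.coe_smul, Pi.smul_apply, smul_eq_mul,
        mul_left_comm (a _) c]
      rw [intervalIntegral.integral_const_mul]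
      ring
  have hmean : ∀ f : Icc (0 : ℝ) (2 * Real.pi) →ᵇ ℝ,
      |(∫ y in (0 : ℝ)..(2 * Real.pi), a y)⁻¹ * ∫ y in (0 : ℝ)..(2 * Real.pi),
            a y * f (projIcc 0 (2 * Real.pi) Real.two_pi_pos.le y)| ≤ ‖f‖ := by
    intro f
    rw [abs_mul, abs_of_pos (inv_pos.2 hA), inv_mul_le_iff₀ hA]
    obtain ⟨M, -, hM⟩ := ha.exists_le
    have h1 := intervalIntegral.norm_integral_le_of_norm_le (f := fun y => a y * f (projIcc 0
      (2 * Real.pi) Real.two_pi_pos.le y)) (g := fun y => a y * ‖f‖) Real.two_pi_pos.le (by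
        filter_upwards [hM] with y hy _
        rw [norm_mul, Real.norm_of_nonneg hy.1.le]
        exact mul_le_mul_of_nonneg_left (f.norm_coe_le_norm _) hy.1.le)
      ((ha.intervalIntegrable _ _).mul_const _)
    rwa [intervalIntegral.integral_mul_const] at h1
  refine ⟨J₀.mkContinuous ((measureUnivNNReal circleVol : ℝ) ^ (2 : ENNReal).toReal⁻¹ * (K * 2))
    fun f => ?_, fun f => ?_⟩
  · rw [hJ₀, mul_assoc]
    refine Lp.norm_le_of_ae_bound (by positivity) ?_
    filter_upwards [(hmem f).coeFn_toLp, ae_restrict_of_ae hK] with x hx hKx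
    rw [hx, norm_mul, mul_assoc]
    gcongr
    · exact hKx
    · refine (norm_sub_le _ _).trans ?_
      exact (add_le_add (f.norm_coe_le_norm _) (hmean f)).trans_eq (two_mul _).symm
  · rw [LinearMap.mkContinuous_apply, hJ₀]
    exact (hmem f).coeFn_toLp


/-- Competitors in the Wirtinger inequality, restricted to one period. -/
structure IsCompetitor (a w g : ℝ → ℝ) : Prop where
  memLp : MemLp g 2 circleVol
  eq_primitive : ∀ x ∈ Icc 0 (2 * Real.pi), w x = w 0 + ∫ y in (0 : ℝ)..x, g y
  periodic : w (2 * Real.pi) = w 0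
  constraint : ∫ x in (0 : ℝ)..(2 * Real.pi), a x * w x = 0

theorem zero_mem_Icc_two_pi : (0 : ℝ) ∈ Icc 0 (2 * Real.pi) := left_mem_Icc.2 Real.two_pi_pos.le

theorem two_pi_mem_Icc : 2 * Real.pi ∈ Icc 0 (2 * Real.pi) := right_mem_Icc.2 Real.two_pi_pos.le

theorem uIcc_two_pi : uIcc 0 (2 * Real.pi) = Icc 0 (2 * Real.pi) := uIcc_of_le Real.two_pi_pos.le

theorem IsCompetitor.hasACDeriv {a w g : ℝ → ℝ} (h : IsCompetitor a w g) :
    HasACDeriv w g 0 (2 * Real.pi) :=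
  HasACDeriv.of_eqOn_integral h.memLp.intervalIntegrable_circleVol fun x hx =>
    h.eq_primitive x (uIcc_two_pi ▸ hx)

theorem integral_congr_Icc {f g : ℝ → ℝ} (h : ∀ x ∈ Icc 0 (2 * Real.pi), f x = g x) :
    ∫ x in (0 : ℝ)..(2 * Real.pi), f x = ∫ x in (0 : ℝ)..(2 * Real.pi), g x :=
  intervalIntegral.integral_congr fun x hx => h x (uIcc_two_pi ▸ hx)

theorem integral_congr_circleVol {f g : ℝ → ℝ} (h : ∀ᵐ x ∂circleVol, f x = g x) :
    ∫ x in (0 : ℝ)..(2 * Real.pi), f x = ∫ x in (0 : ℝ)..(2 * Real.pi), g x := by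
  rw [← integral_circleVol, ← integral_circleVol]
  exact integral_congr_ae h

theorem integral_congr_left {f g : ℝ → ℝ} (h : ∀ᵐ x ∂circleVol, f x = g x) {x : ℝ}
    (hx : x ∈ Icc 0 (2 * Real.pi)) :
    ∫ y in (0 : ℝ)..x, f y = ∫ y in (0 : ℝ)..x, g y := by
  refine intervalIntegral.integral_congr_ae ?_
  filter_upwards [ae_Icc_of_ae_circleVol h] with t ht hm
  rw [uIoc_of_le hx.1] at hm
  exact ht ⟨hm.1.le, hm.2.trans hx.2⟩

/-- The sine minus its weighted mean c will do, since ∫ (sin - c)² = π + 2πc². This guarantees that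
the operator to be maximized is not zero. -/
theorem exists_competitor_integral_pos {a : ℝ → ℝ} (ha : BddWeight a) :
    ∃ w g, IsCompetitor a w g ∧ 0 < ∫ x in (0 : ℝ)..(2 * Real.pi), a x * w x ^ 2 := by
  have hA := ha.integral_pos Real.two_pi_pos
  obtain ⟨c, hc⟩ : ∃ c, c = (∫ y in (0 : ℝ)..(2 * Real.pi), a y)⁻¹ *
    ∫ y in (0 : ℝ)..(2 * Real.pi), a y * Real.sin y := ⟨_, rfl⟩
  have hi : ∀ f : ℝ → ℝ, Continuous f →
      IntervalIntegrable (fun x => a x * f x) volume 0 (2 * Real.pi) := fun f hf =>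
    (ha.intervalIntegrable _ _).mul_continuousOn hf.continuousOn
  refine ⟨fun x => Real.sin x - c, Real.cos, ⟨?_, ?_, ?_, ?_⟩, ?_⟩
  · exact MemLp.of_bound Real.continuous_cos.aestronglyMeasurable 1
      (Eventually.of_forall fun x => Real.abs_cos_le_one x)
  · intro x _
    rw [integral_cos, Real.sin_zero]
    ring
  · simp
  · simp_rw [mul_sub]
    rw [intervalIntegral.integral_sub (hi _ Real.continuous_sin) (hi _ continuous_const),
      intervalIntegral.integral_mul_const, hc, ← mul_assoc, mul_inv_cancel₀ hA.ne']
    ring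
  · obtain ⟨m, M, hm, hb⟩ := ha.bounds
    have h1 : ∫ x in (0 : ℝ)..(2 * Real.pi), m * (Real.sin x - c) ^ 2 ≤
        ∫ x in (0 : ℝ)..(2 * Real.pi), a x * (Real.sin x - c) ^ 2 := by
      refine intervalIntegral.integral_mono_ae Real.two_pi_pos.le
        (Continuous.intervalIntegrable (by fun_prop) _ _) (hi _ (by fun_prop)) ?_
      filter_upwards [hb] with x hx
      exact mul_le_mul_of_nonneg_right hx.1 (sq_nonneg _)
    refine lt_of_lt_of_le ?_ h1
    rw [intervalIntegral.integral_const_mul]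
    refine mul_pos hm ?_
    have h2 : ∀ x, (Real.sin x - c) ^ 2 = Real.sin x ^ 2 - 2 * c * Real.sin x + c ^ 2 := fun x => by
      ring
    simp_rw [h2]
    rw [intervalIntegral.integral_add (Continuous.intervalIntegrable (by fun_prop) _ _)
        (Continuous.intervalIntegrable (by fun_prop) _ _),
      intervalIntegral.integral_sub (Continuous.intervalIntegrable (by fun_prop) _ _)
        (Continuous.intervalIntegrable (by fun_prop) _ _),
      intervalIntegral.integral_const_mul, integral_sin_sq, integral_sin]
    simp only [Real.sin_zero, Real.cos_zero, Real.sin_two_pi, Real.cos_two_pi,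
      intervalIntegral.integral_const, smul_eq_mul]
    nlinarith [Real.pi_pos, mul_nonneg Real.pi_pos.le (sq_nonneg c)]

/-- The Rayleigh quotient attains its maximum. -/
theorem exists_maximizer {a b : ℝ → ℝ} (ha : BddWeight a) (hb : BddWeight b) :
    ∃ C : ℝ, 0 < C ∧ (∀ w g, IsCompetitor a w g →
      ∫ x in (0 : ℝ)..(2 * Real.pi), a x * w x ^ 2 ≤
        C * ∫ x in (0 : ℝ)..(2 * Real.pi), b x * g x ^ 2) ∧
      ∃ w g, IsCompetitor a w g ∧ 0 < ∫ x in (0 : ℝ)..(2 * Real.pi), a x * w x ^ 2 ∧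
        ∫ x in (0 : ℝ)..(2 * Real.pi), a x * w x ^ 2 =
          C * ∫ x in (0 : ℝ)..(2 * Real.pi), b x * g x ^ 2 := by
  obtain ⟨hσ, K, hK0, hK⟩ := hb.inv_sqrt
  obtain ⟨hσ', K', hK0', hK'⟩ := hb.sqrt
  obtain ⟨V, hVc, hV⟩ := exists_primitive_operator hσ hK0 hK
  obtain ⟨J, hJ⟩ := exists_centering_operator ha
  have hA := ha.integral_pos Real.two_pi_pos
  have hbpos : ∀ᵐ x ∂circleVol, 0 < b x := by
    obtain ⟨M, -, h⟩ := hb.exists_le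
    exact ae_restrict_of_ae (by filter_upwards [h] with x hx using hx.1)
  have hapos : ∀ᵐ x ∂circleVol, 0 < a x := by
    obtain ⟨M, -, h⟩ := ha.exists_le
    exact ae_restrict_of_ae (by filter_upwards [h] with x hx using hx.1)
  obtain ⟨ℓ, hℓ⟩ : ∃ ℓ : Lp ℝ 2 circleVol →L[ℝ] ℝ,
      ∀ h, ℓ h = ∫ t in (0 : ℝ)..(2 * Real.pi), (Real.sqrt (b t))⁻¹ * h t :=
    ⟨(BoundedContinuousFunction.evalCLM ℝ
      (⟨2 * Real.pi, two_pi_mem_Icc⟩ : Icc (0 : ℝ) (2 * Real.pi))).comp V,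
      fun h => hV h ⟨_, two_pi_mem_Icc⟩⟩
  -- Here h stands for √b w', and membership in `E` says that the primitive w is periodic.
  obtain ⟨E, hE⟩ : ∃ E : Submodule ℝ (Lp ℝ 2 circleVol), E = ℓ.ker := ⟨_, rfl⟩
  have hEcl : IsClosed (E : Set (Lp ℝ 2 circleVol)) := hE ▸ ℓ.isClosed_ker
  have : CompleteSpace E := hEcl.completeSpace_coe
  have hmE : ∀ h, h ∈ E ↔ ∫ t in (0 : ℝ)..(2 * Real.pi), (Real.sqrt (b t))⁻¹ * h t = 0 :=
    fun h => by rw [hE, ← hℓ]; exact LinearMap.mem_ker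
  -- In this parametrization ‖h‖² = ∫ b w'² and ‖S h‖² = ∫ a w², so the maximum of the Rayleigh
  -- quotient is ‖S‖².
  obtain ⟨S, hS⟩ : ∃ S : E →L[ℝ] Lp ℝ 2 circleVol, S = (J.comp V).comp E.subtypeL := ⟨_, rfl⟩
  have hSc : IsCompactOperator S := hS ▸ (hVc.clm_comp J).comp_clm E.subtypeL
  obtain ⟨u, hu⟩ : ∃ u : Lp ℝ 2 circleVol → ℝ → ℝ, ∀ h x, u h x =
      V h (projIcc 0 (2 * Real.pi) Real.two_pi_pos.le x) -
        (∫ y in (0 : ℝ)..(2 * Real.pi), a y)⁻¹ * ∫ y in (0 : ℝ)..(2 * Real.pi),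
          a y * V h (projIcc 0 (2 * Real.pi) Real.two_pi_pos.le y) := ⟨_, fun _ _ => rfl⟩
  have huV : ∀ h, ∀ x ∈ Icc 0 (2 * Real.pi), V h (projIcc 0 (2 * Real.pi) Real.two_pi_pos.le x) =
      ∫ t in (0 : ℝ)..x, (Real.sqrt (b t))⁻¹ * h t := fun h x hx => by
    rw [projIcc_of_mem _ hx, hV]
  have hu0 : ∀ h, u h 0 = -((∫ y in (0 : ℝ)..(2 * Real.pi), a y)⁻¹ *
      ∫ y in (0 : ℝ)..(2 * Real.pi),
        a y * V h (projIcc 0 (2 * Real.pi) Real.two_pi_pos.le y)) := fun h => by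
    rw [hu, huV h 0 zero_mem_Icc_two_pi, intervalIntegral.integral_same, zero_sub]
  have hnorm : ∀ h : E, ‖S h‖ ^ 2 = ∫ x in (0 : ℝ)..(2 * Real.pi), a x * u h x ^ 2 := by
    intro h
    rw [← real_inner_self_eq_norm_sq, L2.inner_def, ← integral_circleVol]
    refine integral_congr_ae ?_
    filter_upwards [hJ (V h), hapos] with x hx hax
    rw [hS]
    simp only [ContinuousLinearMap.comp_apply, Submodule.subtypeL_apply]
    rw [hx, ← hu, real_inner_self_eq_norm_sq, Real.norm_eq_abs, sq_abs, mul_pow,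
      Real.sq_sqrt hax.le]
  have hnorm' : ∀ h : Lp ℝ 2 circleVol, ‖h‖ ^ 2 =
      ∫ x in (0 : ℝ)..(2 * Real.pi), b x * ((Real.sqrt (b x))⁻¹ * h x) ^ 2 := by
    intro h
    rw [← real_inner_self_eq_norm_sq, L2.inner_def, ← integral_circleVol]
    refine integral_congr_ae ?_
    filter_upwards [hbpos] with x hx
    rw [real_inner_self_eq_norm_sq, Real.norm_eq_abs, sq_abs, mul_pow, inv_pow,
      Real.sq_sqrt hx.le, ← mul_assoc, mul_inv_cancel₀ hx.ne', one_mul]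
  have hcomp : ∀ h ∈ E, IsCompetitor a (u h) fun x => (Real.sqrt (b x))⁻¹ * h x := by
    intro h hh
    refine ⟨(Lp.memLp h).mul_of_ae_bound hσ hK, fun x hx => ?_, ?_, ?_⟩
    · rw [hu0, hu, huV h x hx]; ring
    · rw [hu0, hu, huV h _ two_pi_mem_Icc, (hmE h).1 hh, zero_sub]
    · simp_rw [hu, mul_sub]
      rw [intervalIntegral.integral_sub, intervalIntegral.integral_mul_const, ← mul_assoc,
        mul_inv_cancel₀ hA.ne', one_mul, sub_self]
      · exact (ha.intervalIntegrable _ _).mul_continuousOn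
          ((V h).continuous.comp continuous_projIcc).continuousOn
      · exact (ha.intervalIntegrable _ _).mul_const _
  -- Conversely, each competitor arises from h = √b g: the derivative determines it up to a
  -- constant, and the constraint fixes the constant.
  have hconv : ∀ w g, IsCompetitor a w g → ∃ h : E,
      ‖(h : Lp ℝ 2 circleVol)‖ ^ 2 = ∫ x in (0 : ℝ)..(2 * Real.pi), b x * g x ^ 2 ∧
      ‖S h‖ ^ 2 = ∫ x in (0 : ℝ)..(2 * Real.pi), a x * w x ^ 2 := by
    intro w g hw
    have hmem := hw.memLp.mul_of_ae_bound hσ' hK'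
    have hae : ∀ᵐ x ∂circleVol, (Real.sqrt (b x))⁻¹ * hmem.toLp _ x = g x := by
      filter_upwards [hmem.coeFn_toLp, hbpos] with x hx hbx
      rw [hx, inv_mul_cancel_left₀ (Real.sqrt_pos.2 hbx).ne']
    have hin : hmem.toLp _ ∈ E := by
      rw [hmE, integral_congr_circleVol hae]
      have := hw.eq_primitive _ two_pi_mem_Icc
      rw [hw.periodic] at this
      linarith
    have hVw : ∀ x ∈ Icc 0 (2 * Real.pi),
        V (hmem.toLp _) (projIcc 0 (2 * Real.pi) Real.two_pi_pos.le x) = w x - w 0 := by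
      intro x hx
      rw [huV _ x hx, integral_congr_left hae hx, hw.eq_primitive x hx]
      ring
    have huw : ∀ x ∈ Icc 0 (2 * Real.pi), u (hmem.toLp _) x = w x := by
      intro x hx
      have hI : ∫ y in (0 : ℝ)..(2 * Real.pi),
          a y * V (hmem.toLp _) (projIcc 0 (2 * Real.pi) Real.two_pi_pos.le y) =
          ∫ y in (0 : ℝ)..(2 * Real.pi), (a y * w y - a y * w 0) :=
        integral_congr_Icc fun y hy => by rw [hVw y hy, mul_sub]
      rw [hu, hVw x hx, hI, intervalIntegral.integral_sub, hw.constraint,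
        intervalIntegral.integral_mul_const, zero_sub, mul_neg, ← mul_assoc,
        inv_mul_cancel₀ hA.ne']
      · ring
      · exact (ha.intervalIntegrable _ _).mul_continuousOn hw.hasACDeriv.continuousOn
      · exact (ha.intervalIntegrable _ _).mul_const _
    refine ⟨⟨_, hin⟩, ?_, ?_⟩
    · rw [hnorm']
      refine integral_congr_circleVol ?_
      filter_upwards [hae] with x hx
      rw [hx]
    · rw [hnorm]
      exact integral_congr_Icc fun x hx => by rw [huw x hx]
  have hS0 : S ≠ 0 := by
    obtain ⟨w, g, hw, hpos⟩ := exists_competitor_integral_pos ha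
    obtain ⟨h, -, h2⟩ := hconv w g hw
    rintro rfl
    simp only [zero_apply, norm_zero] at h2
    rw [← h2] at hpos
    norm_num at hpos
  have hSpos : 0 < ‖S‖ := by
    refine lt_of_le_of_ne S.opNorm_nonneg fun h => hS0 (ContinuousLinearMap.ext fun k => ?_)
    have := S.le_opNorm k
    rw [← h, zero_mul] at this
    exact norm_le_zero_iff.1 this
  obtain ⟨h, hh1, hh2⟩ := exists_norm_apply_eq_of_isCompactOperator S hSc hS0
  refine ⟨‖S‖ ^ 2, by positivity, fun w g hw => ?_, u h, _, hcomp h h.2, ?_, ?_⟩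
  · obtain ⟨k, hk1, hk2⟩ := hconv w g hw
    rw [← hk1, ← hk2, ← mul_pow]
    exact pow_le_pow_left₀ (norm_nonneg _) (S.le_opNorm k) 2
  · rw [← hnorm, hh2]; positivity
  · have hh3 : ‖(h : Lp ℝ 2 circleVol)‖ = 1 := hh1
    rw [← hnorm, hh2, ← hnorm', hh3]; ring


/-! ### The first variation and the Euler-Lagrange equation. -/

theorem BddWeight.exists_abs_le {a : ℝ → ℝ} (ha : BddWeight a) : ∃ M : ℝ, ∀ᵐ x, |a x| ≤ M := by
  obtain ⟨M, -, hM⟩ := ha.exists_le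
  exact ⟨M, by filter_upwards [hM] with x hx; rw [abs_of_pos hx.1]; exact hx.2⟩

theorem BddWeight.intervalIntegrable_mul_mul {b g k : ℝ → ℝ} (hb : BddWeight b)
    (hg : MemLp g 2 circleVol) (hk : MemLp k 2 circleVol) :
    IntervalIntegrable (fun x => b x * (g x * k x)) volume 0 (2 * Real.pi) := by
  obtain ⟨M, hM⟩ := hb.exists_abs_le
  have h : Integrable (fun x => (b x * g x) * k x) circleVol :=
    (hg.mul_of_ae_bound hb.aesm hM).integrable_mul hk
  rw [intervalIntegrable_iff_integrableOn_Ioc_of_le Real.two_pi_pos.le]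
  exact h.congr (Eventually.of_forall fun x => by ring)

theorem IsCompetitor.memLp_self {a w g : ℝ → ℝ} (h : IsCompetitor a w g) :
    MemLp w 2 circleVol := by
  have hc := h.hasACDeriv.continuousOn
  rw [uIcc_two_pi] at hc
  obtain ⟨C, hC⟩ := isCompact_Icc.exists_bound_of_continuousOn hc
  refine MemLp.of_bound ((hc.mono Ioc_subset_Icc_self).aestronglyMeasurable measurableSet_Ioc) C ?_
  rw [ae_restrict_iff' measurableSet_Ioc]
  exact Eventually.of_forall fun x hx => hC x (Ioc_subset_Icc_self hx)

theorem IsCompetitor.add_const_mul {a w g w₁ g₁ : ℝ → ℝ} (ha : BddWeight a)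
    (h : IsCompetitor a w g) (h₁ : IsCompetitor a w₁ g₁) (t : ℝ) :
    IsCompetitor a (fun x => w x + t * w₁ x) (fun x => g x + t * g₁ x) := by
  refine ⟨h.memLp.add (h₁.memLp.const_mul t), fun x hx => ?_, ?_, ?_⟩
  · have hsub : uIcc 0 x ⊆ uIcc 0 (2 * Real.pi) :=
      uIcc_subset_uIcc left_mem_uIcc (uIcc_two_pi ▸ hx)
    rw [intervalIntegral.integral_add, intervalIntegral.integral_const_mul, h.eq_primitive x hx,
      h₁.eq_primitive x hx]
    · ring
    · exact h.memLp.intervalIntegrable_circleVol.mono_set hsub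
    · exact (h₁.memLp.intervalIntegrable_circleVol.mono_set hsub).const_mul t
  · rw [h.periodic, h₁.periodic]
  · have hr : ∀ x, a x * (w x + t * w₁ x) = a x * w x + t * (a x * w₁ x) := fun x => by ring
    simp_rw [hr]
    rw [intervalIntegral.integral_add, intervalIntegral.integral_const_mul, h.constraint,
      h₁.constraint]
    · ring
    · exact (ha.intervalIntegrable _ _).mul_continuousOn h.hasACDeriv.continuousOn
    · exact ((ha.intervalIntegrable _ _).mul_continuousOn h₁.hasACDeriv.continuousOn).const_mul t

theorem integral_weight_add_sq {b f k : ℝ → ℝ} (hb : BddWeight b) (hf : MemLp f 2 circleVol)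
    (hk : MemLp k 2 circleVol) (t : ℝ) :
    ∫ x in (0 : ℝ)..(2 * Real.pi), b x * (f x + t * k x) ^ 2 =
      (∫ x in (0 : ℝ)..(2 * Real.pi), b x * f x ^ 2) +
        2 * t * (∫ x in (0 : ℝ)..(2 * Real.pi), b x * (f x * k x)) +
        t ^ 2 * ∫ x in (0 : ℝ)..(2 * Real.pi), b x * k x ^ 2 := by
  have h1 := hb.intervalIntegrable_mul_mul hf hk
  have h2 := hb.intervalIntegrable_mul_mul hf hf
  have h3 := hb.intervalIntegrable_mul_mul hk hk
  simp_rw [sq] at *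
  rw [← intervalIntegral.integral_const_mul, ← intervalIntegral.integral_const_mul,
    ← intervalIntegral.integral_add h2 (h1.const_mul _),
    ← intervalIntegral.integral_add (h2.add (h1.const_mul _)) (h3.const_mul _)]
  congr 1
  ext x
  ring

/-- The first variation vanishes at a maximizer of the Rayleigh quotient. -/
theorem IsCompetitor.first_variation {a b w g w₁ g₁ : ℝ → ℝ} {C : ℝ} (ha : BddWeight a)
    (hb : BddWeight b) (hC : ∀ w g, IsCompetitor a w g →
      ∫ x in (0 : ℝ)..(2 * Real.pi), a x * w x ^ 2 ≤
        C * ∫ x in (0 : ℝ)..(2 * Real.pi), b x * g x ^ 2)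
    (h : IsCompetitor a w g) (heq : ∫ x in (0 : ℝ)..(2 * Real.pi), a x * w x ^ 2 =
        C * ∫ x in (0 : ℝ)..(2 * Real.pi), b x * g x ^ 2) (h₁ : IsCompetitor a w₁ g₁) :
    ∫ x in (0 : ℝ)..(2 * Real.pi), a x * (w x * w₁ x) =
      C * ∫ x in (0 : ℝ)..(2 * Real.pi), b x * (g x * g₁ x) := by
  -- The deficit of `w + t w₁` in the inequality is a nonnegative quadratic polynomial in t without
  -- constant term; its discriminant forces the linear coefficient to vanish.
  have hq : ∀ t : ℝ, 0 ≤ (C * (∫ x in (0 : ℝ)..(2 * Real.pi), b x * g₁ x ^ 2) -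
      ∫ x in (0 : ℝ)..(2 * Real.pi), a x * w₁ x ^ 2) * (t * t) +
      (2 * (C * (∫ x in (0 : ℝ)..(2 * Real.pi), b x * (g x * g₁ x)) -
        ∫ x in (0 : ℝ)..(2 * Real.pi), a x * (w x * w₁ x))) * t + 0 := by
    intro t
    have h2 := hC _ _ (h.add_const_mul ha h₁ t)
    rw [integral_weight_add_sq ha h.memLp_self h₁.memLp_self,
      integral_weight_add_sq hb h.memLp h₁.memLp, heq] at h2
    linarith
  have h3 := discrim_le_zero hq
  rw [discrim, mul_zero, sub_zero] at h3
  have h4 := pow_eq_zero_iff two_ne_zero |>.1 (le_antisymm h3 (sq_nonneg _))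
  linarith

/-- `w` and `v = b w'` solve the periodic problem `(b w')' + lam a w = 0`. -/
structure IsPeriodicSol (a b : ℝ → ℝ) (lam : ℝ) (w v : ℝ → ℝ) : Prop where
  deriv_fst : HasACDeriv w (fun x => v x / b x) 0 (2 * Real.pi)
  deriv_snd : HasACDeriv v (fun x => -(lam * (a x * w x))) 0 (2 * Real.pi)
  periodic_fst : w (2 * Real.pi) = w 0
  periodic_snd : v (2 * Real.pi) = v 0

theorem BddWeight.ae_pos_circleVol {a : ℝ → ℝ} (ha : BddWeight a) : ∀ᵐ x ∂circleVol, 0 < a x := by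
  obtain ⟨M, -, h⟩ := ha.exists_le
  exact ae_restrict_of_ae (by filter_upwards [h] with x hx using hx.1)

/-- The Euler-Lagrange equation of the maximizers of the Rayleigh quotient. -/
theorem IsCompetitor.exists_isPeriodicSol {a b w g : ℝ → ℝ} {C : ℝ} (ha : BddWeight a)
    (hb : BddWeight b) (hC0 : 0 < C) (hC : ∀ w g, IsCompetitor a w g →
      ∫ x in (0 : ℝ)..(2 * Real.pi), a x * w x ^ 2 ≤
        C * ∫ x in (0 : ℝ)..(2 * Real.pi), b x * g x ^ 2)
    (h : IsCompetitor a w g) (heq : ∫ x in (0 : ℝ)..(2 * Real.pi), a x * w x ^ 2 =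
        C * ∫ x in (0 : ℝ)..(2 * Real.pi), b x * g x ^ 2) :
    ∃ v, IsPeriodicSol a b C⁻¹ w v := by
  have hT : (2 * Real.pi) ≠ 0 := Real.two_pi_pos.ne'
  have hA := ha.integral_pos Real.two_pi_pos
  have hawi : IntervalIntegrable (fun x => a x * w x) volume 0 (2 * Real.pi) :=
    (ha.intervalIntegrable _ _).mul_continuousOn h.hasACDeriv.continuousOn
  -- The primitive of `a w` vanishes at both ends, by the constraint, so integrating by parts
  -- against it leaves no boundary terms.
  obtain ⟨A, hAdef⟩ : ∃ A : ℝ → ℝ, A = fun x => 0 + ∫ y in (0 : ℝ)..x, a y * w y := ⟨_, rfl⟩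
  have hAac : HasACDeriv A (fun x => a x * w x) 0 (2 * Real.pi) :=
    hAdef ▸ HasACDeriv.of_integral hawi 0
  have hA0 : A 0 = 0 := by simp [hAdef]
  have hAT : A (2 * Real.pi) = 0 := by
    simp only [hAdef, zero_add]
    exact h.constraint
  have hAmem : MemLp A 2 circleVol := by
    have hc := hAac.continuousOn
    rw [uIcc_two_pi] at hc
    obtain ⟨K, hK⟩ := isCompact_Icc.exists_bound_of_continuousOn hc
    refine MemLp.of_bound
      ((hc.mono Ioc_subset_Icc_self).aestronglyMeasurable measurableSet_Ioc) K ?_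
    rw [ae_restrict_iff' measurableSet_Ioc]
    exact Eventually.of_forall fun x hx => hK x (Ioc_subset_Icc_self hx)
  obtain ⟨M, hM⟩ := hb.exists_abs_le
  have hbg : MemLp (fun x => b x * g x) 2 circleVol := h.memLp.mul_of_ae_bound hb.aesm hM
  -- The integrated Euler-Lagrange equation says that `f` is constant. To prove it, the variation is
  -- taken in the direction whose derivative is `f` minus its mean `k`; the first variation becomes
  -- ∫ (f - k)² = 0.
  obtain ⟨f, hf⟩ : ∃ f : ℝ → ℝ, f = fun x => C * (b x * g x) + A x := ⟨_, rfl⟩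
  have hfm : MemLp f 2 circleVol := hf ▸ (hbg.const_mul C).add hAmem
  obtain ⟨k, hk⟩ : ∃ k : ℝ, k = (2 * Real.pi)⁻¹ * ∫ x in (0 : ℝ)..(2 * Real.pi), f x := ⟨_, rfl⟩
  have hg₁m : MemLp (fun x => f x - k) 2 circleVol := hfm.sub (memLp_const k)
  have hg₁i := hg₁m.intervalIntegrable_circleVol
  have hg₁0 : ∫ x in (0 : ℝ)..(2 * Real.pi), (f x - k) = 0 := by
    rw [intervalIntegral.integral_sub hfm.intervalIntegrable_circleVol (by simp),
      intervalIntegral.integral_const, hk, smul_eq_mul, sub_zero, ← mul_assoc,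
      mul_inv_cancel₀ hT, one_mul, sub_self]
  -- The constant of integration that makes the test direction satisfy the constraint.
  obtain ⟨c, hc⟩ : ∃ c : ℝ, c = -((∫ y in (0 : ℝ)..(2 * Real.pi), a y)⁻¹ *
    ∫ y in (0 : ℝ)..(2 * Real.pi), a y * ∫ t in (0 : ℝ)..y, (f t - k)) := ⟨_, rfl⟩
  have hw₁ac := HasACDeriv.of_integral hg₁i c
  have hw₁ac0 := HasACDeriv.of_integral hg₁i 0
  simp only [zero_add] at hw₁ac0
  have h₁ : IsCompetitor a (fun x => c + ∫ t in (0 : ℝ)..x, (f t - k)) (fun x => f x - k) := by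
    refine ⟨hg₁m, fun x _ => by simp, by simp [hg₁0], ?_⟩
    simp_rw [mul_add]
    rw [intervalIntegral.integral_add ((ha.intervalIntegrable _ _).mul_const _)
      ((ha.intervalIntegrable _ _).mul_continuousOn hw₁ac0.continuousOn),
      intervalIntegral.integral_mul_const, hc, mul_neg, ← mul_assoc, mul_inv_cancel₀ hA.ne']
    ring
  have hvar := IsCompetitor.first_variation ha hb hC h heq h₁
  have hparts := (hAac.mul hw₁ac).integral_eq
  rw [hA0, hAT, zero_mul, zero_mul, sub_zero, intervalIntegral.integral_add
    (hawi.mul_continuousOn hw₁ac.continuousOn)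
    (hg₁i.continuousOn_mul hAac.continuousOn)] at hparts
  have hassoc : ∫ x in (0 : ℝ)..(2 * Real.pi), a x * w x * (c + ∫ t in (0 : ℝ)..x, (f t - k)) =
      ∫ x in (0 : ℝ)..(2 * Real.pi), a x * (w x * (c + ∫ t in (0 : ℝ)..x, (f t - k))) := by
    simp_rw [mul_assoc]
  have hbgi : IntervalIntegrable (fun x => b x * (g x * (f x - k))) volume 0 (2 * Real.pi) :=
    hb.intervalIntegrable_mul_mul h.memLp hg₁m
  have hzero : ∫ x in (0 : ℝ)..(2 * Real.pi), (f x - k) ^ 2 = 0 := by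
    have h2 : ∀ x, (f x - k) ^ 2 =
        C * (b x * (g x * (f x - k))) + A x * (f x - k) - k * (f x - k) := fun x => by
      have : f x = C * (b x * g x) + A x := by rw [hf]
      linear_combination (f x - k) * this
    simp_rw [h2]
    rw [intervalIntegral.integral_sub, intervalIntegral.integral_add,
      intervalIntegral.integral_const_mul, intervalIntegral.integral_const_mul, hg₁0]
    · linarith
    · exact hbgi.const_mul C
    · exact hg₁i.continuousOn_mul hAac.continuousOn
    · exact (hbgi.const_mul C).add (hg₁i.continuousOn_mul hAac.continuousOn)
    · exact hg₁i.const_mul k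
  have hae : ∀ᵐ x ∂circleVol, f x = k := by
    rw [← integral_circleVol, integral_eq_zero_iff_of_nonneg (fun x => sq_nonneg _)
      hg₁m.integrable_sq] at hzero
    filter_upwards [hzero] with x hx
    have := pow_eq_zero_iff two_ne_zero |>.1 hx
    linarith
  -- The flux `b g` agrees almost everywhere with C⁻¹ (k - A), which is absolutely continuous.
  have hv : HasACDeriv (fun x => C⁻¹ * (k - A x)) (fun x => -(C⁻¹ * (a x * w x))) 0
      (2 * Real.pi) :=
    (((HasACDeriv.const k).sub hAac).const_mul C⁻¹).congr_deriv
      (Eventually.of_forall fun x _ => by ring)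
  refine ⟨fun x => C⁻¹ * (k - A x), ?_, hv, h.periodic, by rw [hA0, hAT]⟩
  refine h.hasACDeriv.congr_deriv ?_
  rw [uIcc_two_pi]
  refine ae_Icc_of_ae_circleVol ?_
  filter_upwards [hae, hb.ae_pos_circleVol] with x hx hbx
  rw [← hx, hf]
  field_simp
  ring


/-! ### From one period to the line; the best constant as a reciprocal eigenvalue. -/

theorem exists_ae_abs_le_of_memLp_top {f : ℝ → ℝ} (hf : MemLp f ⊤ volume) :
    ∃ M : ℝ, ∀ᵐ x, |f x| ≤ M := by
  refine ⟨(eLpNormEssSup f volume).toReal, ?_⟩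
  have hfin : eLpNormEssSup f volume ≠ ⊤ := by
    rw [← eLpNorm_exponent_top]; exact hf.2.ne
  filter_upwards [ae_le_eLpNormEssSup (f := f) (μ := volume)] with x hx
  rw [← Real.norm_eq_abs, ← toReal_enorm]
  exact ENNReal.toReal_mono hfin hx

theorem ae_essInf_le_of_bound {f : ℝ → ℝ} {M : ℝ} (h : ∀ᵐ x, |f x| ≤ M) :
    ∀ᵐ x, essInf f volume ≤ f x :=
  ae_essInf_le ⟨-M, by
    rw [eventually_map]; filter_upwards [h] with x hx using (abs_le.1 hx).1⟩

theorem ae_le_essSup_of_bound {f : ℝ → ℝ} {M : ℝ} (h : ∀ᵐ x, |f x| ≤ M) :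
    ∀ᵐ x, f x ≤ essSup f volume :=
  ae_le_essSup ⟨M, by
    rw [eventually_map]; filter_upwards [h] with x hx using (abs_le.1 hx).2⟩

theorem MemB.bddWeight {a : ℝ → ℝ} (ha : MemB a) : BddWeight a := by
  obtain ⟨M, hM⟩ := exists_ae_abs_le_of_memLp_top ha.memLp
  refine ⟨ha.memLp.1, essInf a volume, M, ha.essInf_pos, ?_⟩
  filter_upwards [ae_essInf_le_of_bound hM, hM] with x h1 h2
  exact ⟨h1, (abs_le.1 h2).2⟩

theorem measurable_toIcoMod : Measurable (toIcoMod Real.two_pi_pos 0) := by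
  have : toIcoMod Real.two_pi_pos 0 = fun x => Int.fract (x / (2 * Real.pi)) * (2 * Real.pi) :=
    funext fun x => toIcoMod_eq_fract_mul _ x
  rw [this]
  fun_prop

/-- Functions on one period extend to bounded measurable periodic functions. -/
theorem exists_periodic_extension {v : ℝ → ℝ} (hv : ContinuousOn v (Icc 0 (2 * Real.pi))) :
    ∃ V : ℝ → ℝ, Measurable V ∧ Function.Periodic V (2 * Real.pi) ∧ (∃ K, ∀ x, |V x| ≤ K) ∧
      ∀ x ∈ Ico 0 (2 * Real.pi), V x = v x := by
  have hext : Continuous fun x => v (projIcc 0 (2 * Real.pi) Real.two_pi_pos.le x) := by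
    have := hv.domRestrict
    exact this.comp continuous_projIcc
  obtain ⟨K, hK⟩ := isCompact_Icc.exists_bound_of_continuousOn hv
  refine ⟨fun x => v (projIcc 0 (2 * Real.pi) Real.two_pi_pos.le
    (toIcoMod Real.two_pi_pos 0 x)), hext.measurable.comp measurable_toIcoMod, fun x => ?_,
    ⟨K, fun x => hK _ (Subtype.mem _)⟩, fun x hx => ?_⟩
  · simp only [toIcoMod_add_right]
  · have h1 : toIcoMod Real.two_pi_pos 0 x = x :=
      (toIcoMod_eq_self Real.two_pi_pos).2 (by rwa [zero_add])
    simp only [h1, projIcc_of_mem _ (Ico_subset_Icc_self hx)]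

theorem IsAdmissible.exists_isCompetitor {a w g : ℝ → ℝ} (h : IsAdmissible a w g) :
    ∃ u : ℝ → ℝ, w =ᵐ[volume] u ∧ Continuous u ∧ Function.Periodic u (2 * Real.pi) ∧
      IsCompetitor a u g := by
  obtain ⟨u, hwu, huc, hup, hprim⟩ := h.isPeriodicH1.exists_primitive
  refine ⟨u, hwu, huc, hup, ?_, fun x _ => hprim x, by simpa using hup 0, ?_⟩
  · exact (h.isPeriodicH1.deriv_memL2Loc _ isCompact_Icc).mono_measure
      (Measure.restrict_mono Ioc_subset_Icc_self le_rfl)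
  · refine (integral_congr_circleVol (ae_restrict_of_ae ?_)).trans h.constraint
    filter_upwards [hwu] with x hx
    rw [hx]

theorem IsPeriodicSol.constraint {a b w v : ℝ → ℝ} {lam : ℝ} (h : IsPeriodicSol a b lam w v)
    (hlam : lam ≠ 0) : ∫ x in (0 : ℝ)..(2 * Real.pi), a x * w x = 0 := by
  have h1 := h.deriv_snd.integral_eq
  rw [h.periodic_snd, sub_self, intervalIntegral.integral_neg, neg_eq_zero,
    intervalIntegral.integral_const_mul] at h1
  exact (mul_eq_zero.1 h1).resolve_left hlam

/-- The derivative of `w v` integrates to zero over a period. -/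
theorem IsPeriodicSol.energy {a b w v : ℝ → ℝ} {lam : ℝ} (h : IsPeriodicSol a b lam w v) :
    ∫ x in (0 : ℝ)..(2 * Real.pi), v x / b x * v x =
      lam * ∫ x in (0 : ℝ)..(2 * Real.pi), a x * w x ^ 2 := by
  have h1 := (h.deriv_fst.mul h.deriv_snd).integral_eq
  rw [h.periodic_fst, h.periodic_snd, sub_self, intervalIntegral.integral_add
    (h.deriv_fst.intervalIntegrable.mul_continuousOn h.deriv_snd.continuousOn)
    (h.deriv_snd.intervalIntegrable.continuousOn_mul h.deriv_fst.continuousOn)] at h1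
  have h2 : ∫ x in (0 : ℝ)..(2 * Real.pi), w x * -(lam * (a x * w x)) =
      -(lam * ∫ x in (0 : ℝ)..(2 * Real.pi), a x * w x ^ 2) := by
    rw [← intervalIntegral.integral_const_mul, ← intervalIntegral.integral_neg]
    congr 1
    ext x
    ring
  linarith

/-- Solutions on one period extend to admissible functions on the line. -/
theorem IsPeriodicSol.exists_isAdmissible {a b w v : ℝ → ℝ} {lam : ℝ} (hb : BddWeight b)
    (hbp : AEPeriodic b) (hlam : lam ≠ 0) (h : IsPeriodicSol a b lam w v) :
    ∃ u g : ℝ → ℝ, IsAdmissible a u g ∧ Continuous u ∧ Function.Periodic u (2 * Real.pi) ∧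
      (∀ x ∈ Icc 0 (2 * Real.pi), u x = w x) ∧
      ∫ x in (0 : ℝ)..(2 * Real.pi), a x * u x ^ 2 =
        lam⁻¹ * ∫ x in (0 : ℝ)..(2 * Real.pi), b x * g x ^ 2 := by
  have hvc := h.deriv_snd.continuousOn
  rw [uIcc_two_pi] at hvc
  -- It is the flux that is extended: a bounded measurable periodic extension suffices, because `u`
  -- is then recovered as a primitive of `V / b`.
  obtain ⟨V, hVm, hVp, ⟨K, hK⟩, hVv⟩ := exists_periodic_extension hvc
  have hVae : ∀ᵐ x ∂circleVol, V x = v x := by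
    rw [ae_restrict_iff' measurableSet_Ioc]
    have h₁ : ∀ᵐ x : ℝ, x ≠ 2 * Real.pi := by simp [ae_iff, measure_singleton]
    filter_upwards [h₁] with x hx hm
    exact hVv x ⟨hm.1.le, lt_of_le_of_ne hm.2 hx⟩
  have hgb : MemL2Loc fun x => V x / b x := by
    obtain ⟨m, M, hm, hbd⟩ := hb.bounds
    refine memL2Loc_of_ae_bound (C := K / m)
      (hVm.aemeasurable.div hb.aesm.aemeasurable).aestronglyMeasurable ?_
    filter_upwards [hbd] with x hx
    rw [abs_div, abs_of_pos (hm.trans_le hx.1)]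
    exact div_le_div₀ ((abs_nonneg _).trans (hK x)) (hK x) hm hx.1
  have hgl := hgb.locallyIntegrable
  have hgp : AEPeriodic fun x => V x / b x := by
    filter_upwards [hbp] with x hx
    rw [hx, hVp x]
  have hgae : ∀ᵐ x ∂circleVol, V x / b x = v x / b x := by
    filter_upwards [hVae] with x hx
    rw [hx]
  have hux : ∀ x ∈ Icc 0 (2 * Real.pi), w 0 + ∫ y in (0 : ℝ)..x, V y / b y = w x := by
    intro x hx
    rw [integral_congr_left hgae hx, h.deriv_fst.integral_eq_left (uIcc_two_pi ▸ hx)]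
    ring
  have hint0 : ∫ y in (0 : ℝ)..(2 * Real.pi), V y / b y = 0 := by
    have := hux _ two_pi_mem_Icc
    rw [h.periodic_fst] at this
    linarith
  have hper : Function.Periodic (fun x => w 0 + ∫ y in (0 : ℝ)..x, V y / b y)
      (2 * Real.pi) := fun x => by
    simp only [hgp.integral_add_two_pi hgl, hint0, add_zero]
  obtain ⟨u, hu⟩ : ∃ u : ℝ → ℝ, u = fun x => w 0 + ∫ y in (0 : ℝ)..x, V y / b y := ⟨_, rfl⟩
  have hprim : ∀ x, u x = u 0 + ∫ y in (0 : ℝ)..x, V y / b y := fun x => by simp [hu]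
  have huc : Continuous u := hu ▸ continuous_const.add (hgl.continuous_primitive' 0)
  rw [← hu] at hper
  have hux' : ∀ x ∈ Icc 0 (2 * Real.pi), u x = w x := fun x hx => by rw [hu]; exact hux x hx
  refine ⟨u, fun x => V x / b x,
    ⟨isPeriodicH1_of_primitive hgb hprim hper (ae_eq_refl _), ?_⟩, huc, hper, hux', ?_⟩
  · exact (integral_congr_Icc fun x hx => by rw [hux' x hx]).trans (h.constraint hlam)
  · rw [integral_congr_Icc (g := fun x => a x * w x ^ 2) fun x hx => by rw [hux' x hx], eq_inv_mul_iff_mul_eq₀ hlam, ← h.energy]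
    refine integral_congr_circleVol ?_
    filter_upwards [hVae, hb.ae_pos_circleVol] with x hx hbx
    rw [hx]
    field_simp

theorem BddWeight.integral_mul_sq_pos {a w : ℝ → ℝ} (ha : BddWeight a)
    (hw : ContinuousOn w (Icc 0 (2 * Real.pi))) (hne : ∃ x ∈ Icc 0 (2 * Real.pi), w x ≠ 0) :
    0 < ∫ x in (0 : ℝ)..(2 * Real.pi), a x * w x ^ 2 := by
  obtain ⟨m, M, hm, hb⟩ := ha.bounds
  have hc : ContinuousOn (fun x => w x ^ 2) (uIcc 0 (2 * Real.pi)) := by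
    rw [uIcc_two_pi]; exact hw.pow 2
  have h1 : ∫ x in (0 : ℝ)..(2 * Real.pi), m * w x ^ 2 ≤
      ∫ x in (0 : ℝ)..(2 * Real.pi), a x * w x ^ 2 := by
    refine intervalIntegral.integral_mono_ae Real.two_pi_pos.le
      (hc.intervalIntegrable.const_mul m)
      ((ha.intervalIntegrable _ _).mul_continuousOn hc) ?_
    filter_upwards [hb] with x hx
    exact mul_le_mul_of_nonneg_right hx.1 (sq_nonneg _)
  refine lt_of_lt_of_le ?_ h1
  obtain ⟨x, hx, hwx⟩ := hne
  exact intervalIntegral.integral_pos Real.two_pi_pos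
    (continuousOn_const.mul (hw.pow 2)) (fun y _ => by positivity) ⟨x, hx, by positivity⟩

/-- The basic properties of the best constant. -/
structure BestConstSpec (a b : ℝ → ℝ) (C : ℝ) : Prop where
  isLeast : IsLeast (wirtingerConstants a b) C
  pos : 0 < C
  le : ∀ w g, IsCompetitor a w g → ∫ x in (0 : ℝ)..(2 * Real.pi), a x * w x ^ 2 ≤
    C * ∫ x in (0 : ℝ)..(2 * Real.pi), b x * g x ^ 2
  exists_sol : ∃ w v, IsPeriodicSol a b C⁻¹ w v ∧ ∃ x ∈ Icc 0 (2 * Real.pi), w x ≠ 0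
  inv_le : ∀ lam : ℝ, 0 < lam → ∀ w v, IsPeriodicSol a b lam w v →
    (∃ x ∈ Icc 0 (2 * Real.pi), w x ≠ 0) → lam⁻¹ ≤ C

theorem bestConstSpec {a b : ℝ → ℝ} (ha : MemB a) (hb : MemB b) :
    BestConstSpec a b (bestConst a b) := by
  have ha' := ha.bddWeight
  have hb' := hb.bddWeight
  obtain ⟨C, hC0, hC, w, g, hw, hpos, heq⟩ := exists_maximizer ha' hb'
  obtain ⟨v, hv⟩ := hw.exists_isPeriodicSol ha' hb' hC0 hC heq
  have hne : ∃ x ∈ Icc 0 (2 * Real.pi), w x ≠ 0 := by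
    by_contra! hcon
    rw [integral_congr_Icc (g := fun _ => 0) fun x hx => by rw [hcon x hx]; ring] at hpos
    simp at hpos
  have hmem : C ∈ wirtingerConstants a b := by
    refine ⟨hC0, fun w g h => ?_⟩
    obtain ⟨u, hwu, -, -, hu⟩ := h.exists_isCompetitor
    refine le_trans (le_of_eq ?_) (hC u g hu)
    refine integral_congr_circleVol (ae_restrict_of_ae ?_)
    filter_upwards [hwu] with x hx
    rw [hx]
  -- An eigenfunction has quotient exactly `lam⁻¹`, which every valid constant must dominate.
  -- Applied to the maximizer, this shows that `C` is least.
  have hinv : ∀ C' ∈ wirtingerConstants a b, ∀ lam : ℝ, 0 < lam → ∀ w v,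
      IsPeriodicSol a b lam w v → (∃ x ∈ Icc 0 (2 * Real.pi), w x ≠ 0) → lam⁻¹ ≤ C' := by
    intro C' hC' lam hlam w v hs hne
    obtain ⟨u, k, hadm, huc, -, huw, hen⟩ := hs.exists_isAdmissible hb' hb.periodic hlam.ne'
    obtain ⟨x, hx, hwx⟩ := hne
    have h1 := ha'.integral_mul_sq_pos huc.continuousOn ⟨x, hx, by rwa [huw x hx]⟩
    have h2 := hC'.2 u k hadm
    rw [hen] at h1 h2
    have h3 : 0 < ∫ x in (0 : ℝ)..(2 * Real.pi), b x * k x ^ 2 :=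
      (pos_iff_pos_of_mul_pos h1).1 (inv_pos.2 hlam)
    exact le_of_mul_le_mul_right h2 h3
  have hleast : IsLeast (wirtingerConstants a b) C :=
    ⟨hmem, fun C' hC' => by simpa using hinv C' hC' C⁻¹ (inv_pos.2 hC0) w v hv hne⟩
  have : bestConst a b = C := hleast.csInf_eq
  rw [this]
  exact ⟨hleast, hC0, hC, ⟨w, v, hv, hne⟩, fun lam => hinv C hmem lam⟩


/-! ### The eigenvalue bound for the weights, and the change of variables. -/

theorem BddWeight.sqrt_div {a b : ℝ → ℝ} (ha : BddWeight a) (hb : BddWeight b) :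
    BddWeight fun x => Real.sqrt (a x / b x) := by
  refine ⟨(ha.aesm.aemeasurable.div hb.aesm.aemeasurable).sqrt.aestronglyMeasurable, ?_⟩
  obtain ⟨m, M, hm, h⟩ := ha.bounds
  obtain ⟨n, hn, h'⟩ := hb.exists_le
  obtain ⟨k, N, hk, h''⟩ := hb.bounds
  refine ⟨Real.sqrt (m / n), Real.sqrt (M / k), by positivity, ?_⟩
  filter_upwards [h, h', h''] with x h1 h2 h3
  have ha0 : 0 < a x := hm.trans_le h1.1
  constructor
  · exact Real.sqrt_le_sqrt (div_le_div₀ ha0.le h1.1 h2.1 h2.2)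
  · exact Real.sqrt_le_sqrt (div_le_div₀ (ha0.le.trans h1.2) h1.2 hk h3.1)

theorem BddWeight.ae_pos {a : ℝ → ℝ} (ha : BddWeight a) : ∀ᵐ x, 0 < a x := by
  obtain ⟨M, -, h⟩ := ha.exists_le
  filter_upwards [h] with x hx using hx.1

/-- Lower bound for the positive eigenvalues of the periodic problem, and the case of equality. -/
theorem IsPeriodicSol.eight_mul_arctan_le {a b w v : ℝ → ℝ} {lam κ ρ : ℝ} (ha : BddWeight a)
    (hb : BddWeight b) (hκ : 0 < κ) (hρ : 0 < ρ) (hρ1 : ρ ≤ 1)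
    (hab : ∀ᵐ x, κ * ρ ≤ Real.sqrt (a x * b x) ∧ Real.sqrt (a x * b x) ≤ κ * ρ⁻¹)
    (hlam : 0 < lam) (h : IsPeriodicSol a b lam w v)
    (hne : ∃ x ∈ Icc 0 (2 * Real.pi), w x ≠ 0) :
    8 * Real.arctan ρ ≤
      Real.sqrt lam * ∫ x in (0 : ℝ)..(2 * Real.pi), Real.sqrt (a x / b x) ∧
    (Real.sqrt lam * ∫ x in (0 : ℝ)..(2 * Real.pi), Real.sqrt (a x / b x) = 8 * Real.arctan ρ →
      ∃ ψ : ℝ → ℝ, (∀ x ∈ Icc 0 (2 * Real.pi), turnTime ρ (ψ x) = turnTime ρ (ψ 0) +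
        Real.sqrt lam * ∫ y in (0 : ℝ)..x, Real.sqrt (a y / b y)) ∧
      ∀ᵐ x, x ∈ Icc 0 (2 * Real.pi) →
        (0 < Real.cos (2 * ψ x) ∧ Real.sqrt (a x * b x) = κ * ρ) ∨
        (Real.cos (2 * ψ x) < 0 ∧ Real.sqrt (a x * b x) = κ * ρ⁻¹)) := by
  have hs := ha.sqrt_div hb
  obtain ⟨δ, M', hδ, hsδ⟩ := hs.bounds
  have hω : 0 < Real.sqrt lam := Real.sqrt_pos.2 hlam
  -- With s = √(a/b) and β = √(ab)/κ one has s/β = κ/b and sβ = a/κ, so the system for W = √lam κ w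
  -- and v takes the form required by the turning estimate.
  have hp : ∀ᵐ x, Real.sqrt (a x / b x) / (Real.sqrt (a x * b x) / κ) = κ / b x := by
    filter_upwards [ha.ae_pos, hb.ae_pos] with x h1 h2
    rw [Real.sqrt_div h1.le, Real.sqrt_mul h1.le]
    have h3 := Real.sqrt_pos.2 h1
    have h4 := Real.sqrt_pos.2 h2
    have h5 := Real.sq_sqrt h2.le
    field_simp
    rw [h5]
  have hr : ∀ᵐ x, Real.sqrt (a x / b x) * (Real.sqrt (a x * b x) / κ) = a x / κ := by
    filter_upwards [ha.ae_pos, hb.ae_pos] with x h1 h2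
    rw [Real.sqrt_div h1.le, Real.sqrt_mul h1.le]
    have h3 := Real.sqrt_pos.2 h1
    have h4 := Real.sqrt_pos.2 h2
    have h5 := Real.sq_sqrt h1.le
    field_simp
    rw [h5]
  have hbi : LocallyIntegrable (fun x => (b x)⁻¹) volume := by
    obtain ⟨m, M, hm, hbd⟩ := hb.bounds
    refine (memL2Loc_of_ae_bound (f := fun x => (b x)⁻¹) (C := m⁻¹) hb.aesm.aemeasurable.inv.aestronglyMeasurable
      ?_).locallyIntegrable
    filter_upwards [hbd] with x hx
    rw [abs_of_pos (inv_pos.2 (hm.trans_le hx.1))]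
    exact inv_anti₀ hm hx.1
  have hpi : IntervalIntegrable (fun x => Real.sqrt lam *
      (Real.sqrt (a x / b x) / (Real.sqrt (a x * b x) / κ))) volume 0 (2 * Real.pi) := by
    refine IntervalIntegrable.const_mul ?_ _
    refine ((hbi.intervalIntegrable 0 (2 * Real.pi)).const_mul κ).congr_ae (ae_restrict_of_ae ?_)
    filter_upwards [hp] with x hx
    rw [hx, div_eq_mul_inv]
  have hri : IntervalIntegrable (fun x => Real.sqrt lam *
      (Real.sqrt (a x / b x) * (Real.sqrt (a x * b x) / κ))) volume 0 (2 * Real.pi) := by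
    refine IntervalIntegrable.const_mul ?_ _
    refine ((ha.intervalIntegrable 0 (2 * Real.pi)).const_mul κ⁻¹).congr_ae (ae_restrict_of_ae ?_)
    filter_upwards [hr] with x hx
    rw [hx, div_eq_inv_mul]
  have hβ : ∀ᵐ x, x ∈ Icc 0 (2 * Real.pi) → Real.sqrt (a x * b x) / κ ∈ Icc ρ ρ⁻¹ := by
    filter_upwards [hab] with x hx _
    exact ⟨(le_div_iff₀ hκ).2 (by linarith [hx.1]), (div_le_iff₀ hκ).2 (by linarith [hx.2])⟩
  have hlam' := Real.mul_self_sqrt hlam.le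
  have key := Wirtinger.eight_mul_arctan_le (T := 2 * Real.pi) (ω := Real.sqrt lam)
    (W := fun x => Real.sqrt lam * κ * w x) (v := v)
    Real.two_pi_pos hρ hρ1 hω hδ (hs.intervalIntegrable _ _) hpi hri
    (by filter_upwards [hsδ] with x hx _ using hx.1) hβ
    ((h.deriv_fst.const_mul _).congr_deriv (by
      filter_upwards [hp] with x hx _
      rw [hx]; ring))
    (h.deriv_snd.congr_deriv (by
      filter_upwards [hr] with x hx _
      rw [hx]
      have h1 : lam * (a x * w x) = Real.sqrt lam * Real.sqrt lam * (a x * w x) := by rw [hlam']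
      rw [h1]
      field_simp))
    (by rw [h.periodic_fst]) h.periodic_snd (by
      obtain ⟨x, hx, hwx⟩ := hne
      exact ⟨x, hx, by positivity⟩)
  refine ⟨key.1, fun heq => ?_⟩
  obtain ⟨ψ, h1, h2⟩ := key.2 heq
  refine ⟨ψ, h1, ?_⟩
  filter_upwards [h2] with x hx hm
  rcases hx hm with ⟨h3, h4⟩ | ⟨h3, h4⟩
  · exact Or.inl ⟨h3, by rw [← h4]; field_simp⟩
  · exact Or.inr ⟨h3, by rw [← h4]; field_simp⟩

theorem meanSqrt_pos {a b : ℝ → ℝ} (ha : BddWeight a) (hb : BddWeight b) : 0 < meanSqrt a b := by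
  have := (ha.sqrt_div hb).integral_pos Real.two_pi_pos
  have hpi := Real.pi_pos
  unfold meanSqrt
  positivity

theorem integral_sqrt_div_eq (a b : ℝ → ℝ) :
    ∫ x in (0 : ℝ)..(2 * Real.pi), Real.sqrt (a x / b x) = 2 * Real.pi * meanSqrt a b := by
  have hpi := Real.pi_pos
  unfold meanSqrt
  field_simp

/-- The maximizer is a periodic solution with eigenvalue 1/C, so the turning estimate reads 8 arctan
ρ · √C ≤ 2π · `meanSqrt a b`. -/
theorem bestConst_le {a b : ℝ → ℝ} {κ ρ : ℝ} (ha : MemB a) (hb : MemB b) (hκ : 0 < κ)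
    (hρ : 0 < ρ) (hρ1 : ρ ≤ 1)
    (hab : ∀ᵐ x, κ * ρ ≤ Real.sqrt (a x * b x) ∧ Real.sqrt (a x * b x) ≤ κ * ρ⁻¹) :
    bestConst a b ≤ (meanSqrt a b / (4 / Real.pi * Real.arctan ρ)) ^ 2 := by
  have hspec := bestConstSpec ha hb
  obtain ⟨w, v, hsol, hne⟩ := hspec.exists_sol
  have h1 := (hsol.eight_mul_arctan_le ha.bddWeight hb.bddWeight hκ hρ hρ1 hab
    (inv_pos.2 hspec.pos) hne).1
  have hA : 0 < Real.arctan ρ := Real.arctan_pos.2 hρ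
  have hc := meanSqrt_pos ha.bddWeight hb.bddWeight
  have hpi := Real.pi_pos
  have hC := Real.sqrt_pos.2 hspec.pos
  rw [integral_sqrt_div_eq, Real.sqrt_inv, ← div_eq_inv_mul, le_div_iff₀ hC] at h1
  rw [← Real.sqrt_le_left (by positivity), le_div_iff₀ (by positivity)]
  have h2 : 8 * Real.arctan ρ * Real.sqrt (bestConst a b) =
      2 * Real.pi * (Real.sqrt (bestConst a b) * (4 / Real.pi * Real.arctan ρ)) := by
    field_simp
    ring
  rw [h2] at h1
  exact le_of_mul_le_mul_left h1 (by positivity)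

/-- Change of variables on the line. -/
theorem exists_homeomorph_tau {a b : ℝ → ℝ} (ha : BddWeight a) (hb : BddWeight b) :
    ∃ θ : ℝ ≃ₜ ℝ, (∀ x, θ.symm x = tau a b x) ∧ StrictMono (tau a b) ∧
      (∃ K, LipschitzWith K θ) ∧ ∃ K, LipschitzWith K (tau a b) := by
  have hs := ha.sqrt_div hb
  have hc := meanSqrt_pos ha hb
  obtain ⟨m, M, hm, hbd⟩ := hs.bounds
  have hsub : ∀ x y, tau a b y - tau a b x =
      1 / meanSqrt a b * ∫ t in x..y, Real.sqrt (a t / b t) := fun x y => by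
    unfold tau
    rw [← mul_sub, intervalIntegral.integral_interval_sub_left (hs.intervalIntegrable _ _)
      (hs.intervalIntegrable _ _)]
  -- The density √(a/b) lies between positive constants, so τ is bi-Lipschitz. Beyond the
  -- homeomorphism, this allows null sets to be carried in both directions.
  have hlow : ∀ x y, x ≤ y → m / meanSqrt a b * (y - x) ≤ tau a b y - tau a b x := by
    intro x y hxy
    have h1 : ∫ _ in x..y, m ≤ ∫ t in x..y, Real.sqrt (a t / b t) := by
      refine intervalIntegral.integral_mono_ae hxy (by simp) (hs.intervalIntegrable x y) ?_
      filter_upwards [hbd] with t ht using ht.1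
    rw [intervalIntegral.integral_const, smul_eq_mul] at h1
    rw [hsub]
    calc m / meanSqrt a b * (y - x) = 1 / meanSqrt a b * ((y - x) * m) := by ring
      _ ≤ _ := by gcongr
  have hupp : ∀ x y, x ≤ y → tau a b y - tau a b x ≤ M / meanSqrt a b * (y - x) := by
    intro x y hxy
    have h1 : ∫ t in x..y, Real.sqrt (a t / b t) ≤ ∫ _ in x..y, M := by
      refine intervalIntegral.integral_mono_ae hxy (hs.intervalIntegrable x y) (by simp) ?_
      filter_upwards [hbd] with t ht using ht.2
    rw [intervalIntegral.integral_const, smul_eq_mul] at h1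
    rw [hsub]
    calc _ ≤ 1 / meanSqrt a b * ((y - x) * M) := by gcongr
      _ = _ := by ring
  have hm' : 0 < m / meanSqrt a b := by positivity
  have hmono : StrictMono (tau a b) := fun x y hxy => by
    have := hlow x y hxy.le
    have h2 := mul_pos hm' (sub_pos.2 hxy)
    linarith
  have hlip : LipschitzWith (Real.toNNReal (M / meanSqrt a b)) (tau a b) := by
    refine LipschitzWith.of_dist_le_mul fun x y => ?_
    wlog hxy : x ≤ y generalizing x y
    · rw [dist_comm, dist_comm x]
      exact this y x (not_le.1 hxy).le
    · rw [dist_comm, dist_comm x, Real.dist_eq, Real.dist_eq,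
        abs_of_nonneg (sub_nonneg.2 (hmono.monotone hxy)), abs_of_nonneg (sub_nonneg.2 hxy)]
      refine (hupp x y hxy).trans ?_
      gcongr
      exact Real.le_coe_toNNReal _
  have h0 : tau a b 0 = 0 := by simp [tau]
  have hsurj : Function.Surjective (tau a b) := by
    refine hlip.continuous.surjective ?_ ?_
    · refine tendsto_atTop_mono' atTop ?_ (tendsto_id.const_mul_atTop hm')
      filter_upwards [eventually_ge_atTop 0] with x hx
      have := hlow 0 x hx
      simpa [h0] using this
    · refine tendsto_atBot_mono' atBot ?_ (tendsto_id.const_mul_atBot hm')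
      filter_upwards [eventually_le_atBot 0] with x hx
      have := hlow x 0 hx
      rw [h0] at this
      simp only [id]
      linarith
  obtain ⟨e, he⟩ : ∃ e : ℝ ≃o ℝ, ∀ x, e x = tau a b x :=
    ⟨StrictMono.orderIsoOfSurjective _ hmono hsurj, fun x => rfl⟩
  have hθ : ∀ t, tau a b (e.symm t) = t := fun t => by rw [← he, e.apply_symm_apply]
  refine ⟨e.symm.toHomeomorph, fun x => he x, hmono,
    ⟨Real.toNNReal (m / meanSqrt a b)⁻¹, ?_⟩, _, hlip⟩
  refine LipschitzWith.of_dist_le_mul fun x y => ?_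
  change dist (e.symm x) (e.symm y) ≤ _
  wlog hxy : x ≤ y generalizing x y
  · rw [dist_comm, dist_comm x]
    exact this y x (not_le.1 hxy).le
  · have hxy' := e.symm.monotone hxy
    rw [dist_comm, dist_comm x, Real.dist_eq, Real.dist_eq,
      abs_of_nonneg (sub_nonneg.2 hxy'), abs_of_nonneg (sub_nonneg.2 hxy),
      Real.coe_toNNReal _ (by positivity), le_inv_mul_iff₀ hm']
    have := hlow _ _ hxy'
    rwa [hθ, hθ] at this

theorem _root_.LipschitzWith.volume_image_eq_zero {f : ℝ → ℝ} {K : NNReal}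
    (hf : LipschitzWith K f) {s : Set ℝ} (hs : volume s = 0) : volume (f '' s) = 0 := by
  have h := hf.hausdorffMeasure_image_le (d := 1) zero_le_one s
  rw [hausdorffMeasure_real, hs, mul_zero] at h
  exact le_antisymm h bot_le

theorem tau_two_pi {a b : ℝ → ℝ} (ha : BddWeight a) (hb : BddWeight b) :
    tau a b (2 * Real.pi) = 2 * Real.pi := by
  have hc := meanSqrt_pos ha hb
  unfold tau
  rw [integral_sqrt_div_eq]
  field_simp

theorem tau_zero (a b : ℝ → ℝ) : tau a b 0 = 0 := by simp [tau]

/-! ### The step function and its relation to the turning time. -/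

section Step

/-- The sign of sin 2t tells the quarter period containing t; only the countably many jump points,
where sin 2t = 0, are left out. -/
theorem stepFun_of_sin_pos {L t : ℝ} (h : 0 < Real.sin (2 * t)) : stepFun L t = 1 := by
  unfold stepFun
  have h1 := toIcoMod_mem_Ico Real.two_pi_pos 0 t
  have h2 : Real.sin (2 * toIcoMod Real.two_pi_pos 0 t) = Real.sin (2 * t) := by
    have : toIcoMod Real.two_pi_pos 0 t = t - toIcoDiv Real.two_pi_pos 0 t * (2 * Real.pi) := by
      rw [toIcoMod, zsmul_eq_mul]
    rw [this, show 2 * (t - toIcoDiv Real.two_pi_pos 0 t * (2 * Real.pi)) =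
      2 * t - ((2 * toIcoDiv Real.two_pi_pos 0 t : ℤ) : ℝ) * (2 * Real.pi) by push_cast; ring,
      Real.sin_sub_int_mul_two_pi]
  rw [zero_add] at h1
  rw [← h2] at h
  generalize toIcoMod Real.two_pi_pos 0 t = u at h1 h
  simp only
  rw [if_pos]
  by_contra hcon
  push Not at hcon
  rcases lt_or_ge u Real.pi with hu | hu
  · have : Real.sin (2 * u - 2 * Real.pi) ≤ 0 :=
      Real.sin_nonpos_of_nonpos_of_neg_pi_le (by linarith) (by linarith [hcon.1])
    rw [Real.sin_sub_two_pi] at this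
    linarith
  · have : Real.sin (2 * u - 2 * Real.pi - 2 * Real.pi) ≤ 0 :=
      Real.sin_nonpos_of_nonpos_of_neg_pi_le (by linarith [h1.2]) (by linarith [hcon.2 hu])
    rw [Real.sin_sub_two_pi, Real.sin_sub_two_pi] at this
    linarith

theorem stepFun_of_sin_neg {L t : ℝ} (h : Real.sin (2 * t) < 0) : stepFun L t = L := by
  unfold stepFun
  have h1 := toIcoMod_mem_Ico Real.two_pi_pos 0 t
  have h2 : Real.sin (2 * toIcoMod Real.two_pi_pos 0 t) = Real.sin (2 * t) := by
    have : toIcoMod Real.two_pi_pos 0 t = t - toIcoDiv Real.two_pi_pos 0 t * (2 * Real.pi) := by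
      rw [toIcoMod, zsmul_eq_mul]
    rw [this, show 2 * (t - toIcoDiv Real.two_pi_pos 0 t * (2 * Real.pi)) =
      2 * t - ((2 * toIcoDiv Real.two_pi_pos 0 t : ℤ) : ℝ) * (2 * Real.pi) by push_cast; ring,
      Real.sin_sub_int_mul_two_pi]
  rw [zero_add] at h1
  rw [← h2] at h
  generalize toIcoMod Real.two_pi_pos 0 t = u at h1 h
  simp only
  rw [if_neg]
  rintro (hu | ⟨hu, hu'⟩)
  · have := Real.sin_nonneg_of_nonneg_of_le_pi (x := 2 * u) (by linarith [h1.1]) (by linarith)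
    linarith
  · have := Real.sin_nonneg_of_nonneg_of_le_pi (x := 2 * u - 2 * Real.pi) (by linarith)
      (by linarith)
    rw [Real.sin_sub_two_pi] at this
    linarith

theorem countable_sin_two_mul_eq_zero : {x : ℝ | Real.sin (2 * x) = 0}.Countable := by
  refine (countable_range fun k : ℤ => (k : ℝ) * Real.pi / 2).mono ?_
  intro x hx
  obtain ⟨k, hk⟩ := Real.sin_eq_zero_iff.1 hx
  exact ⟨k, by simp only; rw [hk]; ring⟩

/-- Turning at maximal speed, the quadrants are passed in equal times. -/
theorem cos_mul_cos_turnTime_pos {ρ : ℝ} (hρ : 0 < ρ) (hρ1 : ρ ≤ 1) {s : ℝ}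
    (hs : Real.cos (2 * s) ≠ 0) :
    0 < Real.cos (2 * s) *
      Real.cos (2 * (Real.pi / (4 * Real.arctan ρ) * turnTime ρ s)) := by
  have hpi := Real.pi_pos
  have hA : 0 < Real.arctan ρ := Real.arctan_pos.2 hρ
  -- The rescaled turning time is increasing, commutes with the shift by π/2 and fixes ±π/4. Hence
  -- it maps each interval between consecutive zeros of cos 2s onto itself.
  obtain ⟨G, hG⟩ : ∃ G : ℝ → ℝ, ∀ s, G s = Real.pi / (4 * Real.arctan ρ) * turnTime ρ s :=
    ⟨_, fun _ => rfl⟩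
  have hGmono : StrictMono G := fun x y hxy => by
    rw [hG, hG]
    exact mul_lt_mul_of_pos_left (strictMono_turnTime hρ hxy) (by positivity)
  have hper : Function.Periodic (fun s => G s - s) (Real.pi / 2) := fun s => by
    simp only [hG, turnTime_add_pi_div_two hρ hρ1]
    field_simp
    ring
  have hG1 : G (Real.pi / 4) = Real.pi / 4 := by
    rw [hG, turnTime_pi_div_four hρ hρ1]; field_simp
  have hG2 : G (-(Real.pi / 4)) = -(Real.pi / 4) := by
    rw [hG, turnTime_neg_pi_div_four hρ hρ1]; field_simp
  rw [← hG]
  -- Reduction to the central quarter: a shift by n quarter turns multiplies both cosines by (-1)ⁿ.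
  obtain ⟨n, hn⟩ : ∃ n : ℤ, s - n * (Real.pi / 2) ∈ Ico (-(Real.pi / 4)) (Real.pi / 4) := by
    refine ⟨⌊(s + Real.pi / 4) / (Real.pi / 2)⌋, ?_, ?_⟩
    · have := Int.floor_le ((s + Real.pi / 4) / (Real.pi / 2))
      rw [le_div_iff₀ (by positivity)] at this
      linarith
    · have := Int.lt_floor_add_one ((s + Real.pi / 4) / (Real.pi / 2))
      rw [div_lt_iff₀ (by positivity)] at this
      linarith
  obtain ⟨u, hu⟩ : ∃ u, u = s - n * (Real.pi / 2) := ⟨_, rfl⟩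
  rw [← hu] at hn
  have hsu : s = u + n * (Real.pi / 2) := by rw [hu]; ring
  have hGs : G s = G u + n * (Real.pi / 2) := by
    have := hper.int_mul n u
    simp only [← hsu] at this
    rw [hsu] at this ⊢
    linarith
  have h1 : Real.cos (2 * s) = (-1) ^ n * Real.cos (2 * u) := by
    rw [hsu, ← Real.cos_add_int_mul_pi]; congr 1; ring
  have h2 : Real.cos (2 * G s) = (-1) ^ n * Real.cos (2 * G u) := by
    rw [hGs, ← Real.cos_add_int_mul_pi]; congr 1; ring
  have hu1 : -(Real.pi / 4) < u := by
    refine lt_of_le_of_ne hn.1 fun h => hs ?_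
    rw [h1, ← h, show 2 * -(Real.pi / 4) = -(Real.pi / 2) by ring, Real.cos_neg,
      Real.cos_pi_div_two, mul_zero]
  have h3 : 0 < Real.cos (2 * u) :=
    Real.cos_pos_of_mem_Ioo ⟨by linarith, by linarith [hn.2]⟩
  have h4 := hGmono hu1
  have h5 := hGmono hn.2
  rw [hG2] at h4
  rw [hG1] at h5
  have h6 : 0 < Real.cos (2 * G u) :=
    Real.cos_pos_of_mem_Ioo ⟨by linarith, by linarith⟩
  rw [h1, h2]
  have h7 : ((-1 : ℝ) ^ n) * (-1) ^ n = 1 := by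
    rw [← mul_zpow]; norm_num
  calc 0 < Real.cos (2 * u) * Real.cos (2 * G u) := mul_pos h3 h6
    _ = _ := by linear_combination (-(Real.cos (2 * u) * Real.cos (2 * G u))) * h7

end Step


/-! ### The explicit eigenfunction of the step weight. -/

section Wave

/-- A quarter wave: `sin (μ y)` up to `π / 4`, then `ρ cos (μ (π / 2 - y))`, extended as an odd
function. -/
noncomputable def quarterWave (ρ μ y : ℝ) : ℝ :=
  Real.sin (μ * max (-(Real.pi / 4)) (min y (Real.pi / 4))) +
    ρ * (Real.cos (μ * (Real.pi / 2 - max y (Real.pi / 4))) - Real.cos (μ * (Real.pi / 4))) -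
    ρ * (Real.cos (μ * (Real.pi / 2 + min y (-(Real.pi / 4)))) - Real.cos (μ * (Real.pi / 4)))

/-- The extremal function for the step weight. -/
noncomputable def wave (ρ μ t : ℝ) : ℝ := quarterWave ρ μ (Real.arcsin (Real.sin t))

variable {ρ μ : ℝ}

theorem continuous_wave : Continuous (wave ρ μ) := by
  unfold wave quarterWave
  have : Continuous fun t => Real.arcsin (Real.sin t) :=
    Real.continuous_arcsin.comp Real.continuous_sin
  fun_prop

theorem quarterWave_neg (y : ℝ) : quarterWave ρ μ (-y) = -quarterWave ρ μ y := by
  unfold quarterWave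
  have hpi := Real.pi_pos
  have h1 : max (-(Real.pi / 4)) (min (-y) (Real.pi / 4)) =
      -max (-(Real.pi / 4)) (min y (Real.pi / 4)) := by
    rcases le_total y (Real.pi / 4) with h | h <;> rcases le_total (-(Real.pi / 4)) y with h' | h'
    · rw [min_eq_left h, max_eq_right h', min_eq_left (by linarith), max_eq_right (by linarith)]
    · rw [min_eq_left h, max_eq_left h', min_eq_right (by linarith), max_eq_right (by linarith),
        neg_neg]
    · rw [min_eq_left (show -y ≤ Real.pi / 4 by linarith),
        max_eq_left (show -y ≤ -(Real.pi / 4) by linarith), min_eq_right h,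
        max_eq_right (by linarith)]
    · linarith
  have h2 : max (-y) (Real.pi / 4) = -min y (-(Real.pi / 4)) := by
    rw [← max_neg_neg, neg_neg]
  have h3 : min (-y) (-(Real.pi / 4)) = -max y (Real.pi / 4) := by
    rw [← min_neg_neg]
  rw [h1, h2, h3, mul_neg, Real.sin_neg]
  ring_nf

theorem antiperiodic_wave : Function.Antiperiodic (wave ρ μ) Real.pi := fun t => by
  rw [wave, Real.sin_add_pi, Real.arcsin_neg, quarterWave_neg, wave]

theorem wave_add_int_mul_pi (t : ℝ) (n : ℤ) :
    wave ρ μ (t + n * Real.pi) = (-1) ^ n * wave ρ μ t := by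
  have := antiperiodic_wave.add_zsmul_eq (f := wave ρ μ) (x := t) n
  rw [zsmul_eq_mul] at this
  rw [this]
  rcases Int.even_or_odd n with h | h
  · rw [h.neg_one_zpow, Int.negOnePow_even _ h]; simp
  · rw [h.neg_one_zpow, Int.negOnePow_odd _ h]; simp

theorem periodic_wave : Function.Periodic (wave ρ μ) (2 * Real.pi) := fun t => by
  have := wave_add_int_mul_pi (ρ := ρ) (μ := μ) t 2
  norm_num at this
  exact this

theorem wave_of_mem_Icc_left {t : ℝ} (ht : t ∈ Icc (-(Real.pi / 4)) (Real.pi / 4)) :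
    wave ρ μ t = Real.sin (μ * t) := by
  have hpi := Real.pi_pos
  rw [wave, Real.arcsin_sin (by linarith [ht.1]) (by linarith [ht.2]), quarterWave,
    min_eq_left ht.2, max_eq_right ht.1, max_eq_right ht.2, min_eq_right ht.1]
  ring_nf

/-- The condition `hμ` makes the sine and cosine pieces match at π/4. Past π/2 the formula persists
because both sides are symmetric about π/2. -/
theorem wave_of_mem_Icc_right (hμ : Real.sin (μ * (Real.pi / 4)) = ρ * Real.cos (μ * (Real.pi / 4)))
    {t : ℝ} (ht : t ∈ Icc (Real.pi / 4) (3 * Real.pi / 4)) :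
    wave ρ μ t = ρ * Real.cos (μ * (Real.pi / 2 - t)) := by
  have hpi := Real.pi_pos
  have hq : ∀ y, Real.pi / 4 ≤ y → quarterWave ρ μ y = ρ * Real.cos (μ * (Real.pi / 2 - y)) := by
    intro y hy
    rw [quarterWave, min_eq_right hy, max_eq_right (by linarith), max_eq_left hy,
      min_eq_right (by linarith), hμ]
    ring_nf
  rcases le_total t (Real.pi / 2) with h | h
  · rw [wave, Real.arcsin_sin (by linarith [ht.1]) h, hq t ht.1]
  · rw [wave, ← Real.sin_pi_sub, Real.arcsin_sin (by linarith [ht.2]) (by linarith),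
      hq _ (by linarith [ht.2]), ← Real.cos_neg]
    ring_nf

/-- The equation of the extremal function, at the points where the step weight is continuous. -/
theorem hasDerivAt_wave (hρ : ρ ≠ 0)
    (hμ : Real.sin (μ * (Real.pi / 4)) = ρ * Real.cos (μ * (Real.pi / 4))) (t : ℝ) :
    (0 < Real.cos (2 * t) → HasDerivAt (wave ρ μ) (μ * ρ⁻¹ * wave ρ μ (t + Real.pi / 2)) t) ∧
    (Real.cos (2 * t) < 0 → HasDerivAt (wave ρ μ) (μ * ρ * wave ρ μ (t + Real.pi / 2)) t) := by
  have hpi := Real.pi_pos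
  obtain ⟨n, hn⟩ : ∃ n : ℤ, t - n * Real.pi ∈ Ico (-(Real.pi / 4)) (3 * Real.pi / 4) := by
    refine ⟨⌊(t + Real.pi / 4) / Real.pi⌋, ?_, ?_⟩
    · have := Int.floor_le ((t + Real.pi / 4) / Real.pi)
      rw [le_div_iff₀ (by positivity)] at this
      linarith
    · have := Int.lt_floor_add_one ((t + Real.pi / 4) / Real.pi)
      rw [div_lt_iff₀ (by positivity)] at this
      linarith
  obtain ⟨u, hu⟩ : ∃ u, u = t - n * Real.pi := ⟨_, rfl⟩
  rw [← hu] at hn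
  have htu : t = u + n * Real.pi := by rw [hu]; ring
  have hcos : Real.cos (2 * t) = Real.cos (2 * u) := by
    rw [htu, ← Real.cos_add_int_mul_two_pi (2 * u) n]; congr 1; ring
  have hw : wave ρ μ (t + Real.pi / 2) = (-1) ^ n * wave ρ μ (u + Real.pi / 2) := by
    rw [← wave_add_int_mul_pi, htu]; congr 1; ring
  have hlin : ∀ c : ℝ, HasDerivAt (fun s : ℝ => s - c) 1 t := fun c =>
    (hasDerivAt_id t).sub_const c
  rw [hcos, hw]
  constructor
  · intro h
    have hu2 : u < Real.pi / 4 := by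
      by_contra hcon
      have := Real.cos_nonpos_of_pi_div_two_le_of_le (x := 2 * u) (by linarith)
        (by linarith [hn.2])
      linarith
    have hu1 : -(Real.pi / 4) < u := by
      refine lt_of_le_of_ne hn.1 fun h' => ?_
      rw [← h', show 2 * -(Real.pi / 4) = -(Real.pi / 2) by ring, Real.cos_neg,
        Real.cos_pi_div_two] at h
      exact lt_irrefl _ h
    have hev : wave ρ μ =ᶠ[𝓝 t] fun s => (-1) ^ n * Real.sin (μ * (s - n * Real.pi)) := by
      have : Ioo (-(Real.pi / 4) + n * Real.pi) (Real.pi / 4 + n * Real.pi) ∈ 𝓝 t :=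
        Ioo_mem_nhds (by linarith) (by linarith)
      filter_upwards [this] with s hs
      rw [← wave_of_mem_Icc_left (ρ := ρ) ⟨by linarith [hs.1], by linarith [hs.2]⟩,
        ← wave_add_int_mul_pi]
      congr 1; ring
    have hd := (((hlin (n * Real.pi)).const_mul μ).sin.const_mul ((-1 : ℝ) ^ n))
    refine (hd.congr_of_eventuallyEq hev).congr_deriv ?_
    -- The quarter shift of the wave acts as the flux: at u + π/2 its value is ρ cos(μu), a multiple
    -- of the derivative of sin(μu).
    rw [← hu, wave_of_mem_Icc_right hμ ⟨by linarith, by linarith⟩,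
      show Real.pi / 2 - (u + Real.pi / 2) = -u by ring, mul_neg, Real.cos_neg]
    field_simp
  · intro h
    have hu1 : Real.pi / 4 < u := by
      by_contra hcon
      have := Real.cos_nonneg_of_neg_pi_div_two_le_of_le (x := 2 * u) (by linarith [hn.1])
        (by linarith)
      linarith
    have hev : wave ρ μ =ᶠ[𝓝 t]
        fun s => (-1) ^ n * (ρ * Real.cos (μ * (Real.pi / 2 - (s - n * Real.pi)))) := by
      have : Ioo (Real.pi / 4 + n * Real.pi) (3 * Real.pi / 4 + n * Real.pi) ∈ 𝓝 t :=
        Ioo_mem_nhds (by linarith) (by linarith [hn.2])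
      filter_upwards [this] with s hs
      rw [← wave_of_mem_Icc_right hμ ⟨by linarith [hs.1], by linarith [hs.2]⟩,
        ← wave_add_int_mul_pi]
      congr 1; ring
    have hd := ((((hlin (n * Real.pi)).const_sub (Real.pi / 2)).const_mul μ).cos.const_mul
      ρ).const_mul ((-1 : ℝ) ^ n)
    refine (hd.congr_of_eventuallyEq hev).congr_deriv ?_
    have h1 : wave ρ μ (u + Real.pi / 2) = -wave ρ μ (u - Real.pi / 2) := by
      rw [← antiperiodic_wave]; congr 1; ring
    rw [← hu, h1, wave_of_mem_Icc_left ⟨by linarith, by linarith [hn.2]⟩, ← Real.sin_neg,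
      ← mul_neg, neg_sub]
    ring

/-- The wave is continuous and has a bounded derivative off a countable set, so the fundamental
theorem of calculus bounds its increments. -/
theorem exists_lipschitzWith_wave (hρ : ρ ≠ 0)
    (hμ : Real.sin (μ * (Real.pi / 4)) = ρ * Real.cos (μ * (Real.pi / 4))) :
    ∃ K, LipschitzWith K (wave ρ μ) := by
  obtain ⟨K, hK⟩ : ∃ K : ℝ, ∀ t, |wave ρ μ t| ≤ K := by
    obtain ⟨K, hK⟩ := isCompact_Icc.exists_bound_of_continuousOn
      (continuous_wave (ρ := ρ) (μ := μ)).continuousOn (s := Icc 0 (2 * Real.pi))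
    refine ⟨K, fun t => ?_⟩
    obtain ⟨y, hy, hyt⟩ := periodic_wave.exists_mem_Ico₀ Real.two_pi_pos (f := wave ρ μ) t
    rw [hyt]
    exact hK y (Ico_subset_Icc_self hy)
  obtain ⟨D, hD⟩ : ∃ D : ℝ → ℝ, D = fun t => if 0 < Real.cos (2 * t) then
    μ * ρ⁻¹ * wave ρ μ (t + Real.pi / 2) else μ * ρ * wave ρ μ (t + Real.pi / 2) := ⟨_, rfl⟩
  have hc : Continuous fun t => wave ρ μ (t + Real.pi / 2) :=
    continuous_wave.comp (continuous_add_const _)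
  have hDm : Measurable D := by
    rw [hD]
    refine Measurable.ite ?_ (hc.measurable.const_mul _) (hc.measurable.const_mul _)
    exact (isOpen_lt continuous_const (by fun_prop)).measurableSet
  obtain ⟨B, hB⟩ : ∃ B : ℝ, B = max (|μ * ρ⁻¹| * K) (|μ * ρ| * K) := ⟨_, rfl⟩
  have hDB : ∀ t, |D t| ≤ B := fun t => by
    rw [hD, hB]
    simp only
    split_ifs
    · rw [abs_mul]
      exact le_max_of_le_left (mul_le_mul_of_nonneg_left (hK _) (abs_nonneg _))
    · rw [abs_mul]
      exact le_max_of_le_right (mul_le_mul_of_nonneg_left (hK _) (abs_nonneg _))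
  have hDi : ∀ x y, IntervalIntegrable D volume x y := fun x y =>
    (memL2Loc_of_ae_bound hDm.aestronglyMeasurable
      (Eventually.of_forall hDB)).locallyIntegrable.intervalIntegrable x y
  have hFTC : ∀ x y, ∫ t in x..y, D t = wave ρ μ y - wave ρ μ x := fun x y => by
    refine integral_eq_of_hasDerivAt_off_countable _ _ countable_cos_two_mul_eq_zero
      continuous_wave.continuousOn (fun t ht => ?_) (hDi x y)
    have hne : Real.cos (2 * t) ≠ 0 := ht.2
    rw [hD]
    simp only
    split_ifs with h
    · exact (hasDerivAt_wave hρ hμ t).1 h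
    · exact (hasDerivAt_wave hρ hμ t).2 (lt_of_le_of_ne (not_lt.1 h) hne)
  refine ⟨Real.toNNReal B, LipschitzWith.of_dist_le_mul fun x y => ?_⟩
  rw [Real.dist_eq, ← hFTC, Real.coe_toNNReal _ ((abs_nonneg _).trans (hDB 0)), Real.dist_eq]
  exact intervalIntegral.norm_integral_le_of_norm_le_const (f := D) (C := B) fun t _ => hDB t

end Wave


/-! ### The constant in (i) and the characterization of equality. -/

theorem exists_bestConst_bound_params {a b : ℝ → ℝ} (ha : BddWeight a) (hb : BddWeight b) :
    ∃ κ ρ : ℝ, 0 < κ ∧ 0 < ρ ∧ ρ ≤ 1 ∧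
      ρ = (essInf (fun x => a x * b x) volume / essSup (fun x => a x * b x) volume) ^
        (1 / 4 : ℝ) ∧
      ∀ᵐ x, κ * ρ ≤ Real.sqrt (a x * b x) ∧ Real.sqrt (a x * b x) ≤ κ * ρ⁻¹ := by
  obtain ⟨m, M, hm, h⟩ := ha.bounds
  obtain ⟨n, N, hn, h'⟩ := hb.bounds
  have hbd : ∀ᵐ x, m * n ≤ a x * b x ∧ |a x * b x| ≤ M * N := by
    filter_upwards [h, h'] with x hx hy
    have ha0 := hm.trans_le hx.1
    have hb0 := hn.trans_le hy.1
    rw [abs_of_pos (mul_pos ha0 hb0)]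
    exact ⟨mul_le_mul hx.1 hy.1 hn.le ha0.le, mul_le_mul hx.2 hy.2 hb0.le (ha0.le.trans hx.2)⟩
  have hbd' : ∀ᵐ x, |a x * b x| ≤ M * N := by filter_upwards [hbd] with x hx using hx.2
  have hinf := ae_essInf_le_of_bound hbd'
  have hsup := ae_le_essSup_of_bound hbd'
  have hpos : 0 < essInf (fun x => a x * b x) volume := by
    refine lt_of_lt_of_le (mul_pos hm hn) (le_essInf_of_ae_le _ ?_ ?_)
    · filter_upwards [hbd] with x hx using hx.1
    · refine IsBoundedUnder.isCoboundedUnder_ge ⟨M * N, ?_⟩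
      rw [eventually_map]
      filter_upwards [hbd'] with x hx using (abs_le.1 hx).2
  obtain ⟨x, hx1, hx2⟩ := (hinf.and hsup).exists
  generalize essInf (fun x => a x * b x) volume = p at *
  generalize essSup (fun x => a x * b x) volume = q at *
  have hpq : p ≤ q := hx1.trans hx2
  have hq : 0 < q := hpos.trans_le hpq
  have hroot : ∀ y : ℝ, 0 < y → (y * y) ^ (1 / 4 : ℝ) = Real.sqrt y := fun y hy => by
    rw [Real.mul_rpow hy.le hy.le, ← Real.rpow_add hy, Real.sqrt_eq_rpow]
    norm_num
  -- The solution of κρ = √p and κ/ρ = √q: it centers the range of √(ab) multiplicatively.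
  refine ⟨(p * q) ^ (1 / 4 : ℝ), (p / q) ^ (1 / 4 : ℝ), by positivity, by positivity,
    Real.rpow_le_one (by positivity) ((div_le_one hq).2 hpq) (by norm_num), rfl, ?_⟩
  have h1 : (p * q) ^ (1 / 4 : ℝ) * (p / q) ^ (1 / 4 : ℝ) = Real.sqrt p := by
    rw [← Real.mul_rpow (by positivity) (by positivity), ← hroot p hpos]
    congr 1
    field_simp
  have h2 : (p * q) ^ (1 / 4 : ℝ) * ((p / q) ^ (1 / 4 : ℝ))⁻¹ = Real.sqrt q := by
    rw [← Real.inv_rpow (by positivity), ← Real.mul_rpow (by positivity) (by positivity),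
      ← hroot q hq]
    congr 1
    field_simp
  rw [h1, h2]
  filter_upwards [hinf, hsup] with x hx hy
  exact ⟨Real.sqrt_le_sqrt hx, Real.sqrt_le_sqrt hy⟩

/-- The exceptional set in t lies in the image under τ of a null set, and τ is Lipschitz. The lemma
after this one uses the Lipschitz inverse in the same way. -/
theorem ae_restrict_Ioo_comp {a b : ℝ → ℝ} {θ : ℝ ≃ₜ ℝ} (ha : BddWeight a) (hb : BddWeight b)
    (hθ : ∀ x, θ.symm x = tau a b x) (hmono : StrictMono (tau a b)) {K : NNReal}
    (hK : LipschitzWith K (tau a b)) {P : ℝ → Prop}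
    (h : ∀ᵐ x, x ∈ Icc 0 (2 * Real.pi) → P x) :
    ∀ᵐ t ∂volume.restrict (Ioo 0 (2 * Real.pi)), P (θ t) := by
  rw [ae_restrict_iff' measurableSet_Ioo]
  refine measure_mono_null ?_ (hK.volume_image_eq_zero h)
  intro t ht
  simp only [mem_compl_iff, mem_ofPred_eq, Classical.not_imp] at ht ⊢
  have ht' : tau a b (θ t) = t := by rw [← hθ, θ.symm_apply_apply]
  refine ⟨θ t, ?_, ht'⟩
  simp only [mem_compl_iff, mem_ofPred_eq, Classical.not_imp]
  refine ⟨⟨?_, ?_⟩, ht.2⟩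
  · rw [← hmono.le_iff_le, tau_zero, ht']; exact ht.1.1.le
  · rw [← hmono.le_iff_le, tau_two_pi ha hb, ht']; exact ht.1.2.le

theorem ae_Icc_of_ae_restrict_Ioo {a b : ℝ → ℝ} {θ : ℝ ≃ₜ ℝ} (ha : BddWeight a)
    (hb : BddWeight b) (hθ : ∀ x, θ.symm x = tau a b x) (hmono : StrictMono (tau a b))
    {K : NNReal} (hK : LipschitzWith K θ) {P : ℝ → Prop}
    (h : ∀ᵐ t ∂volume.restrict (Ioo 0 (2 * Real.pi)), P (θ t)) :
    ∀ᵐ x, x ∈ Icc 0 (2 * Real.pi) → P x := by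
  rw [ae_restrict_iff' measurableSet_Ioo] at h
  have h1 : ∀ᵐ x : ℝ, x ∉ θ '' {t | ¬(t ∈ Ioo 0 (2 * Real.pi) → P (θ t))} :=
    measure_eq_zero_iff_ae_notMem.1 (hK.volume_image_eq_zero h)
  have h₁ : ∀ᵐ x : ℝ, x ≠ 0 := by simp [ae_iff, measure_singleton]
  have h₂ : ∀ᵐ x : ℝ, x ≠ 2 * Real.pi := by simp [ae_iff, measure_singleton]
  filter_upwards [h1, h₁, h₂] with x hx hx0 hx1 hm
  have hx' : θ (tau a b x) = x := by rw [← hθ, θ.apply_symm_apply]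
  by_contra hP
  refine hx ⟨tau a b x, ?_, hx'⟩
  simp only [mem_ofPred_eq, Classical.not_imp, hx']
  refine ⟨⟨?_, ?_⟩, hP⟩
  · have := hmono (lt_of_le_of_ne hm.1 (Ne.symm hx0))
    rwa [tau_zero] at this
  · have := hmono (lt_of_le_of_ne hm.2 hx1)
    rwa [tau_two_pi ha hb] at this

/-- In the case of equality, `a b` is a step function of `τ`. -/
theorem exists_shift_of_bestConst_eq {a b : ℝ → ℝ} {κ ρ : ℝ} (ha : MemB a) (hb : MemB b)
    (hκ : 0 < κ) (hρ : 0 < ρ) (hρ1 : ρ ≤ 1)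
    (hab : ∀ᵐ x, κ * ρ ≤ Real.sqrt (a x * b x) ∧ Real.sqrt (a x * b x) ≤ κ * ρ⁻¹)
    (heq : bestConst a b = (meanSqrt a b / (4 / Real.pi * Real.arctan ρ)) ^ 2) :
    ∃ φ : ℝ, ∀ᵐ x, x ∈ Icc 0 (2 * Real.pi) →
      (0 < Real.sin (2 * (tau a b x + φ)) ∧ Real.sqrt (a x * b x) = κ * ρ) ∨
      (Real.sin (2 * (tau a b x + φ)) < 0 ∧ Real.sqrt (a x * b x) = κ * ρ⁻¹) := by
  have hspec := bestConstSpec ha hb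
  obtain ⟨w, v, hsol, hne⟩ := hspec.exists_sol
  have hA : 0 < Real.arctan ρ := Real.arctan_pos.2 hρ
  have hc := meanSqrt_pos ha.bddWeight hb.bddWeight
  have hpi := Real.pi_pos
  have hsqrt : Real.sqrt (bestConst a b)⁻¹ = 4 / Real.pi * Real.arctan ρ / meanSqrt a b := by
    rw [Real.sqrt_inv, heq, Real.sqrt_sq (by positivity), inv_div]
  obtain ⟨ψ, hψ1, hψ2⟩ := (hsol.eight_mul_arctan_le ha.bddWeight hb.bddWeight hκ hρ hρ1 hab
    (inv_pos.2 hspec.pos) hne).2 (by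
      rw [hsqrt, integral_sqrt_div_eq]
      field_simp
      ring)
  -- In the case of equality the rescaled turning time at ψ(x) is τ(x) plus its initial value; the
  -- extra π/4 turns cos 2t into sin 2t.
  refine ⟨Real.pi / (4 * Real.arctan ρ) * turnTime ρ (ψ 0) + Real.pi / 4, ?_⟩
  filter_upwards [hψ2] with x hx hm
  have h1 : Real.sin (2 * (tau a b x +
      (Real.pi / (4 * Real.arctan ρ) * turnTime ρ (ψ 0) + Real.pi / 4))) =
      Real.cos (2 * (Real.pi / (4 * Real.arctan ρ) * turnTime ρ (ψ x))) := by
    rw [hψ1 x hm, hsqrt, ← Real.sin_add_pi_div_two, tau]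
    congr 1
    field_simp
    ring
  rw [h1]
  rcases hx hm with ⟨h2, h3⟩ | ⟨h2, h3⟩
  · exact Or.inl ⟨(pos_iff_pos_of_mul_pos (cos_mul_cos_turnTime_pos hρ hρ1 h2.ne')).1 h2, h3⟩
  · refine Or.inr ⟨?_, h3⟩
    have := cos_mul_cos_turnTime_pos hρ hρ1 h2.ne
    exact (neg_iff_neg_of_mul_pos this).1 h2

/-- With μ = (4/π) arctan ρ, composing the wave with a shift of τ gives a periodic solution for the
eigenvalue (μ / `meanSqrt a b`)², and the best constant is at least the reciprocal of any positive
eigenvalue. -/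
theorem le_bestConst_of_step {a b : ℝ → ℝ} {κ ρ φ : ℝ} (ha : MemB a) (hb : MemB b)
    (hκ : 0 < κ) (hρ : 0 < ρ) (hstep : ∀ᵐ x, x ∈ Icc 0 (2 * Real.pi) →
      (0 < Real.sin (2 * (tau a b x + φ)) ∧ Real.sqrt (a x * b x) = κ * ρ) ∨
      (Real.sin (2 * (tau a b x + φ)) < 0 ∧ Real.sqrt (a x * b x) = κ * ρ⁻¹)) :
    (meanSqrt a b / (4 / Real.pi * Real.arctan ρ)) ^ 2 ≤ bestConst a b := by
  have hpi := Real.pi_pos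
  have ha' := ha.bddWeight
  have hb' := hb.bddWeight
  have hA : 0 < Real.arctan ρ := Real.arctan_pos.2 hρ
  have hc := meanSqrt_pos ha' hb'
  have hs := ha'.sqrt_div hb'
  obtain ⟨θ, hθ, hmono, -, K', hK'⟩ := exists_homeomorph_tau ha' hb'
  obtain ⟨μ, hμdef⟩ : ∃ μ, μ = 4 / Real.pi * Real.arctan ρ := ⟨_, rfl⟩
  have hμ0 : 0 < μ := by rw [hμdef]; positivity
  have hμ : Real.sin (μ * (Real.pi / 4)) = ρ * Real.cos (μ * (Real.pi / 4)) := by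
    have h1 : μ * (Real.pi / 4) = Real.arctan ρ := by rw [hμdef]; field_simp
    have h2 := Real.tan_arctan ρ
    rw [Real.tan_eq_sin_div_cos, div_eq_iff (Real.cos_arctan_pos ρ).ne'] at h2
    rw [h1, h2]
  obtain ⟨K, hK⟩ := exists_lipschitzWith_wave hρ.ne' hμ
  rw [← hμdef]
  -- The shift by π/4 moves the jumps of the step weight, at sin 2t = 0, to the junctions of the
  -- wave, at cos 2t = 0.
  obtain ⟨T, hT⟩ : ∃ T : ℝ → ℝ, T = fun x => tau a b x + (φ - Real.pi / 4) := ⟨_, rfl⟩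
  have hTsin : ∀ x, Real.cos (2 * T x) = Real.sin (2 * (tau a b x + φ)) := fun x => by
    rw [← Real.cos_sub_pi_div_two, hT]
    congr 1
    ring
  have hTd : ∀ᵐ x, HasDerivAt T (1 / meanSqrt a b * Real.sqrt (a x / b x)) x := by
    filter_upwards [LocallyIntegrable.ae_hasDerivAt_integral hs.locallyIntegrable] with x hx
    rw [hT]
    exact ((hx 0).const_mul _).add_const _
  have hTlip : LipschitzWith K' T := by
    rw [hT]
    refine LipschitzWith.of_dist_le_mul fun x y => ?_
    rw [dist_add_right]
    exact hK'.dist_le_mul x y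
  -- The offset d covers both the solution, with d = 0, and its flux, with d = π/2.
  have hac : ∀ d : ℝ, AbsolutelyContinuousOnInterval (fun x => wave ρ μ (T x + d)) 0
      (2 * Real.pi) := fun d => by
    refine (LipschitzWith.lipschitzOnWith (K := K * K') (LipschitzWith.of_dist_le_mul
      fun x y => ?_)).absolutelyContinuousOnInterval
    refine (hK.dist_le_mul _ _).trans ?_
    rw [dist_add_right, NNReal.coe_mul, mul_assoc]
    gcongr
    exact hTlip.dist_le_mul x y
  have hsplit : ∀ᵐ x, 0 < a x ∧ 0 < b x := ha'.ae_pos.and hb'.ae_pos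
  have hw : HasACDeriv (fun x => wave ρ μ (T x + 0))
      (fun x => μ * κ / meanSqrt a b * wave ρ μ (T x + Real.pi / 2) / b x) 0 (2 * Real.pi) := by
    refine ⟨hac 0, ?_⟩
    filter_upwards [hTd, hstep, hsplit] with x hx hst hpos hm
    rw [uIcc_two_pi] at hm
    have h4 := Real.sqrt_pos.2 hpos.1
    have h5 := Real.sqrt_pos.2 hpos.2
    have h6 := Real.sq_sqrt hpos.2.le
    have h9 := hpos.2.ne'
    simp only [add_zero]
    rcases hst hm with ⟨h1, h2⟩ | ⟨h1, h2⟩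
    · rw [← hTsin] at h1
      refine (((hasDerivAt_wave hρ.ne' hμ (T x)).1 h1).comp x hx).congr_deriv ?_
      have h3 : ρ⁻¹ = κ / Real.sqrt (a x * b x) := by rw [h2]; field_simp
      rw [h3, Real.sqrt_div hpos.1.le, Real.sqrt_mul hpos.1.le]
      field_simp
      rw [h6]
      field_simp
    · rw [← hTsin] at h1
      refine (((hasDerivAt_wave hρ.ne' hμ (T x)).2 h1).comp x hx).congr_deriv ?_
      have h3 : ρ = κ / Real.sqrt (a x * b x) := by rw [h2]; field_simp
      rw [show μ * ρ = μ * (κ / Real.sqrt (a x * b x)) by rw [← h3], Real.sqrt_div hpos.1.le,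
        Real.sqrt_mul hpos.1.le]
      field_simp
      rw [h6]
      field_simp
  have hv : HasACDeriv (fun x => μ * κ / meanSqrt a b * wave ρ μ (T x + Real.pi / 2))
      (fun x => -((μ / meanSqrt a b) ^ 2 * (a x * wave ρ μ (T x + 0)))) 0 (2 * Real.pi) := by
    refine ⟨(hac _).const_mul _, ?_⟩
    filter_upwards [hTd, hstep, hsplit] with x hx hst hpos hm
    rw [uIcc_two_pi] at hm
    have h4 := Real.sqrt_pos.2 hpos.1
    have h5 := Real.sqrt_pos.2 hpos.2
    have h6 := Real.sq_sqrt hpos.1.le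
    have h7 : Real.cos (2 * (T x + Real.pi / 2)) = -Real.cos (2 * T x) := by
      rw [← Real.cos_add_pi]; congr 1; ring
    have h8 : wave ρ μ (T x + Real.pi / 2 + Real.pi / 2) = -wave ρ μ (T x) := by
      rw [← antiperiodic_wave]; congr 1; ring
    have hx' := hx.add_const (Real.pi / 2)
    simp only [add_zero]
    rcases hst hm with ⟨h1, h2⟩ | ⟨h1, h2⟩
    · rw [← hTsin, ← neg_neg (Real.cos (2 * T x)), ← h7] at h1
      refine ((((hasDerivAt_wave hρ.ne' hμ (T x + Real.pi / 2)).2 (by linarith)).comp x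
        hx').const_mul _).congr_deriv ?_
      have h3 : ρ = Real.sqrt (a x * b x) / κ := by rw [h2]; field_simp
      rw [h8, show μ * ρ = μ * (Real.sqrt (a x * b x) / κ) by rw [← h3],
        Real.sqrt_div hpos.1.le, Real.sqrt_mul hpos.1.le]
      field_simp
      rw [h6]
      field_simp
    · rw [← hTsin, ← neg_neg (Real.cos (2 * T x)), ← h7] at h1
      refine ((((hasDerivAt_wave hρ.ne' hμ (T x + Real.pi / 2)).1 (by linarith)).comp x
        hx').const_mul _).congr_deriv ?_
      have h3 : ρ⁻¹ = Real.sqrt (a x * b x) / κ := by rw [h2]; field_simp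
      rw [h8, h3, Real.sqrt_div hpos.1.le, Real.sqrt_mul hpos.1.le]
      field_simp
      rw [h6]
      field_simp
  have hTper : T (2 * Real.pi) = T 0 + 2 * Real.pi := by
    rw [hT]; simp only [tau_two_pi ha' hb', tau_zero]; ring
  have hsol : IsPeriodicSol a b ((μ / meanSqrt a b) ^ 2) (fun x => wave ρ μ (T x + 0))
      (fun x => μ * κ / meanSqrt a b * wave ρ μ (T x + Real.pi / 2)) := by
    refine ⟨hw, hv, ?_, ?_⟩
    · simp only [hTper, add_zero]
      exact periodic_wave _
    · simp only [hTper]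
      rw [add_right_comm, periodic_wave]
  -- The point is chosen with T x equal to π/2 modulo 2π, where the wave takes the value ρ.
  have hne : ∃ x ∈ Icc 0 (2 * Real.pi), wave ρ μ (T x + 0) ≠ 0 := by
    obtain ⟨t, ht⟩ : ∃ t, t = toIcoMod Real.two_pi_pos 0 (Real.pi / 2 - (φ - Real.pi / 4)) :=
      ⟨_, rfl⟩
    have htm : t ∈ Ico 0 (2 * Real.pi) := by
      have := toIcoMod_mem_Ico Real.two_pi_pos 0 (Real.pi / 2 - (φ - Real.pi / 4))
      rwa [zero_add, ← ht] at this
    have hτ : tau a b (θ t) = t := by rw [← hθ, θ.symm_apply_apply]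
    refine ⟨θ t, ⟨?_, ?_⟩, ?_⟩
    · rw [← hmono.le_iff_le, tau_zero, hτ]; exact htm.1
    · rw [← hmono.le_iff_le, tau_two_pi ha' hb', hτ]; exact htm.2.le
    · rw [hT]
      simp only [hτ, add_zero]
      rw [ht, toIcoMod, zsmul_eq_mul, show ∀ n : ℝ, Real.pi / 2 - (φ - Real.pi / 4) -
        n * (2 * Real.pi) + (φ - Real.pi / 4) = Real.pi / 2 - n * (2 * Real.pi) by intro n; ring,
        periodic_wave.sub_int_mul_eq, wave_of_mem_Icc_right hμ ⟨by linarith, by linarith⟩]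
      simpa using hρ.ne'
  have := (bestConstSpec ha hb).inv_le _ (by positivity) _ _ hsol hne
  rwa [← inv_pow, inv_div] at this


/-! ### Normalized constants over the class 𝓑(L). -/

theorem rpow_neg_half_spec {L : ℝ} (hL : 1 < L) :
    0 < Real.sqrt L ∧ 0 < L ^ (-1 / 2 : ℝ) ∧ L ^ (-1 / 2 : ℝ) ≤ 1 ∧
      Real.sqrt L * L ^ (-1 / 2 : ℝ) = 1 ∧ Real.sqrt L * (L ^ (-1 / 2 : ℝ))⁻¹ = L := by
  have hL0 : 0 < L := zero_lt_one.trans hL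
  have hs : 0 < Real.sqrt L := Real.sqrt_pos.2 hL0
  have h : L ^ (-1 / 2 : ℝ) = (Real.sqrt L)⁻¹ := by
    rw [Real.sqrt_eq_rpow, ← Real.rpow_neg hL0.le]
    norm_num
  rw [h, inv_inv, Real.mul_self_sqrt hL0.le]
  exact ⟨hs, inv_pos.2 hs, inv_le_one_of_one_le₀ (Real.one_le_sqrt.2 hL.le),
    mul_inv_cancel₀ hs.ne', rfl⟩

theorem MemBL.ae_mem {L : ℝ} {f : ℝ → ℝ} (h : MemBL L f) : ∀ᵐ x, 1 ≤ f x ∧ f x ≤ L := by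
  obtain ⟨M, hM⟩ := exists_ae_abs_le_of_memLp_top h.memLp
  have h1 := ae_essInf_le_of_bound hM
  have h2 := ae_le_essSup_of_bound hM
  rw [h.essInf_eq] at h1
  rw [h.essSup_eq] at h2
  exact h1.and h2

theorem div_sq_eq_mul_zpow (c D : ℝ) : (c / D) ^ 2 = D ^ (-2 : ℤ) * c ^ 2 := by
  rw [zpow_neg, div_pow, div_eq_inv_mul]
  rfl

theorem normalizedConst_le_iff {a b : ℝ → ℝ} {D : ℝ} (ha : MemB a) (hb : MemB b) :
    normalizedConst a b ≤ D ^ (-2 : ℤ) ↔ bestConst a b ≤ (meanSqrt a b / D) ^ 2 := by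
  have := meanSqrt_pos ha.bddWeight hb.bddWeight
  rw [normalizedConst, div_sq_eq_mul_zpow, div_le_iff₀ (by positivity)]

theorem normalizedConst_eq_iff {a b : ℝ → ℝ} {D : ℝ} (ha : MemB a) (hb : MemB b) :
    normalizedConst a b = D ^ (-2 : ℤ) ↔ bestConst a b = (meanSqrt a b / D) ^ 2 := by
  have := meanSqrt_pos ha.bddWeight hb.bddWeight
  rw [normalizedConst, div_sq_eq_mul_zpow, div_eq_iff (by positivity)]

/-- The bounds 1 and L on √(ab) correspond to κ = √L and ρ = L^(-1/2), for which κρ = 1 and κ/ρ = L.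
-/
theorem normalizedConst_le {a b : ℝ → ℝ} {L : ℝ} (ha : MemB a) (hb : MemB b) (hL : 1 < L)
    (h : MemBL L fun x => Real.sqrt (a x * b x)) :
    normalizedConst a b ≤ (4 / Real.pi * Real.arctan (L ^ (-1 / 2 : ℝ))) ^ (-2 : ℤ) := by
  obtain ⟨h1, h2, h3, h4, h5⟩ := rpow_neg_half_spec hL
  rw [normalizedConst_le_iff ha hb]
  refine bestConst_le ha hb h1 h2 h3 ?_
  rw [h4, h5]
  exact h.ae_mem

theorem ae_sin_two_mul_add_ne_zero (φ : ℝ) : ∀ᵐ t : ℝ, Real.sin (2 * (t + φ)) ≠ 0 := by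
  have h : ∀ᵐ t : ℝ, Real.sin (2 * t) ≠ 0 := by
    have := countable_sin_two_mul_eq_zero.ae_notMem volume
    filter_upwards [this] with x hx using hx
  exact (measurePreserving_add_right volume φ).quasiMeasurePreserving.ae h

theorem measurable_stepFun (L : ℝ) : Measurable (stepFun L) := by
  have hm := measurable_toIcoMod
  refine Measurable.ite ?_ measurable_const measurable_const
  exact (measurableSet_lt hm measurable_const).union
    ((measurableSet_le measurable_const hm).inter (measurableSet_lt hm measurable_const))

theorem stepFun_mem_Icc {L : ℝ} (hL : 1 < L) (x : ℝ) : 1 ≤ stepFun L x ∧ stepFun L x ≤ L := by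
  unfold stepFun
  simp only
  split_ifs
  · exact ⟨le_rfl, hL.le⟩
  · exact ⟨hL.le, le_rfl⟩

theorem memBL_stepFun {L : ℝ} (hL : 1 < L) : MemBL L (stepFun L) := by
  have hb : ∀ᵐ x, |stepFun L x| ≤ L := Eventually.of_forall fun x => by
    obtain ⟨h1, h2⟩ := stepFun_mem_Icc hL x
    rwa [abs_of_pos (zero_lt_one.trans_le h1)]
  have hpi := Real.pi_pos
  refine ⟨memLp_top_of_bound (measurable_stepFun L).aestronglyMeasurable L hb,
    Eventually.of_forall fun x => by simp [stepFun], le_antisymm ?_ ?_, le_antisymm ?_ ?_⟩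
  -- A bound valid almost everywhere holds on a dense set, hence at some point of an open interval
  -- where the step function takes the extreme value.
  · obtain ⟨x, hx, hx'⟩ := (Measure.dense_of_ae (ae_essInf_le_of_bound hb)).inter_open_nonempty
      (Ioo 0 (Real.pi / 2)) isOpen_Ioo (nonempty_Ioo.2 (by positivity))
    refine hx'.trans_eq (stepFun_of_sin_pos (Real.sin_pos_of_pos_of_lt_pi ?_ ?_))
    · linarith [hx.1]
    · linarith [hx.2]
  · refine le_essInf_of_ae_le _ (Eventually.of_forall fun x => (stepFun_mem_Icc hL x).1) ?_
    exact IsBoundedUnder.isCoboundedUnder_ge ⟨L, by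
      rw [eventually_map]; exact Eventually.of_forall fun x => (stepFun_mem_Icc hL x).2⟩
  · refine essSup_le_of_ae_le _ (Eventually.of_forall fun x => (stepFun_mem_Icc hL x).2) ?_
    exact IsBoundedUnder.isCoboundedUnder_le ⟨1, by
      rw [eventually_map]; exact Eventually.of_forall fun x => (stepFun_mem_Icc hL x).1⟩
  · obtain ⟨x, hx, hx'⟩ := (Measure.dense_of_ae (ae_le_essSup_of_bound hb)).inter_open_nonempty
      (Ioo (Real.pi / 2) Real.pi) isOpen_Ioo (nonempty_Ioo.2 (by linarith))
    refine (stepFun_of_sin_neg ?_).symm.trans_le hx'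
    rw [← Real.sin_sub_two_pi]
    exact Real.sin_neg_of_neg_of_neg_pi_lt (by linarith [hx.2]) (by linarith [hx.1])

theorem memB_stepFun {L : ℝ} (hL : 1 < L) : MemB (stepFun L) := by
  have h := memBL_stepFun hL
  exact ⟨h.memLp, h.periodic, h.essInf_eq.symm ▸ zero_lt_one⟩

/-- The step condition in terms of `stepFun`. -/
theorem sqrt_mul_step_of_eq_stepFun {L p t : ℝ} (hL : 1 < L) (ht : Real.sin (2 * t) ≠ 0)
    (h : p = stepFun L t ^ 2) :
    (0 < Real.sin (2 * t) ∧ Real.sqrt p = Real.sqrt L * L ^ (-1 / 2 : ℝ)) ∨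
      (Real.sin (2 * t) < 0 ∧ Real.sqrt p = Real.sqrt L * (L ^ (-1 / 2 : ℝ))⁻¹) := by
  obtain ⟨-, -, -, h4, h5⟩ := rpow_neg_half_spec hL
  rw [h, Real.sqrt_sq (zero_le_one.trans (stepFun_mem_Icc hL t).1), h4, h5]
  rcases ht.lt_or_gt with h1 | h1
  · exact Or.inr ⟨h1, stepFun_of_sin_neg h1⟩
  · exact Or.inl ⟨h1, stepFun_of_sin_pos h1⟩

theorem normalizedConst_eq_of_step {a b : ℝ → ℝ} {L φ : ℝ} (ha : MemB a) (hb : MemB b)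
    (hL : 1 < L) (h : MemBL L fun x => Real.sqrt (a x * b x))
    (hstep : ∀ᵐ x, x ∈ Icc 0 (2 * Real.pi) → Real.sin (2 * (tau a b x + φ)) ≠ 0 ∧
      a x * b x = stepFun L (tau a b x + φ) ^ 2) :
    normalizedConst a b = (4 / Real.pi * Real.arctan (L ^ (-1 / 2 : ℝ))) ^ (-2 : ℤ) := by
  obtain ⟨h1, h2, -, -, -⟩ := rpow_neg_half_spec hL
  rw [normalizedConst_eq_iff ha hb]
  refine le_antisymm ((normalizedConst_le_iff ha hb).1 (normalizedConst_le ha hb hL h))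
    (le_bestConst_of_step (φ := φ) ha hb h1 h2 ?_)
  filter_upwards [hstep] with x hx hm
  exact sqrt_mul_step_of_eq_stepFun hL (hx hm).1 (hx hm).2

/-- For a = b = ā the quotient a/b is 1, so τ is the identity and the step condition holds with zero
shift: the upper bound is attained. -/
theorem isGreatest_normalizedConsts {L : ℝ} (hL : 1 < L) :
    IsGreatest (normalizedConsts L)
      ((4 / Real.pi * Real.arctan (L ^ (-1 / 2 : ℝ))) ^ (-2 : ℤ)) := by
  have hs := memB_stepFun hL
  have hpos : ∀ x, 0 < stepFun L x := fun x => zero_lt_one.trans_le (stepFun_mem_Icc hL x).1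
  have hsq : (fun x => Real.sqrt (stepFun L x * stepFun L x)) = stepFun L :=
    funext fun x => Real.sqrt_mul_self (hpos x).le
  have hdiv : (fun x => Real.sqrt (stepFun L x / stepFun L x)) = fun _ => 1 :=
    funext fun x => by rw [div_self (hpos x).ne', Real.sqrt_one]
  have hmean : meanSqrt (stepFun L) (stepFun L) = 1 := by
    have hpi := Real.pi_pos
    unfold meanSqrt
    rw [hdiv, intervalIntegral.integral_const, sub_zero, smul_eq_mul, mul_one]
    field_simp
  have htau : ∀ x, tau (stepFun L) (stepFun L) x = x := fun x => by
    unfold tau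
    rw [hmean, hdiv, intervalIntegral.integral_const]
    simp
  have hBL : MemBL L fun x => Real.sqrt (stepFun L x * stepFun L x) := by
    rw [hsq]; exact memBL_stepFun hL
  refine ⟨⟨stepFun L, stepFun L, hs, hs, hBL, ?_⟩, ?_⟩
  · refine (normalizedConst_eq_of_step (φ := 0) hs hs hL hBL ?_).symm
    filter_upwards [ae_sin_two_mul_add_ne_zero 0] with x hx hm
    rw [htau]
    exact ⟨hx, by rw [add_zero, sq]⟩
  · rintro r ⟨a, b, ha, hb, hab, rfl⟩
    exact normalizedConst_le ha hb hL hab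

theorem normalizedConst_eq_iff_exists_shift {a b : ℝ → ℝ} {L : ℝ} {θ : ℝ ≃ₜ ℝ} (ha : MemB a)
    (hb : MemB b) (hθ : ∀ x, θ.symm x = tau a b x) (hmono : StrictMono (tau a b))
    {K K' : NNReal} (hK : LipschitzWith K θ) (hK' : LipschitzWith K' (tau a b)) (hL : 1 < L)
    (h : MemBL L fun x => Real.sqrt (a x * b x)) :
    normalizedConst a b = (4 / Real.pi * Real.arctan (L ^ (-1 / 2 : ℝ))) ^ (-2 : ℤ) ↔
      ∃ φ : ℝ, ∀ᵐ t ∂(volume.restrict (Ioo 0 (2 * Real.pi))),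
        a (θ t) * b (θ t) = stepFun L (t + φ) ^ 2 := by
  have ha' := ha.bddWeight
  have hb' := hb.bddWeight
  have hτ : ∀ t, tau a b (θ t) = t := fun t => by rw [← hθ, θ.symm_apply_apply]
  obtain ⟨h1, h2, h3, h4, h5⟩ := rpow_neg_half_spec hL
  constructor
  · intro heq
    obtain ⟨φ, hφ⟩ := exists_shift_of_bestConst_eq ha hb h1 h2 h3 (by
      rw [h4, h5]; exact h.ae_mem) ((normalizedConst_eq_iff ha hb).1 heq)
    refine ⟨φ, ?_⟩
    rw [h4, h5] at hφ
    have h6 : ∀ᵐ x, x ∈ Icc 0 (2 * Real.pi) →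
        a x * b x = stepFun L (tau a b x + φ) ^ 2 := by
      filter_upwards [hφ, ha'.ae_pos, hb'.ae_pos] with x hx hax hbx hm
      have h7 := Real.sq_sqrt (mul_pos hax hbx).le
      rcases hx hm with ⟨h8, h9⟩ | ⟨h8, h9⟩
      · rw [stepFun_of_sin_pos h8, ← h7, h9]
      · rw [stepFun_of_sin_neg h8, ← h7, h9]
    simpa only [hτ] using ae_restrict_Ioo_comp ha' hb' hθ hmono hK' h6
  · rintro ⟨φ, hφ⟩
    refine normalizedConst_eq_of_step (φ := φ) ha hb hL h ?_
    refine ae_Icc_of_ae_restrict_Ioo ha' hb' hθ hmono hK ?_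
    simp only [hτ]
    filter_upwards [hφ, ae_restrict_of_ae (ae_sin_two_mul_add_ne_zero φ)] with t ht ht'
      using ⟨ht', ht⟩


/-! ### Reciprocal weights. -/

theorem IsAdmissible.congr {a u w g : ℝ → ℝ} (h : IsAdmissible a u g) (hw : w =ᵐ[volume] u) :
    IsAdmissible a w g := by
  obtain ⟨u', hu, -, hp, hprim⟩ := h.isPeriodicH1.exists_primitive
  refine ⟨isPeriodicH1_of_primitive h.isPeriodicH1.deriv_memL2Loc hprim hp (hw.trans hu), ?_⟩
  refine (integral_congr_circleVol (ae_restrict_of_ae ?_)).trans h.constraint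
  filter_upwards [hw] with x hx
  rw [hx]

theorem periodic_cos_primitive {a : ℝ → ℝ} (ha : BddWeight a) (hp : AEPeriodic a) (C φ : ℝ) :
    Function.Periodic (fun x => C * Real.cos (2 * Real.pi *
      (∫ y in (0 : ℝ)..(2 * Real.pi), a y)⁻¹ * (∫ y in (0 : ℝ)..x, a y) + φ))
      (2 * Real.pi) := fun x => by
  have hA := ha.integral_pos Real.two_pi_pos
  simp only [hp.integral_add_two_pi ha.locallyIntegrable]
  rw [← Real.cos_add_two_pi (_ * (∫ y in (0 : ℝ)..x, a y) + φ)]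
  congr 2
  field_simp
  ring

theorem continuous_cos_primitive {a : ℝ → ℝ} (ha : BddWeight a) (C ω φ : ℝ) :
    Continuous fun x => C * Real.cos (ω * (∫ y in (0 : ℝ)..x, a y) + φ) := by
  have := ha.locallyIntegrable.continuous_primitive' 0
  fun_prop

theorem exists_cos_primitive_ne_zero {a : ℝ → ℝ} (ha : BddWeight a) {C : ℝ} (hC : C ≠ 0)
    (φ : ℝ) : ∃ x ∈ Icc 0 (2 * Real.pi), C * Real.cos (2 * Real.pi *
      (∫ y in (0 : ℝ)..(2 * Real.pi), a y)⁻¹ * (∫ y in (0 : ℝ)..x, a y) + φ) ≠ 0 := by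
  have hA := ha.integral_pos Real.two_pi_pos
  by_contra! hcon
  have h1 := hcon 0 zero_mem_Icc_two_pi
  -- At this point the phase has advanced by π/2, so vanishing both here and at 0 would force cos φ
  -- = sin φ = 0.
  obtain ⟨x, hx, hx'⟩ := intermediate_value_Icc Real.two_pi_pos.le
    (ha.locallyIntegrable.continuous_primitive' 0).continuousOn
    (show (∫ y in (0 : ℝ)..(2 * Real.pi), a y) / 4 ∈ Icc _ _ by
      simp only [intervalIntegral.integral_same]; constructor <;> linarith)
  have h2 := hcon x hx
  simp only at hx'
  rw [hx', show 2 * Real.pi * (∫ y in (0 : ℝ)..(2 * Real.pi), a y)⁻¹ *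
    ((∫ y in (0 : ℝ)..(2 * Real.pi), a y) / 4) + φ = φ + Real.pi / 2 by field_simp; ring,
    Real.cos_add_pi_div_two] at h2
  rw [intervalIntegral.integral_same, mul_zero, zero_add] at h1
  have h3 := (mul_eq_zero.1 h1).resolve_left hC
  have h4 := neg_eq_zero.1 ((mul_eq_zero.1 h2).resolve_left hC)
  have := Real.sin_sq_add_cos_sq φ
  rw [h3, h4] at this
  norm_num at this

theorem _root_.Function.Periodic.eq_of_eqOn_Icc {f g : ℝ → ℝ}
    (hf : Function.Periodic f (2 * Real.pi)) (hg : Function.Periodic g (2 * Real.pi))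
    (h : ∀ x ∈ Icc 0 (2 * Real.pi), f x = g x) : f = g := by
  ext x
  have hx := toIcoMod_mem_Ico Real.two_pi_pos 0 x
  rw [zero_add] at hx
  have := h _ (Ico_subset_Icc_self hx)
  rwa [toIcoMod, hf.sub_zsmul_eq, hg.sub_zsmul_eq] at this

section Reciprocal

variable {a b : ℝ → ℝ}

theorem BddWeight.hasACDeriv_primitive (ha : BddWeight a) :
    HasACDeriv (fun x => ∫ y in (0 : ℝ)..x, a y) a 0 (2 * Real.pi) :=
  HasACDeriv.of_eqOn_integral (ha.intervalIntegrable _ _) fun x _ => by simp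

theorem isPeriodicSol_cos_primitive (ha : BddWeight a) (hab : b =ᵐ[volume] fun x => (a x)⁻¹)
    {ω : ℝ} (hω : ω = 2 * Real.pi * (∫ y in (0 : ℝ)..(2 * Real.pi), a y)⁻¹) (C φ : ℝ) :
    IsPeriodicSol a b (ω ^ 2) (fun x => C * Real.cos (ω * (∫ y in (0 : ℝ)..x, a y) + φ))
      (fun x => -(C * ω) * Real.sin (ω * (∫ y in (0 : ℝ)..x, a y) + φ)) := by
  have hA := ha.integral_pos Real.two_pi_pos
  have hphase := (ha.hasACDeriv_primitive.const_mul ω).add (HasACDeriv.const φ)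
  have hend : ω * (∫ y in (0 : ℝ)..(2 * Real.pi), a y) + φ = φ + 2 * Real.pi := by
    rw [hω]
    field_simp
    ring
  refine ⟨?_, ?_, ?_, ?_⟩
  · refine ((hphase.comp Real.hasDerivAt_cos Real.continuous_sin.neg).const_mul C).congr_deriv ?_
    filter_upwards [hab] with x hx _
    rw [hx, div_inv_eq_mul]
    ring
  · refine ((hphase.comp Real.hasDerivAt_sin Real.continuous_cos).const_mul
      (-(C * ω))).congr_deriv (Eventually.of_forall fun x _ => ?_)
    ring
  · simp only [hend, intervalIntegral.integral_same, mul_zero, zero_add, Real.cos_add_two_pi]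
  · simp only [hend, intervalIntegral.integral_same, mul_zero, zero_add, Real.sin_add_two_pi]

/-- Solutions of the periodic problem with reciprocal weights are trigonometric functions of
the primitive. -/
theorem IsPeriodicSol.exists_eq_cos_primitive (ha : BddWeight a)
    (hab : b =ᵐ[volume] fun x => (a x)⁻¹) {ω : ℝ} (hω : ω ≠ 0) {w v : ℝ → ℝ}
    (h : IsPeriodicSol a b (ω ^ 2) w v) : ∃ C φ : ℝ, ∀ x ∈ Icc 0 (2 * Real.pi),
      w x = C * Real.cos (ω * (∫ y in (0 : ℝ)..x, a y) + φ) := by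
  have hphase := ha.hasACDeriv_primitive.const_mul ω
  have hcos := hphase.comp Real.hasDerivAt_cos Real.continuous_sin.neg
  have hsin := hphase.comp Real.hasDerivAt_sin Real.continuous_cos
  have hv := h.deriv_snd.const_mul ω⁻¹
  obtain ⟨R, ψ, -, hR1, hR2⟩ := exists_polar (w 0) (ω⁻¹ * v 0)
  refine ⟨R, -ψ, fun x hx => ?_⟩
  have hx' : x ∈ uIcc 0 (2 * Real.pi) := uIcc_two_pi ▸ hx
  -- Rotating (w, v/ω) by the phase ω ∫ a gives a constant vector; its two components are treated in
  -- turn, and the rotation is undone at the end.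
  have h1 := ((h.deriv_fst.mul hcos).sub (hv.mul hsin)).eq_left_of_deriv_zero (by
    filter_upwards [hab] with y hy _
    rw [hy, div_inv_eq_mul]
    field_simp
    ring) hx'
  have h2 := ((h.deriv_fst.mul hsin).add (hv.mul hcos)).eq_left_of_deriv_zero (by
    filter_upwards [hab] with y hy _
    rw [hy, div_inv_eq_mul]
    field_simp
    ring) hx'
  simp only [intervalIntegral.integral_same, mul_zero, Real.cos_zero, Real.sin_zero, mul_one,
    sub_zero, zero_add] at h1 h2
  have h3 := Real.sin_sq_add_cos_sq (ω * ∫ y in (0 : ℝ)..x, a y)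
  rw [← sub_eq_add_neg, Real.cos_sub]
  linear_combination Real.cos (ω * ∫ y in (0 : ℝ)..x, a y) * (h1 + hR1) +
    Real.sin (ω * ∫ y in (0 : ℝ)..x, a y) * (h2 + hR2) - w x * h3

/-- Since ab = 1, the general upper bound applies with κ = ρ = 1, where (4/π) arctan 1 = 1. The
cosine of the primitive is an eigenfunction that gives the reverse inequality. -/
theorem bestConst_of_reciprocal (ha : MemB a) (hb : MemB b)
    (hab : b =ᵐ[volume] fun x => (a x)⁻¹) :
    bestConst a b = ((2 * Real.pi)⁻¹ * ∫ x in (0 : ℝ)..(2 * Real.pi), a x) ^ 2 := by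
  have ha' := ha.bddWeight
  have hA := ha'.integral_pos Real.two_pi_pos
  have hpi := Real.pi_pos
  refine le_antisymm ?_ ?_
  · have h1 := bestConst_le ha hb zero_lt_one zero_lt_one le_rfl (by
      filter_upwards [hab, ha'.ae_pos] with x hx hax
      rw [hx, mul_inv_cancel₀ hax.ne', Real.sqrt_one]
      norm_num)
    have h2 : meanSqrt a b = (2 * Real.pi)⁻¹ * ∫ x in (0 : ℝ)..(2 * Real.pi), a x := by
      rw [meanSqrt, one_div]
      congr 1
      refine integral_congr_circleVol (ae_restrict_of_ae ?_)
      filter_upwards [hab, ha'.ae_pos] with x hx hax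
      rw [hx, div_inv_eq_mul, Real.sqrt_mul_self hax.le]
    rwa [Real.arctan_one, div_mul_div_cancel₀ hpi.ne', div_self four_ne_zero, div_one, h2] at h1
  · have h1 := (bestConstSpec ha hb).inv_le _ (by positivity) _ _
      (isPeriodicSol_cos_primitive ha' hab rfl 1 0) (exists_cos_primitive_ne_zero ha' one_ne_zero 0)
    refine le_trans (le_of_eq ?_) h1
    rw [← inv_pow, mul_inv (2 * Real.pi), inv_inv]

/-- Equality makes the competitor a maximizer, hence a solution of the Euler-Lagrange equation, and
these solutions are cosines of the primitive. Conversely, the energy identity gives equality for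
every such cosine. -/
theorem exists_admissible_eq_iff_of_reciprocal (ha : MemB a) (hb : MemB b)
    (hab : b =ᵐ[volume] fun x => (a x)⁻¹) (w : ℝ → ℝ) :
    (¬ w =ᵐ[volume] 0 ∧ ∃ g : ℝ → ℝ, IsAdmissible a w g ∧
      ∫ x in (0 : ℝ)..(2 * Real.pi), a x * w x ^ 2 =
        bestConst a b * ∫ x in (0 : ℝ)..(2 * Real.pi), b x * g x ^ 2) ↔
    ∃ C φ : ℝ, C ≠ 0 ∧ w =ᵐ[volume] fun x =>
      C * Real.cos (2 * Real.pi * (∫ y in (0 : ℝ)..(2 * Real.pi), a y)⁻¹ *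
        (∫ y in (0 : ℝ)..x, a y) + φ) := by
  have ha' := ha.bddWeight
  have hb' := hb.bddWeight
  have hA := ha'.integral_pos Real.two_pi_pos
  have hpi := Real.pi_pos
  have hspec := bestConstSpec ha hb
  obtain ⟨ω, hω⟩ : ∃ ω, ω = 2 * Real.pi * (∫ y in (0 : ℝ)..(2 * Real.pi), a y)⁻¹ := ⟨_, rfl⟩
  have hω0 : ω ≠ 0 := by rw [hω]; positivity
  have hinv : (bestConst a b)⁻¹ = ω ^ 2 := by
    rw [bestConst_of_reciprocal ha hb hab, hω, ← inv_pow, mul_inv (2 * Real.pi)⁻¹, inv_inv]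
  have hperiod := periodic_cos_primitive ha' ha.periodic
  have hcont := continuous_cos_primitive ha'
  have hnz := fun {C : ℝ} (hC : C ≠ 0) φ => exists_cos_primitive_ne_zero ha' hC φ
  simp only [← hω] at hperiod hnz ⊢
  constructor
  · rintro ⟨hne, g, hadm, heq⟩
    obtain ⟨u, hwu, -, hup, hcomp⟩ := hadm.exists_isCompetitor
    obtain ⟨v, hsol⟩ := hcomp.exists_isPeriodicSol ha' hb' hspec.pos hspec.le (by
      rw [← heq]
      refine integral_congr_circleVol (ae_restrict_of_ae ?_)
      filter_upwards [hwu] with x hx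
      rw [hx])
    rw [hinv] at hsol
    obtain ⟨C, φ, hu⟩ := hsol.exists_eq_cos_primitive ha' hab hω0
    have huU : u = fun x => C * Real.cos (ω * (∫ y in (0 : ℝ)..x, a y) + φ) :=
      hup.eq_of_eqOn_Icc (hperiod C φ) hu
    rw [huU] at hwu
    refine ⟨C, φ, ?_, hwu⟩
    rintro rfl
    simp only [zero_mul] at hwu
    exact hne hwu
  · rintro ⟨C, φ, hC, hw⟩
    obtain ⟨u, g, hadm, -, hup, hu, hen⟩ := (isPeriodicSol_cos_primitive ha' hab hω C
      φ).exists_isAdmissible hb' hb.periodic (pow_ne_zero 2 hω0)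
    rw [← hup.eq_of_eqOn_Icc (hperiod C φ) hu] at hw
    refine ⟨fun h0 => ?_, g, hadm.congr hw, ?_⟩
    · obtain ⟨x, hx, hx'⟩ := hnz hC φ
      have h1 : u =ᵐ[volume] fun _ => (0 : ℝ) := hw.symm.trans h0
      rw [hup.eq_of_eqOn_Icc (hperiod C φ) hu,
        Continuous.ae_eq_iff_eq volume (hcont C ω φ) continuous_const] at h1
      exact hx' (congrFun h1 x)
    · rw [← hinv, inv_inv] at hen
      rw [← hen]
      refine integral_congr_circleVol (ae_restrict_of_ae ?_)
      filter_upwards [hw] with x hx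
      rw [hx]

end Reciprocal

end Wirtinger

theorem lemma2 (a b : ℝ → ℝ) (ha : Wirtinger.MemB a) (hb : Wirtinger.MemB b) :
    -- the best constant is well defined, and satisfies the estimate
    (IsLeast (Wirtinger.wirtingerConstants a b) (Wirtinger.bestConst a b) ∧
      Wirtinger.bestConst a b ≤
        ((1 / (2 * Real.pi) * ∫ x in (0 : ℝ)..(2 * Real.pi), Real.sqrt (a x / b x)) /
          (4 / Real.pi * Real.arctan
            ((essInf (fun x => a x * b x) volume / essSup (fun x => a x * b x) volume) ^
              (1 / 4 : ℝ)))) ^ 2) ∧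
    -- the change of variables is a homeomorphism, and it characterizes the maximizers
    (∃ θ : ℝ ≃ₜ ℝ, (∀ x : ℝ, θ.symm x = Wirtinger.tau a b x) ∧
      ∀ L : ℝ, 1 < L → Wirtinger.MemBL L (fun x => Real.sqrt (a x * b x)) →
        IsLUB (Wirtinger.normalizedConsts L)
          ((4 / Real.pi * Real.arctan (L ^ (-1 / 2 : ℝ))) ^ (-2 : ℤ)) ∧
        ((Wirtinger.normalizedConst a b = sSup (Wirtinger.normalizedConsts L) ∧
            sSup (Wirtinger.normalizedConsts L) =
              (4 / Real.pi * Real.arctan (L ^ (-1 / 2 : ℝ))) ^ (-2 : ℤ)) ↔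
          ∃ φ : ℝ, ∀ᵐ t ∂(volume.restrict (Set.Ioo 0 (2 * Real.pi))),
            a (θ t) * b (θ t) = Wirtinger.stepFun L (t + φ) ^ 2)) ∧
    -- the case of reciprocal weights
    (b =ᵐ[volume] (fun x => (a x)⁻¹) →
      Wirtinger.bestConst a b =
        ((2 * Real.pi)⁻¹ * ∫ x in (0 : ℝ)..(2 * Real.pi), a x) ^ 2 ∧
      ∀ w : ℝ → ℝ,
        (¬ w =ᵐ[volume] 0 ∧ ∃ g : ℝ → ℝ, Wirtinger.IsAdmissible a w g ∧
          ∫ x in (0 : ℝ)..(2 * Real.pi), a x * w x ^ 2 =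
            Wirtinger.bestConst a b * ∫ x in (0 : ℝ)..(2 * Real.pi), b x * g x ^ 2) ↔
        ∃ C φ : ℝ, C ≠ 0 ∧ w =ᵐ[volume] fun x =>
          C * Real.cos (2 * Real.pi * (∫ y in (0 : ℝ)..(2 * Real.pi), a y)⁻¹ *
            (∫ y in (0 : ℝ)..x, a y) + φ)) := by
  have ha' := ha.bddWeight
  have hb' := hb.bddWeight
  refine ⟨⟨(Wirtinger.bestConstSpec ha hb).isLeast, ?_⟩, ?_, fun hab =>
    ⟨Wirtinger.bestConst_of_reciprocal ha hb hab,
      Wirtinger.exists_admissible_eq_iff_of_reciprocal ha hb hab⟩⟩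
  · obtain ⟨κ, ρ, hκ, hρ, hρ1, hdef, h⟩ := Wirtinger.exists_bestConst_bound_params ha' hb'
    rw [← hdef]
    exact Wirtinger.bestConst_le ha hb hκ hρ hρ1 h
  · obtain ⟨θ, hθ, hmono, ⟨K, hK⟩, K', hK'⟩ := Wirtinger.exists_homeomorph_tau ha' hb'
    refine ⟨θ, hθ, fun L hL h => ?_⟩
    have hlub := (Wirtinger.isGreatest_normalizedConsts hL).isLUB
    have hsup := hlub.csSup_eq (Wirtinger.isGreatest_normalizedConsts hL).nonempty
    refine ⟨hlub, ?_⟩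
    rw [← Wirtinger.normalizedConst_eq_iff_exists_shift ha hb hθ hmono hK hK' hL h, hsup]
    exact and_iff_left rfl
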